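/- **Model.** A *randomized word RAM* with word length $w$ has registers and a fixed finite number of memories (arrays) of $w$-bit words; in one step it performs an arithmetic, comparison, bitwise or shift operation modulo $2^w$, a load or store, a branch, or draws a uniformly random word. Programs do not depend on the input or on $w$. All algorithms are Las Vegas: every halting run has the right output, and running times are expected. An algorithm may fix a constant $c$ and has to work for every $w\ge c\log_2(m+2)$, where $m$ is the input size (for 3SUM also the largest absolute value of an input number); its time bounds may not depend on $w$. We write $T(n)=\Omega(n^{b-o(1)})$ if there are $\delta(n)\to 0$ and $C>0$ with $T(n)\ge C\,n^{b-\delta(n)}$ for all sufficiently large $n$. **3SUM conjecture.** 3SUM: given a set $A$ of at most $n$ integers, decide whether there are distinct $x,y,z\in A$ with $x+y=z$. The conjecture: every Las Vegas algorithm for 3SUM has worst-case expected time $\Omega(n^{2-o(1)})$ on sets of at most $n$ integers. **SetDisjointness.** Preprocess two families $A,B$ of nonempty finite sets, with elements in a universe $\{0,\dots,u-1\}$ where $u$ is the sum of the set sizes, so as to answer on-line queries $(S,S')\in A\times B$: is $S\cap S'=\emptyset$? Queries may modify the memory. For instances whose sum of set sizes is at most $N$, let $t_p(N)$ be the worst-case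 expected preprocessing time and $t_q(N)$ the worst-case amortized expected query time, that is, the supremum over instances, admissible $w$ and nonempty query sequences fixed in advance of the expected total query time after preprocessing divided by the number of queries. (Both may be infinite.) **Theorem.** Assume the 3SUM conjecture. For every Las Vegas data structure for SetDisjointness: 1. for every real $0<\gamma<1$, $$t_p(N)+N^{\frac{1+\gamma}{2-\gamma}}\,t_q(N)=\Omega\left(N^{\frac{2}{2-\gamma}-o(1)}\right);$$ 2. in particular, if $t_q$ is bounded by a constant, then $t_p(N)=\Omega\left(N^{2-o(1)}\right)$. -/

import Mathlib

open Filter Topology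
open scoped ENNReal NNReal

noncomputable section

/-! ### A randomized word RAM

The machine has registers and finitely many named memories (arrays), all of whose cells hold
words of `w` bits; both are indexed by natural numbers, and a program mentions only finitely many
of them. A program is a finite text that does not depend on the input or on `w`; it is built
from the usual constant-time word instructions with sequencing, branching and loops.
Every elementary step costs one unit of time. -/

/-- Binary word operations. `lt` and `eq` return `1` for true and `0` for false. -/
inductive WordOp
  | add | sub | mul | div | mod | band | bor | bxor | shl | shr | lt | eq

/-- The value of an operation on `w`-bit words; all arithmetic is modulo `2 ^ w`
(and division by zero returns zero). -/
def WordOp.eval (w : ℕ) (o : WordOp) (y z : ℕ) : ℕ :=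
  (match o with
    | .add => y + z
    | .sub => y + (2 ^ w - z % 2 ^ w)
    | .mul => y * z
    | .div => y / z
    | .mod => y % z
    | .band => y &&& z
    | .bor => y ||| z
    | .bxor => y ^^^ z
    | .shl => y <<< z
    | .shr => y >>> z
    | .lt => if y < z then 1 else 0
    | .eq => if y = z then 1 else 0) % 2 ^ w

/-- Programs. Registers and memories are named by natural numbers.
* `const x k`: put the constant `k` into register `x`;
* `op o x y z`: put the result of `o` on the contents of `y` and `z` into `x`;
* `load x a y`: put into `x` the cell of memory `a` whose address is the content of `y`;
* `store a y x`: write the content of `x` to the cell of memory `a` addressed by `y`;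
* `rand x`: put a fresh uniformly random word into `x`;
* `ite x c d`: run `c` if the content of `x` is not zero, and `d` otherwise;
* `loop x c`: repeat `c` as long as the content of `x` is not zero. -/
inductive Prog
  | skip
  | const (x k : ℕ)
  | op (o : WordOp) (x y z : ℕ)
  | load (x a y : ℕ)
  | store (a y x : ℕ)
  | rand (x : ℕ)
  | seq (c d : Prog)
  | ite (x : ℕ) (c d : Prog)
  | loop (x : ℕ) (c : Prog)

/-- The contents of the registers and of the memories. -/
structure RamState where
  reg : ℕ → ℕ
  mem : ℕ → ℕ → ℕ

def RamState.setReg (s : RamState) (x v : ℕ) : RamState :=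
  { s with reg := Function.update s.reg x v }

def RamState.setMem (s : RamState) (a i v : ℕ) : RamState :=
  { s with mem := Function.update s.mem a (Function.update (s.mem a) i v) }

/-- A configuration: the programs that remain to be run, in this order, and the state.
It is halting when no program is left. -/
abbrev RamConfig := List Prog × RamState

/-- One step of the machine with word length `w`. -/
def ramStep (w : ℕ) : RamConfig → PMF RamConfig
  | ([], s) => PMF.pure ([], s)
  | (.skip :: K, s) => PMF.pure (K, s)
  | (.const x k :: K, s) => PMF.pure (K, s.setReg x (k % 2 ^ w))
  | (.op o x y z :: K, s) => PMF.pure (K, s.setReg x (o.eval w (s.reg y) (s.reg z)))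
  | (.load x a y :: K, s) => PMF.pure (K, s.setReg x (s.mem a (s.reg y)))
  | (.store a y x :: K, s) => PMF.pure (K, s.setMem a (s.reg y) (s.reg x))
  | (.rand x :: K, s) =>
      (PMF.uniformOfFinset (Finset.range (2 ^ w)) ⟨0, by simp⟩).map
        (fun v => (K, s.setReg x v))
  | (.seq c d :: K, s) => PMF.pure (c :: d :: K, s)
  | (.ite x c d :: K, s) => PMF.pure (if s.reg x ≠ 0 then c :: K else d :: K, s)
  | (.loop x c :: K, s) => PMF.pure (if s.reg x ≠ 0 then c :: .loop x c :: K else K, s)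

/-- The distribution of the configuration after `t` steps of the program `c` started in `s`. -/
def ramDist (w : ℕ) (c : Prog) (s : RamState) : ℕ → PMF RamConfig
  | 0 => PMF.pure ([c], s)
  | t + 1 => (ramDist w c s t).bind (ramStep w)

/-- The expected running time `∑ₜ Pr[the machine has not halted after t steps]`. -/
def expTime (w : ℕ) (c : Prog) (s : RamState) : ℝ≥0∞ :=
  ∑' t : ℕ, (ramDist w c s t).toOuterMeasure {κ | κ.1 ≠ []}

/-- `s'` is a possible final state of the program `c` started in `s`. -/
def MayEndIn (w : ℕ) (c : Prog) (s s' : RamState) : Prop :=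
  ∃ t, ([], s') ∈ (ramDist w c s t).support

/-- The probability that `c`, started in `s`, halts in the state `s'`. -/
def finalProb (w : ℕ) (c : Prog) (s s' : RamState) : ℝ≥0∞ :=
  ⨆ t, ramDist w c s t ([], s')

/-- The expected value of `f` at the final state (runs that do not halt contribute `0`). -/
def expFinal (w : ℕ) (c : Prog) (s : RamState) (f : RamState → ℝ≥0∞) : ℝ≥0∞ :=
  ∑' s', finalProb w c s s' * f s'

/-- `T(n) = Ω(n ^ (b - o(1)))`. -/
def IsOmegaPowSubLittleO (T : ℕ → ℝ≥0∞) (b : ℝ) : Prop :=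
  ∃ δ : ℕ → ℝ, Tendsto δ atTop (𝓝 0) ∧ ∃ C : ℝ, 0 < C ∧
    ∀ᶠ n : ℕ in atTop, ENNReal.ofReal (C * (n : ℝ) ^ (b - δ n)) ≤ T n

/-- The word length `w` is at least `c * log₂ (m + 2)`. -/
def WordsFit (c m w : ℕ) : Prop := (m + 2) ^ c ≤ 2 ^ w

/-! ### 3SUM -/

/-- A yes-instance: there are distinct `x`, `y`, `z` in the set with `x + y = z`. -/
def HasThreeSum (A : List ℤ) : Prop :=
  ∃ x ∈ A, ∃ y ∈ A, ∃ z ∈ A, x ≠ y ∧ x ≠ z ∧ y ≠ z ∧ x + y = z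

/-- The input: the number of elements in register `0`, the word length in register `1`, and
the elements, as words in two's complement, in memory `0`. Everything else is zero. -/
def threeSumInput (w : ℕ) (A : List ℤ) : RamState where
  reg r := if r = 0 then A.length else if r = 1 then w else 0
  mem a i := if a = 0 then (A.getD i 0 % 2 ^ w).toNat else 0

/-- `w` is an admissible word length for `A`: at least `c` times the logarithm of the number of
elements and of their magnitude. -/
def ThreeSumWordsFit (c : ℕ) (A : List ℤ) (w : ℕ) : Prop :=
  WordsFit c A.length w ∧ ∀ x ∈ A, WordsFit c x.natAbs w

/-- A Las Vegas algorithm for 3SUM on sets of integers, given as repetition-free lists in any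
order. On all word lengths from `c` times the bit length of the input numbers on, every
run that halts ends with the right answer in register `0` (nonzero means yes). -/
structure ThreeSumAlgorithm where
  prog : Prog
  c : ℕ
  correct : ∀ (A : List ℤ) (w : ℕ), A.Nodup → ThreeSumWordsFit c A w →
    ∀ s', MayEndIn w prog (threeSumInput w A) s' → (s'.reg 0 ≠ 0 ↔ HasThreeSum A)

/-- The worst-case expected running time on sets of at most `n` integers. -/
def ThreeSumAlgorithm.time (M : ThreeSumAlgorithm) (n : ℕ) : ℝ≥0∞ :=
  ⨆ (A : List ℤ) (w : ℕ) (_ : A.Nodup) (_ : A.length ≤ n) (_ : ThreeSumWordsFit M.c A w),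
    expTime w M.prog (threeSumInput w A)

/-- The 3SUM conjecture: 3SUM requires `Ω(n ^ (2 - o(1)))` time, even in expectation. -/
def ThreeSumConjecture : Prop :=
  ∀ M : ThreeSumAlgorithm, IsOmegaPowSubLittleO M.time 2

/-! ### Online SetDisjointness -/

/-- An instance: two indexed families `A`, `B` of nonempty finite sets, each given as a
repetition-free list in any order. The elements are named by natural numbers less than the
total size of the sets. -/
structure SetFamilies where
  A : List (List ℕ)
  B : List (List ℕ)
  nonempty : ∀ S ∈ A ++ B, S ≠ []
  nodup : ∀ S ∈ A ++ B, S.Nodup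
  lt_size : ∀ S ∈ A ++ B, ∀ x ∈ S, x < (A ++ B).flatten.length

/-- The sum of the set sizes. -/
def SetFamilies.size (I : SetFamilies) : ℕ := (I.A ++ I.B).flatten.length

/-- A query: a pair in `A × B`, given by the two indices. -/
abbrev SetFamilies.Query (I : SetFamilies) := Fin I.A.length × Fin I.B.length

/-- The queried sets are disjoint. -/
def SetFamilies.IsDisjoint (I : SetFamilies) (q : I.Query) : Prop :=
  List.Disjoint (I.A.get q.1) (I.B.get q.2)

/-- The input of the preprocessing: `|A|`, `|B|`, the total size and the word length in registers
`0` to `3`; memory `0` holds the elements of all sets of `A` and then of `B`, one set after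
another; cell `i` of memory `1` holds the position in memory `0` where the `i`-th set starts
(for `i = |A| + |B|`, the total size). Everything else is zero. -/
def SetFamilies.input (w : ℕ) (I : SetFamilies) : RamState where
  reg r := if r = 0 then I.A.length else if r = 1 then I.B.length
    else if r = 2 then I.size else if r = 3 then w else 0
  mem a i :=
    if a = 0 then (I.A ++ I.B).flatten.getD i 0
    else if a = 1 then
      if i ≤ (I.A ++ I.B).length then ((I.A ++ I.B).take i).flatten.length else 0
    else 0

/-- Pose a query: its two indices are put into registers `0` and `1`; everything else is left as
the data structure left it. -/
def SetFamilies.pose (I : SetFamilies) (q : I.Query) (s : RamState) : RamState :=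
  (s.setReg 0 q.1).setReg 1 q.2

/-- Started in `s`, every run of the query program on the sequence of queries answers each of
them correctly, in register `0` (nonzero means disjoint). Queries may modify the memory. -/
def AnswersCorrectly (w : ℕ) (query : Prog) (I : SetFamilies) :
    List I.Query → RamState → Prop
  | [], _ => True
  | q :: qs, s => ∀ s', MayEndIn w query (I.pose q s) s' →
      (s'.reg 0 ≠ 0 ↔ I.IsDisjoint q) ∧ AnswersCorrectly w query I qs s'

/-- The expected total time to answer a sequence of queries one after the other, from `s`. -/
def expQueriesTime (w : ℕ) (query : Prog) (I : SetFamilies) :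
    List I.Query → RamState → ℝ≥0∞
  | [], _ => 0
  | q :: qs, s => expTime w query (I.pose q s) +
      expFinal w query (I.pose q s) (expQueriesTime w query I qs)

/-- A Las Vegas data structure for SetDisjointness: a preprocessing program and a query program.
On all word lengths from a constant times `log N` on, every sequence of queries after
the preprocessing is answered without errors. -/
structure SetDisjointnessDS where
  prep : Prog
  query : Prog
  c : ℕ
  correct : ∀ (I : SetFamilies) (w : ℕ), WordsFit c I.size w →
    ∀ s, MayEndIn w prep (I.input w) s → ∀ qs, AnswersCorrectly w query I qs s

/-- The worst-case expected preprocessing time on instances of total size at most `N`. -/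
def SetDisjointnessDS.prepTime (D : SetDisjointnessDS) (N : ℕ) : ℝ≥0∞ :=
  ⨆ (I : SetFamilies) (w : ℕ) (_ : I.size ≤ N) (_ : WordsFit D.c I.size w),
    expTime w D.prep (I.input w)

/-- The amortized expected query time on instances of total size at most `N`: the largest
average, over a nonempty sequence of queries fixed in advance, of the expected time to answer
it after the preprocessing. -/
def SetDisjointnessDS.queryTime (D : SetDisjointnessDS) (N : ℕ) : ℝ≥0∞ :=
  ⨆ (I : SetFamilies) (w : ℕ) (_ : I.size ≤ N) (_ : WordsFit D.c I.size w)
    (qs : List I.Query) (_ : qs ≠ []),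
    expFinal w D.prep (I.input w) (expQueriesTime w D.query I qs) / (qs.length : ℝ≥0∞)

end

/-! A data structure for SetDisjointness is turned into an algorithm for 3SUM. The numbers are
padded to `P = 2^λ` keys, sorted, and cut into `R = 2^ρ` groups of `g = P / R` consecutive keys. For
a fixed number z, the pairs with sum z lie in group pairs on a monotone staircase of length `S = 2R
- 1` (`stair_complete`), so about `nR` questions remain: do two given groups contain elements x, y
with x + y = z?

The questions are asked modulo a random multiply-shift hash function h with `Q = q²` values, `q = g
2^β`. It is linear up to a rounding bit (`hash_add`), so true pairs are never lost. Writing h(z) =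
iq + j, the question becomes whether the first group's hash values shifted by -iq meet the negated
hash values of the second group shifted by j (`not_disjoint_iff`). Splitting h(z) into two digits
means that each group needs only q shifted copies instead of Q, and the total size is `N = O(g P
2^(2β))`.

Apart from at most `3n` degenerate questions (`card_degenerate_le`), a question that does not lead
to a solution is hit with probability at most `10 · 2^(-2β)` (`card_falsePositive_le`, via the
counting lemma `card_window_le`). A hit is checked in time O(g) by looking up partners of the
elements of the first group, and checking stops at the first genuine hit. Hence 3SUM costs one
preprocessing, nS queries and `O(P log P + N + PR + P² / 2^(2β))` further steps (`totalCost_le`).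

Now let R be about n^θ and 2^β about n^η, with small η > 0 and θ slightly above γ. Then N is about
n^κ with κ = 2 - θ + 2η ≤ 2 - γ, there are about n^(1+θ) queries, and the remaining work is
O(n^(2-2σ)) for some σ > 0. If the sum in the first claim were below N^(2/(2-γ)-ε), both
preprocessing and queries would be polynomially subquadratic in n, against the conjecture
(`tradeoff`). The second claim follows by letting γ tend to 1: constant query time makes the query
term negligible.

On the machine side, everything rests on one quantity, `cost w k f`: the expectation of k per step
plus f at the final state. The single estimate `reduction_cost` is used twice. With k = 0 and f the
indicator of a wrong answer it gives Las Vegas correctness, and with k = 1 and f = 0 it gives the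
running time. All queries are computed before the preprocessing is run, so for each choice of the
hash function they form a sequence fixed in advance, as the amortized query time demands. -/

set_option linter.unusedSimpArgs false

/-! ### Expected costs of configurations -/

namespace WordRam

/-- The distribution of the configuration `t` steps after `κ`. -/
noncomputable def distFrom (w : ℕ) (κ : RamConfig) : ℕ → PMF RamConfig
  | 0 => PMF.pure κ
  | t + 1 => (distFrom w κ t).bind (ramStep w)

theorem ramDist_eq_distFrom (w : ℕ) (c : Prog) (s : RamState) (t : ℕ) :
    ramDist w c s t = distFrom w ([c], s) t := by
  induction t with
  | zero => rfl
  | succ t ih => simp only [ramDist, distFrom, ih]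

theorem distFrom_succ' (w : ℕ) (κ : RamConfig) (t : ℕ) :
    distFrom w κ (t + 1) = (ramStep w κ).bind fun κ' => distFrom w κ' t := by
  induction t with
  | zero => simp [distFrom, PMF.pure_bind, PMF.bind_pure]
  | succ t ih =>
    rw [distFrom, ih, PMF.bind_bind]
    rfl

theorem tsum_pure_mul {α : Type*} (a : α) (F : α → ℝ≥0∞) :
    ∑' x, PMF.pure a x * F x = F a := by
  rw [tsum_eq_single a]
  · simp
  · intro b hb
    simp [PMF.pure_apply, hb]

theorem tsum_bind_mul {α β : Type*} (p : PMF α) (q : α → PMF β) (F : β → ℝ≥0∞) :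
    ∑' x, p.bind q x * F x = ∑' y, p y * ∑' x, q y x * F x := by
  simp only [PMF.bind_apply, ← ENNReal.tsum_mul_right, ← ENNReal.tsum_mul_left]
  rw [ENNReal.tsum_comm]
  simp only [mul_assoc]

theorem tsum_map_mul {α β : Type*} (p : PMF α) (g : α → β) (F : β → ℝ≥0∞) :
    ∑' x, p.map g x * F x = ∑' y, p y * F (g y) := by
  rw [PMF.map, tsum_bind_mul]
  simp only [Function.comp, tsum_pure_mul]

/-- The indicator of the configurations that are still running. -/
def running (κ : RamConfig) : ℝ≥0∞ := if κ.1 ≠ [] then 1 else 0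

/-- The value of `f` at a halting configuration, and `0` at the others. -/
def final (f : RamState → ℝ≥0∞) (κ : RamConfig) : ℝ≥0∞ := if κ.1 = [] then f κ.2 else 0

/-- The expected cost of the first `n` steps, at `k` per step, plus `f` at the final state. -/
noncomputable def costUpTo (w : ℕ) (k : ℝ≥0∞) (f : RamState → ℝ≥0∞) : ℕ → RamConfig → ℝ≥0∞
  | _, ([], s) => f s
  | 0, (_ :: _, _) => 0
  | n + 1, (c :: K, s) => k + ∑' κ', ramStep w (c :: K, s) κ' * costUpTo w k f n κ'

/-- The expected cost of a run, at `k` per step, plus `f` at the final state. -/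
noncomputable def cost (w : ℕ) (k : ℝ≥0∞) (f : RamState → ℝ≥0∞) (κ : RamConfig) : ℝ≥0∞ :=
  ⨆ n, costUpTo w k f n κ

variable {w : ℕ} {k : ℝ≥0∞} {f : RamState → ℝ≥0∞}

@[simp] theorem costUpTo_nil (n : ℕ) (s : RamState) : costUpTo w k f n ([], s) = f s := by
  cases n <;> simp [costUpTo]

@[simp] theorem cost_nil (s : RamState) : cost w k f ([], s) = f s := by
  simp [cost]

theorem costUpTo_le_cost (n : ℕ) (κ : RamConfig) : costUpTo w k f n κ ≤ cost w k f κ :=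
  le_iSup (fun n => costUpTo w k f n κ) n

theorem distFrom_nil (w : ℕ) (s : RamState) (t : ℕ) :
    distFrom w ([], s) t = PMF.pure ([], s) := by
  induction t with
  | zero => rfl
  | succ t ih => rw [distFrom, ih, PMF.pure_bind, ramStep]

/-- Links the recursion, which suits estimates that follow the program, with the distributions
behind `expTime` and `MayEndIn`: k is paid for each time at which the machine is still running, and
f on the mass that has halted. -/
theorem costUpTo_eq (n : ℕ) (κ : RamConfig) :
    costUpTo w k f n κ = k * ∑ t ∈ Finset.range n, ∑' κ', distFrom w κ t κ' * running κ'
      + ∑' κ', distFrom w κ n κ' * final f κ' := by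
  induction n generalizing κ with
  | zero =>
    rw [distFrom, tsum_pure_mul]
    obtain ⟨_ | ⟨c, K⟩, s⟩ := κ <;> simp [final, costUpTo]
  | succ n ih =>
    obtain ⟨_ | ⟨c, K⟩, s⟩ := κ
    · simp only [distFrom_nil, tsum_pure_mul]
      simp [running, final]
    · rw [costUpTo, Finset.sum_range_succ', distFrom_succ', tsum_bind_mul]
      simp only [ih, distFrom_succ' w _ _, tsum_bind_mul, mul_add, ENNReal.tsum_add]
      have h0 : ∑' κ', distFrom w (c :: K, s) 0 κ' * running κ' = 1 := by
        rw [distFrom, tsum_pure_mul]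
        simp [running]
      rw [h0, mul_one, add_comm _ k, add_assoc]
      congr 2
      rw [Finset.mul_sum]
      simp only [Finset.mul_sum]
      rw [Summable.tsum_finsetSum (fun _ _ => ENNReal.summable)]
      refine Finset.sum_congr rfl fun t _ => ?_
      rw [← ENNReal.tsum_mul_left]
      refine tsum_congr fun κ' => ?_
      ring

theorem toOuterMeasure_running (p : PMF RamConfig) :
    p.toOuterMeasure {κ | κ.1 ≠ []} = ∑' κ', p κ' * running κ' := by
  rw [PMF.toOuterMeasure_apply]
  refine tsum_congr fun κ => ?_
  by_cases h : κ.1 = [] <;> simp [running, h]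

theorem tsum_final (p : PMF RamConfig) (f : RamState → ℝ≥0∞) :
    ∑' κ', p κ' * final f κ' = ∑' s', p ([], s') * f s' := by
  have : Function.Injective (fun s : RamState => (([], s) : RamConfig)) := by
    intro a b h; simpa using h
  rw [← this.tsum_eq (f := fun κ' => p κ' * final f κ')]
  · simp [final]
  · intro κ hκ
    obtain ⟨_ | ⟨c, K⟩, s⟩ := κ
    · exact ⟨s, rfl⟩
    · simp [final] at hκ

theorem expTime_le_cost (w : ℕ) (c : Prog) (s : RamState) :
    expTime w c s ≤ cost w 1 0 ([c], s) := by
  rw [expTime, ENNReal.tsum_eq_iSup_nat]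
  refine iSup_mono fun n => ?_
  rw [costUpTo_eq, one_mul]
  simp only [ramDist_eq_distFrom, toOuterMeasure_running]
  exact le_self_add

/-- For k = 0 the cost is the expectation of f, a sum of nonnegative terms in which every reachable
final state has positive weight. This turns a cost bound into a statement about all halting runs. -/
theorem eq_zero_of_cost_eq_zero {c : Prog} {s s' : RamState}
    (h : cost w 0 f ([c], s) = 0) (hs : MayEndIn w c s s') : f s' = 0 := by
  obtain ⟨t, ht⟩ := hs
  rw [ramDist_eq_distFrom] at ht
  have h1 := (costUpTo_le_cost (w := w) (k := 0) (f := f) t ([c], s)).trans h.le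
  rw [costUpTo_eq, zero_mul, zero_add, tsum_final] at h1
  have h2 := (ENNReal.le_tsum s').trans h1
  simp only [nonpos_iff_eq_zero, mul_eq_zero] at h2
  exact h2.resolve_left ((PMF.mem_support_iff _ _).1 ht)

/-- The factor k stands in front of the times as well as of `g`, so for k = 0 these terms vanish
even if they are infinite. The hypothesis is restricted to reachable final states because only there
does the data structure guarantee anything. -/
theorem cost_le_expTime_add_expFinal {c : Prog} {s : RamState} {g : RamState → ℝ≥0∞}
    {v : ℝ≥0∞} (h : ∀ s', MayEndIn w c s s' → f s' ≤ k * g s' + v) :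
    cost w k f ([c], s) ≤ k * expTime w c s + k * expFinal w c s g + v := by
  refine iSup_le fun n => ?_
  rw [costUpTo_eq, tsum_final, add_assoc]
  refine add_le_add (mul_le_mul_right ?_ _) ?_
  · rw [expTime]
    simp only [ramDist_eq_distFrom, toOuterMeasure_running]
    exact ENNReal.sum_le_tsum _
  · calc ∑' s', distFrom w ([c], s) n ([], s') * f s'
        ≤ ∑' s', (k * (finalProb w c s s' * g s') + distFrom w ([c], s) n ([], s') * v) := by
          refine ENNReal.tsum_le_tsum fun s' => ?_
          by_cases h0 : distFrom w ([c], s) n ([], s') = 0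
          · simp [h0]
          · have hm : MayEndIn w c s s' :=
              ⟨n, by rw [ramDist_eq_distFrom, PMF.mem_support_iff]; exact h0⟩
            have hp : distFrom w ([c], s) n ([], s') ≤ finalProb w c s s' := by
              rw [← ramDist_eq_distFrom]
              exact le_iSup (fun t => ramDist w c s t ([], s')) n
            calc _ ≤ distFrom w ([c], s) n ([], s') * (k * g s' + v) := by gcongr; exact h s' hm
              _ = k * (distFrom w ([c], s) n ([], s') * g s')
                  + distFrom w ([c], s) n ([], s') * v := by ring
              _ ≤ _ := by gcongr
      _ = k * expFinal w c s g + (∑' s', distFrom w ([c], s) n ([], s')) * v := by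
          rw [ENNReal.tsum_add, ENNReal.tsum_mul_left, ENNReal.tsum_mul_right]; rfl
      -- The probability of having halted is at most one.
      _ ≤ k * expFinal w c s g + 1 * v := by
          gcongr
          rw [← (distFrom w ([c], s) n).tsum_coe]
          exact ENNReal.tsum_comp_le_tsum_of_injective
            (f := fun s' : RamState => (([], s') : RamConfig)) (fun a b h => by simpa using h) _
      _ = _ := by rw [one_mul]

theorem cost_cons_le (c : Prog) (K : List Prog) (s : RamState) :
    cost w k f (c :: K, s) ≤ k + ∑' κ', ramStep w (c :: K, s) κ' * cost w k f κ' := by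
  refine iSup_le fun n => ?_
  cases n with
  | zero => simp [costUpTo]
  | succ n =>
    rw [costUpTo]
    gcongr
    exact costUpTo_le_cost _ _

theorem cost_le_of_step_pure {c : Prog} {K : List Prog} {s : RamState} {κ : RamConfig}
    (h : ramStep w (c :: K, s) = PMF.pure κ) :
    cost w k f (c :: K, s) ≤ k + cost w k f κ := by
  refine (cost_cons_le c K s).trans ?_
  rw [h, tsum_pure_mul]

theorem cost_rand_le (x : ℕ) (K : List Prog) (s : RamState) :
    cost w k f (.rand x :: K, s) ≤
      k + ∑ v ∈ Finset.range (2 ^ w), (2 ^ w : ℝ≥0∞)⁻¹ * cost w k f (K, s.setReg x v) := by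
  refine (cost_cons_le _ K s).trans ?_
  gcongr
  rw [ramStep, tsum_map_mul, tsum_eq_sum (s := Finset.range (2 ^ w))]
  · refine Finset.sum_le_sum fun v hv => le_of_eq ?_
    congr 1
    refine (PMF.uniformOfFinset_apply_of_mem _ hv).trans ?_
    simp
  · intro v hv
    refine mul_eq_zero_of_left (PMF.uniformOfFinset_apply_of_notMem _ hv) _

theorem ramStep_append (c : Prog) (J K : List Prog) (s : RamState) :
    ramStep w (c :: J ++ K, s) = (ramStep w (c :: J, s)).map fun κ => (κ.1 ++ K, κ.2) := by
  cases c <;> simp only [List.cons_append, ramStep, PMF.pure_map, PMF.map_comp]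
  all_goals try split_ifs
  all_goals rfl

/-- The run follows that of `J` until `J` is exhausted. Whatever number of steps is then left for
`K`, it costs no more than a complete run of `K`. -/
theorem cost_append_le (J K : List Prog) (s : RamState) :
    cost w k f (J ++ K, s) ≤ cost w k (fun s' => cost w k f (K, s')) (J, s) := by
  refine iSup_le fun n => le_trans ?_ (costUpTo_le_cost n _)
  induction n generalizing J s with
  | zero =>
    cases J with
    | nil => simpa using costUpTo_le_cost _ _
    | cons c J => simp [costUpTo]
  | succ n ih =>
    cases J with
    | nil => simpa using costUpTo_le_cost _ _
    | cons c J =>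
      rw [costUpTo, List.cons_append, costUpTo, ← List.cons_append, ramStep_append, tsum_map_mul]
      gcongr
      exact ih _ _

/-! ### Renaming registers and memories -/

/-- The program with registers shifted by `50` and memories shifted by `20`. -/
def rename : Prog → Prog
  | .skip => .skip
  | .const x k => .const (x + 50) k
  | .op o x y z => .op o (x + 50) (y + 50) (z + 50)
  | .load x a y => .load (x + 50) (a + 20) (y + 50)
  | .store a y x => .store (a + 20) (y + 50) (x + 50)
  | .rand x => .rand (x + 50)
  | .seq c d => .seq (rename c) (rename d)
  | .ite x c d => .ite (x + 50) (rename c) (rename d)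
  | .loop x c => .loop (x + 50) (rename c)

/-- The state with registers below `50` and memories below `20` from `e`, and the others
from `d`. -/
def glue (e d : RamState) : RamState where
  reg r := if r < 50 then e.reg r else d.reg (r - 50)
  mem a := if a < 20 then e.mem a else d.mem (a - 20)

/-- The part of the state a renamed program works on. -/
def high (s : RamState) : RamState where
  reg r := s.reg (r + 50)
  mem a := s.mem (a + 20)

theorem glue_high (s : RamState) : glue s (high s) = s := by
  cases s
  simp only [glue, high, RamState.mk.injEq]
  constructor <;> funext r <;> split_ifs <;> congr <;> omega

@[simp] theorem high_glue (e d : RamState) : high (glue e d) = d := by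
  cases d
  simp [glue, high]

theorem glue_setReg (e d : RamState) (x v : ℕ) :
    (glue e d).setReg (x + 50) v = glue e (d.setReg x v) := by
  simp only [glue, RamState.setReg, RamState.mk.injEq, and_true]
  funext r
  by_cases h : r = x + 50
  · subst h; simp
  · rw [Function.update_of_ne h]
    split_ifs
    · rfl
    · rw [Function.update_of_ne]; omega

theorem glue_setMem (e d : RamState) (a i v : ℕ) :
    (glue e d).setMem (a + 20) i v = glue e (d.setMem a i v) := by
  simp only [glue, RamState.setMem, RamState.mk.injEq, true_and]
  funext r
  by_cases h : r = a + 20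
  · subst h; simp
  · rw [Function.update_of_ne h]
    split_ifs
    · rfl
    · rw [Function.update_of_ne]; omega

theorem glue_reg_add (e d : RamState) (x : ℕ) : (glue e d).reg (x + 50) = d.reg x := by
  simp [glue]

theorem glue_mem_add (e d : RamState) (a : ℕ) : (glue e d).mem (a + 20) = d.mem a := by
  simp [glue]

/-- A renamed program neither reads nor writes registers below 50 or memories below 20. Its steps
therefore commute with gluing on a fixed low part, and it can be run inside a larger program. -/
theorem ramStep_rename (K : List Prog) (e d : RamState) :
    ramStep w (K.map rename, glue e d) =
      (ramStep w (K, d)).map fun κ => (κ.1.map rename, glue e κ.2) := by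
  cases K with
  | nil => simp [ramStep, PMF.pure_map]
  | cons c K =>
    cases c <;> simp only [List.map_cons, rename, ramStep, PMF.pure_map, PMF.map_comp,
      glue_setReg, glue_setMem, glue_reg_add, glue_mem_add]
    all_goals try split_ifs
    all_goals rfl

theorem cost_rename (K : List Prog) (e d : RamState) :
    cost w k f (K.map rename, glue e d) = cost w k (fun d' => f (glue e d')) (K, d) := by
  refine iSup_congr fun n => ?_
  induction n generalizing K d with
  | zero => cases K <;> simp [costUpTo]
  | succ n ih =>
    cases K with
    | nil => simp
    | cons c K =>
      rw [List.map_cons, costUpTo, ← List.map_cons, ramStep_rename, tsum_map_mul, costUpTo]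
      simp only [ih]

theorem cost_rename_le {c : Prog} {K : List Prog} {s : RamState} {g : RamState → ℝ≥0∞}
    {v : ℝ≥0∞}
    (h : ∀ d', MayEndIn w c (high s) d' → cost w k f (K, glue s d') ≤ k * g d' + v) :
    cost w k f (rename c :: K, s) ≤
      k * expTime w c (high s) + k * expFinal w c (high s) g + v := by
  have h1 := cost_append_le (w := w) (k := k) (f := f) [rename c] K s
  refine h1.trans ?_
  have h2 := cost_rename (w := w) (k := k) (f := fun s' => cost w k f (K, s')) [c] s (high s)
  rw [glue_high] at h2
  rw [show [rename c] = [c].map rename from rfl, h2]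
  exact cost_le_expTime_add_expFinal h

end WordRam

/-! ### A structured language, its compilation to the word RAM, and its program logic. -/

namespace WordRam

/-! ### Deterministic runs -/

/-- `BigStep w c s s' t`: the program `c`, started in `s`, halts in `s'` after exactly `t` steps,
without drawing random words. -/
inductive BigStep (w : ℕ) : Prog → RamState → RamState → ℕ → Prop
  | const (x k s) : BigStep w (.const x k) s (s.setReg x (k % 2 ^ w)) 1
  | op (o x y z s) : BigStep w (.op o x y z) s (s.setReg x (o.eval w (s.reg y) (s.reg z))) 1
  | load (x a y s) : BigStep w (.load x a y) s (s.setReg x (s.mem a (s.reg y))) 1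
  | store (a y x s) : BigStep w (.store a y x) s (s.setMem a (s.reg y) (s.reg x)) 1
  | seq {c d s s₁ s₂ t₁ t₂} : BigStep w c s s₁ t₁ → BigStep w d s₁ s₂ t₂ →
      BigStep w (.seq c d) s s₂ (t₁ + t₂ + 1)
  | iteT {x c d s s₁ t} : s.reg x ≠ 0 → BigStep w c s s₁ t → BigStep w (.ite x c d) s s₁ (t + 1)
  | iteF {x c d s s₁ t} : s.reg x = 0 → BigStep w d s s₁ t → BigStep w (.ite x c d) s s₁ (t + 1)
  | loopT {x c s s₁ s₂ t₁ t₂} : s.reg x ≠ 0 → BigStep w c s s₁ t₁ →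
      BigStep w (.loop x c) s₁ s₂ t₂ → BigStep w (.loop x c) s s₂ (t₁ + t₂ + 1)
  | loopF {x c s} : s.reg x = 0 → BigStep w (.loop x c) s s 1

theorem BigStep.cost_le {w : ℕ} {c : Prog} {s s' : RamState} {t : ℕ} (h : BigStep w c s s' t)
    {k : ℝ≥0∞} {f : RamState → ℝ≥0∞} (K : List Prog) :
    cost w k f (c :: K, s) ≤ k * t + cost w k f (K, s') := by
  induction h generalizing K with
  | const | op | load | store =>
    refine (cost_le_of_step_pure (by rw [ramStep])).trans (by simp)
  | @seq c d s s₁ s₂ t₁ t₂ _ _ ih₁ ih₂ =>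
    calc _ ≤ k + cost w k f (c :: d :: K, s) := cost_le_of_step_pure (by rw [ramStep])
      _ ≤ k + (k * t₁ + (k * t₂ + cost w k f (K, s₂))) := by
        gcongr; exact (ih₁ _).trans (by gcongr; exact ih₂ _)
      _ = _ := by push_cast; ring
  | @iteT x c d s s₁ t hx _ ih =>
    calc _ ≤ k + cost w k f (c :: K, s) := cost_le_of_step_pure (by rw [ramStep, if_pos hx])
      _ ≤ k + (k * t + cost w k f (K, s₁)) := by gcongr; exact ih _
      _ = _ := by push_cast; ring
  | @iteF x c d s s₁ t hx _ ih =>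
    calc _ ≤ k + cost w k f (d :: K, s) :=
          cost_le_of_step_pure (by rw [ramStep, if_neg (not_not.2 hx)])
      _ ≤ k + (k * t + cost w k f (K, s₁)) := by gcongr; exact ih _
      _ = _ := by push_cast; ring
  | @loopT x c s s₁ s₂ t₁ t₂ hx _ _ ih₁ ih₂ =>
    calc _ ≤ k + cost w k f (c :: .loop x c :: K, s) :=
          cost_le_of_step_pure (by rw [ramStep, if_pos hx])
      _ ≤ k + (k * t₁ + (k * t₂ + cost w k f (K, s₂))) := by
        gcongr; exact (ih₁ _).trans (by gcongr; exact ih₂ _)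
      _ = _ := by push_cast; ring
  | @loopF x c s hx =>
    calc _ ≤ k + cost w k f (K, s) :=
          cost_le_of_step_pure (by rw [ramStep, if_neg (not_not.2 hx)])
      _ = _ := by push_cast; ring

/-! ### A while language with expressions

Expressions are evaluated with the help of the registers `40` to `49` and memory `19`. -/

/-- Expressions over registers and memories. -/
inductive Ex
  | reg (r : ℕ)
  | lit (k : ℕ)
  | bin (o : WordOp) (e₁ e₂ : Ex)
  | ld (a : ℕ) (e : Ex)

/-- The value of an expression. -/
def Ex.val (w : ℕ) (s : RamState) : Ex → ℕ
  | .reg r => s.reg r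
  | .lit k => k % 2 ^ w
  | .bin o e₁ e₂ => o.eval w (e₁.val w s) (e₂.val w s)
  | .ld a e => s.mem a (e.val w s)

/-- Evaluate an expression into register `t`, using the registers from `t` on. -/
def Ex.comp : Ex → ℕ → Prog
  | .reg r, t => .seq (.store 19 t r) (.load t 19 t)
  | .lit k, t => .const t k
  | .bin o e₁ e₂, t => .seq (e₁.comp t) (.seq (e₂.comp (t + 1)) (.op o t t (t + 1)))
  | .ld a e, t => .seq (e.comp t) (.load t a t)

/-- The evaluation time of an expression. -/
def Ex.wt : Ex → ℕ
  | .reg _ => 3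
  | .lit _ => 1
  | .bin _ e₁ e₂ => e₁.wt + (e₂.wt + 1 + 1) + 1
  | .ld _ e => e.wt + 1 + 1

/-- The registers below `40` and from `50` on. -/
def VisReg (r : ℕ) : Prop := r < 40 ∨ 50 ≤ r

instance : DecidablePred VisReg := fun _ => inferInstanceAs (Decidable (_ ∨ _))

/-- The expression mentions no scratch register or memory, and can be evaluated with the scratch
registers from `t` on. -/
def Ex.Ok : Ex → ℕ → Prop
  | .reg r, t => VisReg r ∧ t < 50
  | .lit _, t => t < 50
  | .bin _ e₁ e₂, t => e₁.Ok t ∧ e₂.Ok (t + 1)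
  | .ld a e, t => a ≠ 19 ∧ e.Ok t

instance Ex.decidableOk : ∀ (e : Ex) (t : ℕ), Decidable (e.Ok t)
  | .reg _, _ => inferInstanceAs (Decidable (_ ∧ _))
  | .lit _, t => inferInstanceAs (Decidable (t < 50))
  | .bin _ e₁ e₂, t =>
      have := Ex.decidableOk e₁ t
      have := Ex.decidableOk e₂ (t + 1)
      inferInstanceAs (Decidable (_ ∧ _))
  | .ld _ e, t =>
      have := Ex.decidableOk e t
      inferInstanceAs (Decidable (_ ∧ _))

/-- The states agree outside the scratch registers and memory. -/
def Sim (s₁ s : RamState) : Prop :=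
  (∀ r, VisReg r → s₁.reg r = s.reg r) ∧ ∀ a, a ≠ 19 → s₁.mem a = s.mem a

theorem Sim.rfl {s : RamState} : Sim s s := ⟨fun _ _ => Eq.refl _, fun _ _ => Eq.refl _⟩

@[simp] theorem setReg_reg (s : RamState) (x v r : ℕ) :
    (s.setReg x v).reg r = if r = x then v else s.reg r := by
  simp [RamState.setReg, Function.update_apply]

@[simp] theorem setReg_mem (s : RamState) (x v : ℕ) : (s.setReg x v).mem = s.mem := rfl

@[simp] theorem setMem_reg (s : RamState) (a i v : ℕ) : (s.setMem a i v).reg = s.reg := rfl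

@[simp] theorem setMem_mem (s : RamState) (a i v b : ℕ) :
    (s.setMem a i v).mem b = if b = a then Function.update (s.mem a) i v else s.mem b := by
  simp [RamState.setMem, Function.update_apply]

theorem Sim.setReg {s₁ s : RamState} (h : Sim s₁ s) (x v : ℕ) :
    Sim (s₁.setReg x v) (s.setReg x v) := by
  refine ⟨fun r hr => ?_, fun a ha => h.2 a ha⟩
  simp only [setReg_reg, h.1 r hr]

theorem Sim.setMem {s₁ s : RamState} (h : Sim s₁ s) (a i v : ℕ) :
    Sim (s₁.setMem a i v) (s.setMem a i v) := by
  refine ⟨fun r hr => h.1 r hr, fun b hb => ?_⟩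
  simp only [setMem_mem]
  split_ifs with hba
  · rw [h.2 a (hba ▸ hb)]
  · exact h.2 b hb

theorem Sim.setReg_left {s₁ s : RamState} (h : Sim s₁ s) {x : ℕ} (hx : ¬ VisReg x) (v : ℕ) :
    Sim (s₁.setReg x v) s := by
  refine ⟨fun r hr => ?_, fun a ha => h.2 a ha⟩
  rw [setReg_reg, if_neg, h.1 r hr]
  rintro rfl
  exact hx hr

theorem Sim.setMem_left {s₁ s : RamState} (h : Sim s₁ s) (i v : ℕ) :
    Sim (s₁.setMem 19 i v) s := by
  refine ⟨fun r hr => h.1 r hr, fun a ha => ?_⟩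
  rw [setMem_mem, if_neg ha, h.2 a ha]

theorem Ex.Ok.lt {e : Ex} {t : ℕ} (he : e.Ok t) : t < 50 := by
  induction e generalizing t with
  | reg r => exact he.2
  | lit k => exact he
  | bin o e₁ e₂ ih₁ ih₂ => exact ih₁ he.1
  | ld a e ih => exact ih he.2

/-- Scratch registers are used as a stack: preserving the registers below `t` is what keeps the left
operand of a binary operation alive while the right one is evaluated from `t + 1` on. -/
theorem Ex.comp_bigStep (w : ℕ) {e : Ex} {t : ℕ} (he : e.Ok t) (ht : 40 ≤ t) {s₁ s : RamState}
    (h : Sim s₁ s) :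
    ∃ s', BigStep w (e.comp t) s₁ s' e.wt ∧ Sim s' s ∧ s'.reg t = e.val w s ∧
      ∀ r, r < t → s'.reg r = s₁.reg r := by
  have nvis : ∀ {u}, 40 ≤ u → u < 50 → ¬ VisReg u := by unfold VisReg; omega
  induction e generalizing t s₁ with
  | reg r =>
    -- A register is copied through memory 19, at whatever address register `t` happens to contain.
    refine ⟨_, .seq (.store 19 t r s₁) (.load t 19 t _),
      (h.setMem_left _ _).setReg_left (nvis ht he.2) _, ?_, fun u hu => ?_⟩
    · simp [Ex.val, h.1 r he.1]
    · simp [hu.ne]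
  | lit k =>
    refine ⟨_, .const t k s₁, h.setReg_left (nvis ht he) _, by simp [Ex.val], fun u hu => ?_⟩
    simp [hu.ne]
  | bin o e₁ e₂ ih₁ ih₂ =>
    obtain ⟨s₂, hb₂, hs₂, hv₂, hr₂⟩ := ih₁ he.1 ht h
    obtain ⟨s₃, hb₃, hs₃, hv₃, hr₃⟩ := ih₂ he.2 (by omega) hs₂
    refine ⟨_, .seq hb₂ (.seq hb₃ (.op o t t (t + 1) s₃)),
      hs₃.setReg_left (nvis ht he.1.lt) _, ?_, fun u hu => ?_⟩
    · simp [Ex.val, hv₃, hr₃ t (by omega), hv₂]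
    · rw [setReg_reg, if_neg hu.ne, hr₃ u (by omega), hr₂ u hu]
  | ld a e ih =>
    obtain ⟨s₂, hb₂, hs₂, hv₂, hr₂⟩ := ih he.2 ht h
    refine ⟨_, .seq hb₂ (.load t a t s₂), hs₂.setReg_left (nvis ht he.2.lt) _, ?_,
      fun u hu => ?_⟩
    · simp [Ex.val, hv₂, hs₂.2 a he.1]
    · rw [setReg_reg, if_neg hu.ne, hr₂ u hu]

/-- Commands. -/
inductive Cmd
  | assign (x : ℕ) (e : Ex)
  | store (a : ℕ) (e₁ e₂ : Ex)
  | seq (c d : Cmd)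
  | ite (e : Ex) (c d : Cmd)
  | while (e : Ex) (c : Cmd)

/-- The program that carries out a command. -/
def Cmd.comp : Cmd → Prog
  | .assign x e => .seq (e.comp 40) (.seq (.store 19 40 40) (.load x 19 40))
  | .store a e₁ e₂ => .seq (e₁.comp 40) (.seq (e₂.comp 41) (.store a 40 41))
  | .seq c d => .seq c.comp d.comp
  | .ite e c d => .seq (e.comp 40) (.ite 40 c.comp d.comp)
  | .while e c => .seq (e.comp 40) (.loop 40 (.seq c.comp (e.comp 40)))

/-- A bound for the number of machine steps per step of a command. -/
def Cmd.wt : Cmd → ℕ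
  | .assign _ e => e.wt + 4
  | .store _ e₁ e₂ => e₁.wt + e₂.wt + 3
  | .seq c d => c.wt + d.wt + 1
  | .ite e c d => e.wt + c.wt + d.wt + 2
  | .while e c => e.wt + c.wt + 3

/-- The command does not touch scratch registers and memory. -/
def Cmd.Ok : Cmd → Prop
  | .assign x e => VisReg x ∧ e.Ok 40
  | .store a e₁ e₂ => a ≠ 19 ∧ e₁.Ok 40 ∧ e₂.Ok 41
  | .seq c d => c.Ok ∧ d.Ok
  | .ite e c d => e.Ok 40 ∧ c.Ok ∧ d.Ok
  | .while e c => e.Ok 40 ∧ c.Ok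

instance Cmd.decidableOk : ∀ c : Cmd, Decidable c.Ok
  | .assign _ _ => inferInstanceAs (Decidable (_ ∧ _))
  | .store _ _ _ => inferInstanceAs (Decidable (_ ∧ _ ∧ _))
  | .seq c d =>
      have := Cmd.decidableOk c
      have := Cmd.decidableOk d
      inferInstanceAs (Decidable (_ ∧ _))
  | .ite _ c d =>
      have := Cmd.decidableOk c
      have := Cmd.decidableOk d
      inferInstanceAs (Decidable (_ ∧ _ ∧ _))
  | .while _ c =>
      have := Cmd.decidableOk c
      inferInstanceAs (Decidable (_ ∧ _))

/-- `Run w c s s' t`: the command `c`, started in `s`, ends in `s'` after `t` assignments, stores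
and tests. -/
inductive Run (w : ℕ) : Cmd → RamState → RamState → ℕ → Prop
  | assign (x e s) : Run w (.assign x e) s (s.setReg x (e.val w s)) 1
  | store (a e₁ e₂ s) : Run w (.store a e₁ e₂) s (s.setMem a (e₁.val w s) (e₂.val w s)) 1
  | seq {c d s s₁ s₂ t₁ t₂} : Run w c s s₁ t₁ → Run w d s₁ s₂ t₂ →
      Run w (.seq c d) s s₂ (t₁ + t₂)
  | iteT {e c d s s₁ t} : e.val w s ≠ 0 → Run w c s s₁ t → Run w (.ite e c d) s s₁ (t + 1)
  | iteF {e c d s s₁ t} : e.val w s = 0 → Run w d s s₁ t → Run w (.ite e c d) s s₁ (t + 1)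
  | whileT {e c s s₁ s₂ t₁ t₂} : e.val w s ≠ 0 → Run w c s s₁ t₁ →
      Run w (.while e c) s₁ s₂ t₂ → Run w (.while e c) s s₂ (t₁ + t₂ + 1)
  | whileF {e c s} : e.val w s = 0 → Run w (.while e c) s s 1

theorem Run.pos {w : ℕ} {c : Cmd} {s s' : RamState} {t : ℕ} (h : Run w c s s' t) : 0 < t := by
  induction h <;> omega

/-- Each step of a command costs a bounded number of machine steps. The bound can be purely
multiplicative because every run takes at least one step (`Run.pos`), which pays for the overhead of
control instructions. -/
theorem Run.bigStep {w : ℕ} {c : Cmd} {s s' : RamState} {t : ℕ} (h : Run w c s s' t)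
    (hc : c.Ok) {s₁ : RamState} (hs : Sim s₁ s) :
    ∃ s₁' t', BigStep w c.comp s₁ s₁' t' ∧ Sim s₁' s' ∧ t' ≤ c.wt * t := by
  induction h generalizing s₁ with
  | assign x e s =>
    obtain ⟨s₂, hb, hs₂, hv, -⟩ := Ex.comp_bigStep w hc.2 le_rfl hs
    refine ⟨_, _, .seq hb (.seq (.store 19 40 40 s₂) (.load x 19 40 _)), ?_, ?_⟩
    · simp only [setMem_mem, setMem_reg, if_true, Function.update_self, hv]
      exact (hs₂.setMem_left _ _).setReg _ _
    · simp [Cmd.wt]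
  | store a e₁ e₂ s =>
    obtain ⟨s₂, hb, hs₂, hv, -⟩ := Ex.comp_bigStep w hc.2.1 le_rfl hs
    obtain ⟨s₃, hb₃, hs₃, hv₃, hr₃⟩ := Ex.comp_bigStep w hc.2.2 (by norm_num) hs₂
    refine ⟨_, _, .seq hb (.seq hb₃ (.store a 40 41 s₃)), ?_, ?_⟩
    · rw [hv₃, hr₃ 40 (by norm_num), hv]
      exact hs₃.setMem _ _ _
    · simp only [Cmd.wt]; omega
  | @seq c d s s₁ s₂ t₁ t₂ hr₁ hr₂ ih₁ ih₂ =>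
    obtain ⟨u₁, v₁, hb₁, hs₁, hv₁⟩ := ih₁ hc.1 hs
    obtain ⟨u₂, v₂, hb₂, hs₂, hv₂⟩ := ih₂ hc.2 hs₁
    refine ⟨_, _, .seq hb₁ hb₂, hs₂, ?_⟩
    have := hr₁.pos
    simp only [Cmd.wt]
    nlinarith
  | @iteT e c d s s₁ t he hr ih =>
    obtain ⟨s₂, hb, hs₂, hv, -⟩ := Ex.comp_bigStep w hc.1 le_rfl hs
    obtain ⟨u₁, v₁, hb₁, hs₁, hv₁⟩ := ih hc.2.1 hs₂
    refine ⟨_, _, .seq hb (.iteT (by rwa [hv]) hb₁), hs₁, ?_⟩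
    simp only [Cmd.wt]
    nlinarith
  | @iteF e c d s s₁ t he hr ih =>
    obtain ⟨s₂, hb, hs₂, hv, -⟩ := Ex.comp_bigStep w hc.1 le_rfl hs
    obtain ⟨u₁, v₁, hb₁, hs₁, hv₁⟩ := ih hc.2.2 hs₂
    refine ⟨_, _, .seq hb (.iteF (by rwa [hv]) hb₁), hs₁, ?_⟩
    simp only [Cmd.wt]
    nlinarith
  | @whileT e c s s₁ s₂ t₁ t₂ he hr₁ hr₂ ih₁ ih₂ =>
    obtain ⟨u, hb, hs₂, hv, -⟩ := Ex.comp_bigStep w hc.1 le_rfl hs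
    obtain ⟨u₁, v₁, hb₁, hs₁, hv₁⟩ := ih₁ hc.2 hs₂
    obtain ⟨u₂, v₂, hb₂, hs₂, hv₂⟩ := ih₂ hc hs₁
    -- The compiled rest of the loop begins by evaluating the test. This evaluation is split off and
    -- becomes the end of the first round's body.
    cases hb₂ with
    | @seq _ _ _ m _ t₃ t₄ hb₃ hb₄ =>
    refine ⟨_, _, .seq hb (.loopT (by rwa [hv]) (.seq hb₁ hb₃) hb₄), hs₂, ?_⟩
    have := hr₁.pos
    simp only [Cmd.wt] at hv₂ ⊢
    nlinarith
  | @whileF e c s he =>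
    obtain ⟨s₂, hb, hs₂, hv, -⟩ := Ex.comp_bigStep w hc.1 le_rfl hs
    refine ⟨_, _, .seq hb (.loopF (by rwa [hv])), hs₂, ?_⟩
    simp only [Cmd.wt]
    omega

/-! ### Frames -/

/-- The registers a command assigns. -/
def Cmd.regs : Cmd → List ℕ
  | .assign x _ => [x]
  | .store _ _ _ => []
  | .seq c d => c.regs ++ d.regs
  | .ite _ c d => c.regs ++ d.regs
  | .while _ c => c.regs

/-- The memories a command stores to. -/
def Cmd.mems : Cmd → List ℕ
  | .assign _ _ => []
  | .store a _ _ => [a]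
  | .seq c d => c.mems ++ d.mems
  | .ite _ c d => c.mems ++ d.mems
  | .while _ c => c.mems

/-- Registers and memories that the command does not change have the same contents. -/
def Frame (c : Cmd) (s s' : RamState) : Prop :=
  (∀ r, r ∉ c.regs → s'.reg r = s.reg r) ∧ ∀ a, a ∉ c.mems → s'.mem a = s.mem a

theorem Frame.rfl {c : Cmd} {s : RamState} : Frame c s s :=
  ⟨fun _ _ => Eq.refl _, fun _ _ => Eq.refl _⟩

theorem Frame.trans {c : Cmd} {s s₁ s₂ : RamState} (h : Frame c s s₁) (h' : Frame c s₁ s₂) :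
    Frame c s s₂ :=
  ⟨fun r hr => (h'.1 r hr).trans (h.1 r hr), fun a ha => (h'.2 a ha).trans (h.2 a ha)⟩

theorem Frame.mono {c d : Cmd} {s s₁ : RamState} (h : Frame c s s₁)
    (hr : ∀ r, r ∉ d.regs → r ∉ c.regs) (hm : ∀ a, a ∉ d.mems → a ∉ c.mems) : Frame d s s₁ :=
  ⟨fun r h' => h.1 r (hr r h'), fun a h' => h.2 a (hm a h')⟩

theorem Run.frame {w : ℕ} {c : Cmd} {s s' : RamState} {t : ℕ} (h : Run w c s s' t) :
    Frame c s s' := by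
  induction h with
  | assign x e s =>
    refine ⟨fun r hr => ?_, fun a _ => rfl⟩
    simp only [Cmd.regs, List.mem_singleton] at hr
    simp [hr]
  | store b e₁ e₂ s =>
    refine ⟨fun r hr => rfl, fun a ha => ?_⟩
    simp only [Cmd.mems, List.mem_singleton] at ha
    simp [ha]
  | seq _ _ ih₁ ih₂ =>
    refine (ih₁.mono ?_ ?_).trans (ih₂.mono ?_ ?_) <;> simp +contextual [Cmd.regs, Cmd.mems]
  | iteT _ _ ih | iteF _ _ ih => refine ih.mono ?_ ?_ <;> simp +contextual [Cmd.regs, Cmd.mems]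
  | whileT _ _ _ ih₁ ih₂ => exact (ih₁.mono (fun _ => id) (fun _ => id)).trans ih₂
  | whileF _ => exact .rfl

/-! ### Total correctness with time bounds -/

/-- Started in `s`, the command ends within `T` steps in a state that satisfies `Q`. -/
def Tri (w : ℕ) (c : Cmd) (s : RamState) (T : ℕ) (Q : RamState → Prop) : Prop :=
  ∃ s' t, Run w c s s' t ∧ t ≤ T ∧ Q s'

variable {w : ℕ} {c d : Cmd} {s : RamState} {Q : RamState → Prop} {T T₁ T₂ : ℕ}

theorem Tri.assign {x : ℕ} {e : Ex} (h : Q (s.setReg x (e.val w s))) :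
    Tri w (.assign x e) s 1 Q := ⟨_, _, .assign x e s, le_rfl, h⟩

theorem Tri.store {a : ℕ} {e₁ e₂ : Ex} (h : Q (s.setMem a (e₁.val w s) (e₂.val w s))) :
    Tri w (.store a e₁ e₂) s 1 Q := ⟨_, _, .store a e₁ e₂ s, le_rfl, h⟩

theorem Tri.seq (h : Tri w c s T₁ fun s₁ => Tri w d s₁ T₂ Q) : Tri w (.seq c d) s (T₁ + T₂) Q := by
  obtain ⟨s₁, t₁, h₁, ht₁, s₂, t₂, h₂, ht₂, hQ⟩ := h
  exact ⟨s₂, _, .seq h₁ h₂, by omega, hQ⟩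

theorem Tri.assign_seq {x v : ℕ} {e : Ex} (hv : e.val w s = v) (h : Tri w d (s.setReg x v) T Q) :
    Tri w (.seq (.assign x e) d) s (T + 1) Q := by
  rw [add_comm]
  exact Tri.seq (Tri.assign (by rwa [hv]))

theorem Tri.store_seq {a i v : ℕ} {e₁ e₂ : Ex} (hi : e₁.val w s = i) (hv : e₂.val w s = v)
    (h : Tri w d (s.setMem a i v) T Q) :
    Tri w (.seq (.store a e₁ e₂) d) s (T + 1) Q := by
  rw [add_comm]
  exact Tri.seq (Tri.store (by rwa [hi, hv]))

theorem Tri.assign' {x v : ℕ} {e : Ex} (hv : e.val w s = v) (h : Q (s.setReg x v)) :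
    Tri w (.assign x e) s 1 Q := Tri.assign (by rwa [hv])

theorem Tri.store' {a i v : ℕ} {e₁ e₂ : Ex} (hi : e₁.val w s = i) (hv : e₂.val w s = v)
    (h : Q (s.setMem a i v)) : Tri w (.store a e₁ e₂) s 1 Q := Tri.store (by rwa [hi, hv])

/-- The frame is passed to the new postcondition, so specifications need not mention what a command
leaves untouched. -/
theorem Tri.mono {Q' : RamState → Prop} {T' : ℕ} (h : Tri w c s T Q) (hT : T ≤ T')
    (hQ : ∀ s', Frame c s s' → Q s' → Q' s') : Tri w c s T' Q' := by
  obtain ⟨s₁, t₁, h₁, ht₁, h⟩ := h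
  exact ⟨s₁, t₁, h₁, ht₁.trans hT, hQ _ h₁.frame h⟩

theorem Tri.ite {e : Ex} (h₁ : e.val w s ≠ 0 → Tri w c s T Q) (h₂ : e.val w s = 0 → Tri w d s T Q) :
    Tri w (.ite e c d) s (T + 1) Q := by
  by_cases he : e.val w s = 0
  · obtain ⟨s₁, t₁, h₁, ht₁, h⟩ := h₂ he
    exact ⟨s₁, _, .iteF he h₁, by omega, h⟩
  · obtain ⟨s₁, t₁, h₁, ht₁, h⟩ := h₁ he
    exact ⟨s₁, _, .iteT he h₁, by omega, h⟩

/-- A loop with an invariant that is indexed by the number of rounds. -/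
theorem Tri.while {e : Ex} (N : ℕ) (T : ℕ → ℕ) (Inv : ℕ → RamState → Prop) (h0 : Inv 0 s)
    (hstep : ∀ i, i < N → ∀ s', Frame c s s' → Inv i s' →
      e.val w s' ≠ 0 ∧ Tri w c s' (T i) (Inv (i + 1)))
    (hend : ∀ s', Frame c s s' → Inv N s' → e.val w s' = 0) :
    Tri w (.while e c) s (∑ i ∈ Finset.range N, (T i + 1) + 1) (Inv N) := by
  -- Induction on the number `j` of rounds still to come.
  suffices H : ∀ j ≤ N, ∀ s', Frame c s s' → Inv (N - j) s' →
      Tri w (.while e c) s' (∑ i ∈ Finset.Ico (N - j) N, (T i + 1) + 1) (Inv N) by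
    have := H N le_rfl s .rfl (by rwa [Nat.sub_self])
    rwa [Nat.sub_self, ← Finset.range_eq_Ico] at this
  intro j
  induction j with
  | zero =>
    intro _ s' hf hi
    exact ⟨s', 1, .whileF (hend s' hf hi), by simp, hi⟩
  | succ j ih =>
    intro hj s' hf hi
    obtain ⟨he, s₁, t₁, h₁, ht₁, hi₁⟩ := hstep _ (by omega) s' hf hi
    rw [show N - (j + 1) + 1 = N - j by omega] at hi₁
    obtain ⟨s₂, t₂, h₂, ht₂, hi₂⟩ := ih (by omega) s₁ (hf.trans h₁.frame) hi₁
    refine ⟨s₂, _, .whileT he h₁ h₂, ?_, hi₂⟩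
    rw [Finset.sum_eq_sum_Ico_succ_bot (by omega), show N - (j + 1) + 1 = N - j by omega]
    omega

/-! ### Cost bounds up to scratch -/

/-- The cost of running `K` from a state that agrees with `s` up to scratch is at most `V`. -/
def CostLe (w : ℕ) (k : ℝ≥0∞) (f : RamState → ℝ≥0∞) (K : List Prog) (s : RamState) (V : ℝ≥0∞) :
    Prop := ∀ s₁, Sim s₁ s → cost w k f (K, s₁) ≤ V

variable {k V : ℝ≥0∞} {f : RamState → ℝ≥0∞} {K : List Prog}

theorem CostLe.mono {V' : ℝ≥0∞} (h : CostLe w k f K s V) (hV : V ≤ V') : CostLe w k f K s V' :=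
  fun s₁ hs => (h s₁ hs).trans hV

theorem CostLe.of_tri (hc : c.Ok) (h : Tri w c s T fun s' => CostLe w k f K s' V) :
    CostLe w k f (c.comp :: K) s (k * (c.wt * T : ℕ) + V) := by
  intro s₁ hs
  obtain ⟨s', t, hr, ht, hV⟩ := h
  obtain ⟨s₁', t', hb, hs', ht'⟩ := hr.bigStep hc hs
  refine (hb.cost_le K).trans (add_le_add ?_ (hV _ hs'))
  exact mul_le_mul_right (Nat.cast_le.2 (ht'.trans (Nat.mul_le_mul_left _ ht))) _

theorem CostLe.seq {c d : Prog} (h : CostLe w k f (c :: d :: K) s V) :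
    CostLe w k f (.seq c d :: K) s (k + V) := fun s₁ hs =>
  (cost_le_of_step_pure (by rw [ramStep])).trans (add_le_add le_rfl (h s₁ hs))

theorem CostLe.loop_pos {x : ℕ} {c : Prog} (hx : VisReg x) (h0 : s.reg x ≠ 0)
    (h : CostLe w k f (c :: .loop x c :: K) s V) :
    CostLe w k f (.loop x c :: K) s (k + V) := fun s₁ hs =>
  (cost_le_of_step_pure (by rw [ramStep, if_pos (by rwa [hs.1 x hx])])).trans
    (add_le_add le_rfl (h s₁ hs))

theorem CostLe.loop_zero {x : ℕ} {c : Prog} (hx : VisReg x) (h0 : s.reg x = 0)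
    (h : CostLe w k f K s V) :
    CostLe w k f (.loop x c :: K) s (k + V) := fun s₁ hs =>
  (cost_le_of_step_pure (by rw [ramStep, if_neg (by rw [hs.1 x hx]; exact not_not.2 h0)])).trans
    (add_le_add le_rfl (h s₁ hs))

theorem CostLe.rand {x : ℕ} {V : ℕ → ℝ≥0∞}
    (h : ∀ v, v < 2 ^ w → CostLe w k f K (s.setReg x v) (V v)) :
    CostLe w k f (.rand x :: K) s
      (k + ∑ v ∈ Finset.range (2 ^ w), (2 ^ w : ℝ≥0∞)⁻¹ * V v) := by
  intro s₁ hs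
  refine (cost_rand_le x K s₁).trans (add_le_add le_rfl (Finset.sum_le_sum fun v hv => ?_))
  exact mul_le_mul_right (h v (Finset.mem_range.1 hv) _ (hs.setReg x v)) _

theorem Sim.high_eq {s₁ s : RamState} (h : Sim s₁ s) : high s₁ = high s := by
  simp only [high, RamState.mk.injEq]
  exact ⟨funext fun r => h.1 _ (Or.inr (by omega)), funext fun a => h.2 _ (by omega)⟩

theorem Sim.glue {s₁ s : RamState} (h : Sim s₁ s) (d : RamState) :
    Sim (glue s₁ d) (glue s d) := by
  refine ⟨fun r hr => ?_, fun a ha => ?_⟩ <;> simp only [WordRam.glue] <;> split_ifs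
  · exact h.1 r hr
  · rfl
  · exact h.2 a ha
  · rfl

theorem CostLe.rename {c : Prog} {g : RamState → ℝ≥0∞}
    (h : ∀ d', MayEndIn w c (high s) d' → CostLe w k f K (WordRam.glue s d') (k * g d' + V)) :
    CostLe w k f (rename c :: K) s
      (k * expTime w c (high s) + k * expFinal w c (high s) g + V) := by
  intro s₁ hs
  rw [← hs.high_eq]
  refine cost_rename_le fun d' hd' => ?_
  rw [hs.high_eq] at hd'
  exact h d' hd' _ (hs.glue d')

end WordRam

/-! ### Word arithmetic, counting loops, and merging of two runs. -/

namespace WordRam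

/-! ### Notation for expressions, and counting loops -/

instance : Add Ex := ⟨.bin .add⟩
instance : Sub Ex := ⟨.bin .sub⟩
instance : Mul Ex := ⟨.bin .mul⟩
instance : Div Ex := ⟨.bin .div⟩
instance : Mod Ex := ⟨.bin .mod⟩
instance (n : ℕ) : OfNat Ex n := ⟨.lit n⟩

/-- `1` if `a < b`, and `0` otherwise. -/
def Ex.lt (a b : Ex) : Ex := .bin .lt a b
/-- `1` if `a = b`, and `0` otherwise. -/
def Ex.eq (a b : Ex) : Ex := .bin .eq a b
/-- `a * 2 ^ b`. -/
def Ex.shl (a b : Ex) : Ex := .bin .shl a b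
/-- `a / 2 ^ b`. -/
def Ex.shr (a b : Ex) : Ex := .bin .shr a b

section
variable {w : ℕ} {s : RamState}

@[simp] theorem val_reg (r : ℕ) : (Ex.reg r).val w s = s.reg r := rfl
@[simp] theorem val_ld (a : ℕ) (e : Ex) : (Ex.ld a e).val w s = s.mem a (e.val w s) := rfl
@[simp] theorem val_lit (k : ℕ) : (Ex.lit k).val w s = k % 2 ^ w := rfl
@[simp] theorem val_zero : (0 : Ex).val w s = 0 := Nat.zero_mod _
@[simp] theorem val_one : (1 : Ex).val w s = 1 % 2 ^ w := rfl
@[simp] theorem val_two : (2 : Ex).val w s = 2 % 2 ^ w := rfl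
@[simp] theorem val_four : (4 : Ex).val w s = 4 % 2 ^ w := rfl
@[simp] theorem val_add (a b : Ex) : (a + b).val w s = (a.val w s + b.val w s) % 2 ^ w := rfl
@[simp] theorem val_mul (a b : Ex) : (a * b).val w s = (a.val w s * b.val w s) % 2 ^ w := rfl
@[simp] theorem val_div (a b : Ex) : (a / b).val w s = (a.val w s / b.val w s) % 2 ^ w := rfl
@[simp] theorem val_mod (a b : Ex) : (a % b).val w s = (a.val w s % b.val w s) % 2 ^ w := rfl
@[simp] theorem val_sub (a b : Ex) :
    (a - b).val w s = (a.val w s + (2 ^ w - b.val w s % 2 ^ w)) % 2 ^ w := rfl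
@[simp] theorem val_lt (a b : Ex) :
    (a.lt b).val w s = (if a.val w s < b.val w s then 1 else 0) % 2 ^ w := rfl
@[simp] theorem val_eq (a b : Ex) :
    (a.eq b).val w s = (if a.val w s = b.val w s then 1 else 0) % 2 ^ w := rfl
@[simp] theorem val_shl (a b : Ex) :
    (a.shl b).val w s = (a.val w s * 2 ^ b.val w s) % 2 ^ w := by
  rw [← Nat.shiftLeft_eq]; rfl
@[simp] theorem val_shr (a b : Ex) :
    (a.shr b).val w s = (a.val w s / 2 ^ b.val w s) % 2 ^ w := by
  rw [← Nat.shiftRight_eq_div_pow]; rfl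
end

theorem sub_word {x y W : ℕ} (hy : y ≤ x) (hx : x < W) : (x + (W - y % W)) % W = x - y := by
  rw [Nat.mod_eq_of_lt (by omega : y < W), show x + (W - y) = x - y + W by omega,
    Nat.add_mod_right, Nat.mod_eq_of_lt (by omega)]

theorem one_lt_two_pow {w : ℕ} (hw : 0 < w) : 1 < 2 ^ w := Nat.one_lt_two_pow hw.ne'

theorem bool_mod {w : ℕ} (hw : 0 < w) (p : Prop) [Decidable p] :
    (if p then 1 else 0) % 2 ^ w = if p then 1 else 0 := by
  apply Nat.mod_eq_of_lt
  have := one_lt_two_pow hw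
  split_ifs <;> omega

/-- Conjunction and disjunction of tests are encoded as product and sum. The sum can be 2, which
must not wrap around to 0. -/
theorem and_or_word {W : ℕ} (hW : 2 < W) (p q r : Prop) [Decidable p] [Decidable q]
    [Decidable r] :
    ((if p then 1 else 0) * (((if q then 1 else 0) + if r then 1 else 0) % W)) % W = 0 ↔
      ¬ (p ∧ (q ∨ r)) := by
  by_cases p <;> by_cases q <;> by_cases r <;>
    simp [*, Nat.mod_eq_of_lt hW, Nat.mod_eq_of_lt (by omega : 1 < W)]

/-- `for i in 0..e do c`. -/
def Cmd.forUp (i : ℕ) (e : Ex) (c : Cmd) : Cmd :=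
  .seq (.assign i 0) (.while ((Ex.reg i).lt e) (.seq c (.assign i (.reg i + 1))))

theorem mem_regs_forUp {i : ℕ} {e : Ex} {c : Cmd} {r : ℕ} :
    r ∈ (Cmd.forUp i e c).regs ↔ r = i ∨ r ∈ c.regs := by
  simp [Cmd.forUp, Cmd.regs, or_comm]

theorem mems_forUp {i : ℕ} {e : Ex} {c : Cmd} : (Cmd.forUp i e c).mems = c.mems := by
  simp [Cmd.forUp, Cmd.mems]

theorem Tri.forUp {w i N : ℕ} {e : Ex} {c : Cmd} {s : RamState} (T : ℕ → ℕ)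
    (Inv : ℕ → RamState → Prop) (hN : N < 2 ^ w) (hi : i ∉ c.regs)
    (he : ∀ s', Frame (.forUp i e c) s s' → e.val w s' = N)
    (h0 : Inv 0 (s.setReg i 0))
    (hstep : ∀ j, j < N → ∀ s', Frame (.forUp i e c) s s' → s'.reg i = j → Inv j s' →
      Tri w c s' (T j) fun s'' => Inv (j + 1) (s''.setReg i (j + 1))) :
    Tri w (.forUp i e c) s (∑ j ∈ Finset.range N, (T j + 2) + 2)
      fun s' => Inv N s' ∧ s'.reg i = N := by
  rw [show ∑ j ∈ Finset.range N, (T j + 2) + 2 =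
    1 + (∑ j ∈ Finset.range N, ((T j + 1) + 1) + 1) from
    (by omega : _ = 1 + (∑ j ∈ Finset.range N, (T j + 2) + 1))]
  refine Tri.seq (Tri.assign ?_)
  rw [val_zero]
  have hfr : ∀ s', Frame (.seq c (.assign i (.reg i + 1))) (s.setReg i 0) s' →
      Frame (.forUp i e c) s s' := by
    intro s' h
    refine ⟨fun r hr => ?_, fun a ha => ?_⟩
    · rw [mem_regs_forUp, not_or] at hr
      rw [h.1 r (by simp [Cmd.regs, hr.1, hr.2]), setReg_reg, if_neg hr.1]
    · rw [mems_forUp] at ha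
      rw [h.2 a (by simp [Cmd.mems, ha]), setReg_mem]
  refine Tri.while N _ (fun j s' => Inv j s' ∧ s'.reg i = j) ⟨h0, by simp⟩ ?_ ?_
  · rintro j hj s' hf ⟨hI, hij⟩
    have hw : 0 < w := by
      rcases Nat.eq_zero_or_pos w with rfl | h
      · simp at hN; omega
      · exact h
    refine ⟨?_, Tri.seq ((hstep j hj s' (hfr _ hf) hij hI).mono le_rfl ?_)⟩
    · rw [val_lt, val_reg, hij, he _ (hfr _ hf), bool_mod hw, if_pos hj]
      exact one_ne_zero
    · intro s'' hf' hI'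
      have h1 : (Ex.reg i + 1).val w s'' = j + 1 := by
        have := one_lt_two_pow hw
        rw [val_add, val_reg, val_one, hf'.1 i hi, hij, Nat.mod_eq_of_lt this,
          Nat.mod_eq_of_lt (by omega)]
      refine Tri.assign ?_
      rw [h1]
      exact ⟨hI', by simp⟩
  · rintro s' hf ⟨hI, hij⟩
    rw [val_lt, val_reg, hij, he _ (hfr _ hf), if_neg (lt_irrefl _), Nat.zero_mod]

/-! ### Merge sort -/

/-- While the two runs `[lo, mid)` and `[mid, hi)` of `X` are merged into `Y`: the entries before
`i` and `j` have been moved to `[lo, k)`. -/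
structure MergeInv (X Y : ℕ → ℕ) (lo mid hi i j k : ℕ) : Prop where
  lo_le : lo ≤ i
  i_le : i ≤ mid
  le_j : mid ≤ j
  j_le : j ≤ hi
  pos : k + mid = i + j
  sorted : ∀ a b, lo ≤ a → a < b → b < k → Y a < Y b
  img : ∀ v, (∃ t, lo ≤ t ∧ t < k ∧ Y t = v) ↔
    (∃ t, lo ≤ t ∧ t < i ∧ X t = v) ∨ ∃ t, mid ≤ t ∧ t < j ∧ X t = v
  lt_left : ∀ a, lo ≤ a → a < k → i < mid → Y a < X i
  lt_right : ∀ a, lo ≤ a → a < k → j < hi → Y a < X j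

/-- By `hX` and `hij` the moved entry is smaller than everything left in either run, so the new last
entry of the output keeps both comparison clauses true. -/
theorem MergeInv.left {X Y : ℕ → ℕ} {lo mid hi i j k : ℕ} (h : MergeInv X Y lo mid hi i j k)
    (hX : ∀ a b, lo ≤ a → a < b → b < mid → X a < X b) (hi' : i < mid)
    (hij : j < hi → X i < X j) :
    MergeInv X (Function.update Y k (X i)) lo mid hi (i + 1) j (k + 1) := by
  obtain ⟨h1, h2, h3, h4, h5, h6, h7, h8, h9⟩ := h
  have hup : ∀ a, a < k → Function.update Y k (X i) a = Y a := fun a ha =>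
    Function.update_of_ne ha.ne _ _
  refine ⟨by omega, by omega, h3, h4, by omega, ?_, ?_, ?_, ?_⟩
  · intro a b ha hab hb
    rw [hup a (by omega)]
    rcases eq_or_ne b k with rfl | hne
    · rw [Function.update_self]; exact h8 a ha hab hi'
    · rw [hup b (by omega)]; exact h6 a b ha hab (by omega)
  · intro v
    constructor
    · rintro ⟨t, ht1, ht2, rfl⟩
      rcases eq_or_ne t k with rfl | hne
      · rw [Function.update_self]; exact Or.inl ⟨i, h1, by omega, rfl⟩
      · rw [hup t (by omega)]
        rcases (h7 (Y t)).1 ⟨t, ht1, by omega, rfl⟩ with ⟨u, hu⟩ | hu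
        · exact Or.inl ⟨u, hu.1, by omega, hu.2.2⟩
        · exact Or.inr hu
    · have old : (∃ t, lo ≤ t ∧ t < k ∧ Y t = v) →
          ∃ t, lo ≤ t ∧ t < k + 1 ∧ Function.update Y k (X i) t = v := by
        rintro ⟨t, ht1, ht2, ht3⟩
        exact ⟨t, ht1, by omega, by rw [hup t ht2, ht3]⟩
      rintro (⟨t, ht1, ht2, ht3⟩ | ht)
      · rcases eq_or_ne t i with rfl | hne
        · exact ⟨k, by omega, by omega, by rw [Function.update_self, ht3]⟩
        · exact old ((h7 v).2 (Or.inl ⟨t, ht1, by omega, ht3⟩))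
      · exact old ((h7 v).2 (Or.inr ht))
  · intro a ha hak hi1
    have := hX i (i + 1) h1 (by omega) hi1
    rcases eq_or_ne a k with rfl | hne
    · rwa [Function.update_self]
    · rw [hup a (by omega)]
      exact (h8 a ha (by omega) hi').trans this
  · intro a ha hak hj
    rcases eq_or_ne a k with rfl | hne
    · rw [Function.update_self]; exact hij hj
    · rw [hup a (by omega)]
      exact h9 a ha (by omega) hj

theorem MergeInv.right {X Y : ℕ → ℕ} {lo mid hi i j k : ℕ} (h : MergeInv X Y lo mid hi i j k)
    (hX : ∀ a b, mid ≤ a → a < b → b < hi → X a < X b) (hj' : j < hi)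
    (hij : i < mid → X j < X i) :
    MergeInv X (Function.update Y k (X j)) lo mid hi i (j + 1) (k + 1) := by
  obtain ⟨h1, h2, h3, h4, h5, h6, h7, h8, h9⟩ := h
  have hup : ∀ a, a < k → Function.update Y k (X j) a = Y a := fun a ha =>
    Function.update_of_ne ha.ne _ _
  refine ⟨by omega, by omega, by omega, by omega, by omega, ?_, ?_, ?_, ?_⟩
  · intro a b ha hab hb
    rw [hup a (by omega)]
    rcases eq_or_ne b k with rfl | hne
    · rw [Function.update_self]; exact h9 a ha hab hj'
    · rw [hup b (by omega)]; exact h6 a b ha hab (by omega)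
  · intro v
    constructor
    · rintro ⟨t, ht1, ht2, rfl⟩
      rcases eq_or_ne t k with rfl | hne
      · rw [Function.update_self]; exact Or.inr ⟨j, h3, by omega, rfl⟩
      · rw [hup t (by omega)]
        rcases (h7 (Y t)).1 ⟨t, ht1, by omega, rfl⟩ with hu | ⟨u, hu⟩
        · exact Or.inl hu
        · exact Or.inr ⟨u, hu.1, by omega, hu.2.2⟩
    · have old : (∃ t, lo ≤ t ∧ t < k ∧ Y t = v) →
          ∃ t, lo ≤ t ∧ t < k + 1 ∧ Function.update Y k (X j) t = v := by
        rintro ⟨t, ht1, ht2, ht3⟩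
        exact ⟨t, ht1, by omega, by rw [hup t ht2, ht3]⟩
      rintro (ht | ⟨t, ht1, ht2, ht3⟩)
      · exact old ((h7 v).2 (Or.inl ht))
      · rcases eq_or_ne t j with rfl | hne
        · exact ⟨k, by omega, by omega, by rw [Function.update_self, ht3]⟩
        · exact old ((h7 v).2 (Or.inr ⟨t, ht1, by omega, ht3⟩))
  · intro a ha hak hi1
    rcases eq_or_ne a k with rfl | hne
    · rw [Function.update_self]; exact hij hi1
    · rw [hup a (by omega)]
      exact h8 a ha (by omega) hi1
  · intro a ha hak hj
    have := hX j (j + 1) h3 (by omega) hj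
    rcases eq_or_ne a k with rfl | hne
    · rwa [Function.update_self]
    · rw [hup a (by omega)]
      exact (h9 a ha (by omega) hj').trans this

/-- Move one entry from memory `1` to memory `2`. -/
def mergeStep : Cmd :=
  .ite ((Ex.reg 22).lt (.reg 25) *
      ((Ex.reg 26).lt (.reg 23 + 1) + (Ex.ld 1 (.reg 22)).lt (.ld 1 (.reg 23))))
    (.seq (.store 2 (.reg 24) (.ld 1 (.reg 22))) (.assign 22 (.reg 22 + 1)))
    (.seq (.store 2 (.reg 24) (.ld 1 (.reg 23))) (.assign 23 (.reg 23 + 1)))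

/-- Merge the runs `[lo, mid)` and `[mid, hi)` (registers `21`, `25`, `26`). -/
def mergeRuns : Cmd :=
  .while ((Ex.reg 24).lt (.reg 26)) (.seq mergeStep (.assign 24 (.reg 24 + 1)))

theorem mergeRuns_spec {w lo mid hi : ℕ} {s : RamState} (hlo : lo ≤ mid) (hmid : mid ≤ hi)
    (hw : 2 ≤ w) (hhi : hi + 1 < 2 ^ w)
    (h22 : s.reg 22 = lo) (h23 : s.reg 23 = mid) (h24 : s.reg 24 = lo) (h25 : s.reg 25 = mid)
    (h26 : s.reg 26 = hi)
    (hl : ∀ a b, lo ≤ a → a < b → b < mid → s.mem 1 a < s.mem 1 b)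
    (hr : ∀ a b, mid ≤ a → a < b → b < hi → s.mem 1 a < s.mem 1 b)
    (hinj : ∀ a b, lo ≤ a → a < mid → mid ≤ b → b < hi → s.mem 1 a ≠ s.mem 1 b) :
    Tri w mergeRuns s ((hi - lo) * 5 + 1) fun s' =>
      MergeInv (s.mem 1) (s'.mem 2) lo mid hi mid hi hi ∧ ∀ t, t < lo → s'.mem 2 t = s.mem 2 t := by
  have hW : 4 ≤ 2 ^ w := (by norm_num : 4 = 2 ^ 2) ▸ Nat.pow_le_pow_right (by norm_num) hw
  have hb : ∀ p : Prop, [Decidable p] → (if p then 1 else 0) % 2 ^ w = if p then 1 else 0 :=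
    fun p _ => bool_mod (by omega) p
  have key := Tri.while (w := w) (s := s) (e := (Ex.reg 24).lt (.reg 26))
    (c := .seq mergeStep (.assign 24 (.reg 24 + 1))) (hi - lo) (fun _ => 4)
    (fun k s' => s'.reg 24 = lo + k ∧
      MergeInv (s.mem 1) (s'.mem 2) lo mid hi (s'.reg 22) (s'.reg 23) (lo + k) ∧
      ∀ t, t < lo → s'.mem 2 t = s.mem 2 t) ?_ ?_ ?_
  · refine key.mono (by simp) ?_
    rintro s' - ⟨-, h2, h3⟩
    refine ⟨?_, h3⟩
    have := h2.i_le
    have := h2.j_le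
    have := h2.pos
    rw [show s'.reg 22 = mid by omega, show s'.reg 23 = hi by omega,
      show lo + (hi - lo) = hi by omega] at h2
    exact h2
  · refine ⟨by omega, ?_, fun _ _ => rfl⟩
    rw [h22, h23]
    exact ⟨le_rfl, hlo, le_rfl, hmid, by omega, by omega, fun v => by
      constructor
      · rintro ⟨t, h⟩; omega
      · rintro (⟨t, h⟩ | ⟨t, h⟩) <;> omega, by omega, by omega⟩
  · rintro k hk s' hf ⟨hk', hI, ht⟩
    have e25 : s'.reg 25 = mid := (hf.1 25 (by decide)).trans h25
    have e26 : s'.reg 26 = hi := (hf.1 26 (by decide)).trans h26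
    have e1 : s'.mem 1 = s.mem 1 := hf.2 1 (by decide)
    obtain ⟨i, hi'⟩ : ∃ i, s'.reg 22 = i := ⟨_, rfl⟩
    obtain ⟨j, hj'⟩ : ∃ j, s'.reg 23 = j := ⟨_, rfl⟩
    rw [hi', hj'] at hI
    have := hI.i_le
    have := hI.j_le
    have := hI.pos
    have := hI.le_j
    have := hI.lo_le
    refine ⟨?_, ?_⟩
    · simp only [val_lt, val_reg, hk', e26, hb]
      rw [if_pos (by omega)]; exact one_ne_zero
    · refine Tri.mono (T := (2 + 1) + 1) (Tri.seq (Tri.ite ?_ ?_)) le_rfl (fun _ _ h => h)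
      · intro hc
        simp only [val_lt, val_add, val_mul, val_reg, val_ld, val_one, e25, e26, e1, hi', hj',
          hb, Nat.mod_eq_of_lt (by omega : 1 < 2 ^ w), Nat.mod_eq_of_lt (by omega : j + 1 < 2 ^ w)]
          at hc
        rw [Ne, and_or_word (by omega), not_not] at hc
        obtain ⟨hc1, hc2⟩ := hc
        have hc2 : j < hi → s.mem 1 i < s.mem 1 j := by
          intro hj
          exact hc2.resolve_left (by omega)
        refine Tri.seq (Tri.store (Tri.assign (Tri.assign ?_)))
        have f1 : i + 1 < 2 ^ w := by omega
        have f2 : lo + k + 1 < 2 ^ w := by omega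
        simp only [val_add, val_reg, val_ld, val_one, setReg_reg, setMem_reg, setReg_mem,
          setMem_mem, hi', hk', e1, Nat.mod_eq_of_lt (by omega : 1 < 2 ^ w)]
        norm_num [Nat.mod_eq_of_lt f1, Nat.mod_eq_of_lt f2]
        rw [hj']
        refine ⟨by omega, ?_, fun t htl => ?_⟩
        · simpa only [add_assoc, *] using hI.left hl hc1 hc2
        · rw [Function.update_of_ne (by omega), ht t htl]
      · intro hc
        simp only [val_lt, val_add, val_mul, val_reg, val_ld, val_one, e25, e26, e1, hi', hj',
          hb, Nat.mod_eq_of_lt (by omega : 1 < 2 ^ w), Nat.mod_eq_of_lt (by omega : j + 1 < 2 ^ w)]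
          at hc
        rw [and_or_word (by omega)] at hc
        have hc1 : j < hi := by
          by_contra h
          exact hc ⟨by omega, Or.inl (by omega)⟩
        -- The runs have no common value, so the failed test excludes equality as well.
        have hc2 : i < mid → s.mem 1 j < s.mem 1 i := by
          intro h
          refine lt_of_le_of_ne ?_ (hinj i j (by omega) h (by omega) hc1).symm
          by_contra h'
          exact hc ⟨h, Or.inr (by omega)⟩
        refine Tri.seq (Tri.store (Tri.assign (Tri.assign ?_)))
        have f1 : j + 1 < 2 ^ w := by omega
        have f2 : lo + k + 1 < 2 ^ w := by omega
        simp only [val_add, val_reg, val_ld, val_one, setReg_reg, setMem_reg, setReg_mem,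
          setMem_mem, hj', hk', e1, Nat.mod_eq_of_lt (by omega : 1 < 2 ^ w)]
        norm_num [Nat.mod_eq_of_lt f1, Nat.mod_eq_of_lt f2]
        rw [hi']
        refine ⟨by omega, ?_, fun t htl => ?_⟩
        · simpa only [add_assoc, *] using hI.right hr hc1 hc2
        · rw [Function.update_of_ne (by omega), ht t htl]
  · rintro s' hf ⟨hk, -⟩
    have e26 : s'.reg 26 = hi := (hf.1 26 (by decide)).trans h26
    simp only [val_lt, val_reg, hk, e26, hb]
    rw [if_neg (by omega)]

end WordRam

/-! ### Merge sort: passes over blocks of doubling length. -/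

namespace WordRam

/-- The blocks of length `d` of `X` are increasing up to `m`. -/
def BlocksIncreasing (X : ℕ → ℕ) (d m : ℕ) : Prop :=
  ∀ a b, a < b → b < m → a / d = b / d → X a < X b

/-- `X` and `Y` take the same values below `m`. -/
def SameValues (X Y : ℕ → ℕ) (m : ℕ) : Prop :=
  ∀ v, (∃ t, t < m ∧ Y t = v) ↔ ∃ t, t < m ∧ X t = v

/-- By counting: `Y` takes as many values on `m` arguments as the injective `X`. It hands
distinctness of the entries from one merge pass to the next. -/
theorem SameValues.injOn {X Y : ℕ → ℕ} {m : ℕ} (h : SameValues X Y m)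
    (hX : ∀ a b, a < b → b < m → X a ≠ X b) : ∀ a b, a < b → b < m → Y a ≠ Y b := by
  have hi : (Finset.range m).image Y = (Finset.range m).image X := by
    ext v
    simpa using h v
  have hX' : Set.InjOn X (Finset.range m : Set ℕ) := by
    intro a ha b hb hab
    simp only [Finset.coe_range, Set.mem_Iio] at ha hb
    by_contra hne
    rcases Nat.lt_or_gt_of_ne hne with h' | h'
    · exact hX a b h' hb hab
    · exact hX b a h' ha hab.symm
  have hY : Set.InjOn Y (Finset.range m : Set ℕ) := by
    rw [← Finset.card_image_iff] at hX' ⊢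
    rw [hi, hX']
  intro a b hab hb he
  have := hY (by simp; omega) (by simpa using hb) he
  omega

theorem div_eq_of_block {b d t : ℕ} (h1 : b * d ≤ t) (h2 : t < b * d + d) : t / d = b :=
  Nat.div_eq_of_lt_le h1 (by rw [add_mul]; omega)

/-- Merge adjacent blocks of length `d` (register `20`) of memory `1` (length in register `4`). -/
def mergeBlocks : Cmd :=
  .while ((Ex.reg 21).lt (.reg 4))
    (.seq (.assign 22 (.reg 21)) <| .seq (.assign 25 (.reg 21 + .reg 20)) <|
      .seq (.assign 23 (.reg 25)) <| .seq (.assign 26 (.reg 25 + .reg 20)) <|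
      .seq (.assign 24 (.reg 21)) <| .seq mergeRuns (.assign 21 (.reg 26)))

theorem mergeBlocks_spec {w d B : ℕ} {s : RamState} (hd : 0 < d) (hw : 2 ≤ w)
    (hP : B * (2 * d) + 1 < 2 ^ w) (h4 : s.reg 4 = B * (2 * d)) (h20 : s.reg 20 = d)
    (h21 : s.reg 21 = 0) (hs : BlocksIncreasing (s.mem 1) d (B * (2 * d)))
    (hinj : ∀ a b, a < b → b < B * (2 * d) → s.mem 1 a ≠ s.mem 1 b) :
    Tri w mergeBlocks s (B * (2 * d * 5 + 8) + 1) fun s' =>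
      BlocksIncreasing (s'.mem 2) (2 * d) (B * (2 * d)) ∧
        SameValues (s.mem 1) (s'.mem 2) (B * (2 * d)) := by
  have hb : ∀ p : Prop, [Decidable p] → (if p then 1 else 0) % 2 ^ w = if p then 1 else 0 :=
    fun p _ => bool_mod (by omega) p
  refine (Tri.while B (fun _ => 2 * d * 5 + 7)
    (fun b s' => s'.reg 21 = b * (2 * d) ∧ BlocksIncreasing (s'.mem 2) (2 * d) (b * (2 * d)) ∧
      SameValues (s.mem 1) (s'.mem 2) (b * (2 * d))) ?_ ?_ ?_).mono (by simp) ?_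
  · refine ⟨by omega, ?_, ?_⟩
    · intro a b _ hb; omega
    · intro v
      simp
  · rintro b hbB s' hf ⟨e21, hs1, hs2⟩
    have e20 : s'.reg 20 = d := (hf.1 20 (by decide)).trans h20
    have e4 : s'.reg 4 = B * (2 * d) := (hf.1 4 (by decide)).trans h4
    have e1 : s'.mem 1 = s.mem 1 := hf.2 1 (by decide)
    have hle : (b + 1) * (2 * d) ≤ B * (2 * d) := Nat.mul_le_mul_right _ hbB
    rw [add_mul, one_mul] at hle
    set lo := b * (2 * d) with hlo
    refine ⟨?_, ?_⟩
    · simp only [val_lt, val_reg, e21, e4, hb]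
      rw [if_pos (by omega)]; exact one_ne_zero
    refine Tri.mono (T := 1 + (1 + (1 + (1 + (1 + ((lo + 2 * d - lo) * 5 + 1 + 1))))))
      (Q := fun s'' => s''.reg 21 = (b + 1) * (2 * d) ∧
      BlocksIncreasing (s''.mem 2) (2 * d) ((b + 1) * (2 * d)) ∧
      SameValues (s.mem 1) (s''.mem 2) ((b + 1) * (2 * d)))
      (Tri.seq (Tri.assign (Tri.seq (Tri.assign (Tri.seq (Tri.assign (Tri.seq (Tri.assign
      (Tri.seq (Tri.assign (Tri.seq ?_))))))))))) (by omega) (fun _ _ h => h)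
    have f1 : lo + d < 2 ^ w := by omega
    have f2 : lo + d + d < 2 ^ w := by omega
    norm_num [e21, e20, Nat.mod_eq_of_lt f1, Nat.mod_eq_of_lt f2]
    have hlo2 : 2 * b * d = lo := by rw [hlo]; ring
    -- The `b`-th block of length `2 * d` consists of the blocks `2 * b` and `2 * b + 1` of length
    -- `d`, which are the two runs to be merged.
    have hdiv : ∀ t, lo ≤ t → t < lo + d → t / d = 2 * b := fun t h1 h2 =>
      div_eq_of_block (by omega) (by omega)
    have hdiv' : ∀ t, lo + d ≤ t → t < lo + d + d → t / d = 2 * b + 1 := fun t h1 h2 =>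
      div_eq_of_block (by rw [add_mul]; omega) (by rw [add_mul]; omega)
    have hdiv2 : ∀ t, lo ≤ t → t < lo + d + d → t / (2 * d) = b := fun t h1 h2 =>
      div_eq_of_block (by omega) (by omega)
    refine (mergeRuns_spec (lo := lo) (mid := lo + d) (hi := lo + d + d) (by omega) (by omega) hw
      (by omega) (by simp) (by simp) (by simp) (by simp) (by simp)
      ?_ ?_ ?_).mono (by omega) ?_
    · intro x y h1 h2 h3
      simpa [e1] using hs x y h2 (by omega) (by rw [hdiv x h1 (by omega), hdiv y (by omega) h3])
    · intro x y h1 h2 h3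
      simpa [e1] using hs x y h2 (by omega) (by rw [hdiv' x h1 (by omega), hdiv' y (by omega) h3])
    · intro x y h1 h2 h3 h4
      simpa [e1] using hinj x y (by omega) (by omega)
    · rintro s'' hf' ⟨hI, hlow⟩
      have e26 : s''.reg 26 = lo + d + d := by
        rw [hf'.1 26 (by decide)]
        simp
      refine Tri.assign ?_
      simp only [setReg_mem, e1] at hI hlow
      simp only [setReg_reg, setReg_mem, if_true, val_reg, e26,
        show (b + 1) * (2 * d) = lo + d + d by rw [hlo]; ring]
      refine ⟨trivial, ?_, ?_⟩
      · intro x y hxy hy hdxy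
        by_cases h1 : y < lo
        · rw [hlow x (by omega), hlow y h1]
          exact hs1 x y hxy h1 hdxy
        · rw [hdiv2 y (by omega) hy] at hdxy
          have : lo ≤ x := by
            have := Nat.div_mul_le_self x (2 * d)
            rwa [hdxy] at this
          exact hI.sorted x y this hxy hy
      · intro v
        have h1 := hs2 v
        have h2 := hI.img v
        constructor
        · rintro ⟨t, ht, htv⟩
          by_cases h3 : t < lo
          · obtain ⟨u, hu, huv⟩ := h1.1 ⟨t, h3, by rw [← hlow t h3, htv]⟩
            exact ⟨u, by omega, huv⟩
          · rcases h2.1 ⟨t, by omega, by omega, htv⟩ with ⟨u, hu⟩ | ⟨u, hu⟩ <;>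
              exact ⟨u, by omega, hu.2.2⟩
        · rintro ⟨t, ht, htv⟩
          by_cases h3 : t < lo
          · obtain ⟨u, hu, huv⟩ := h1.2 ⟨t, h3, htv⟩
            exact ⟨u, by omega, by rw [hlow u hu, huv]⟩
          · have : ∃ u, lo ≤ u ∧ u < lo + d + d ∧ s''.mem 2 u = v := by
              rw [h2]
              by_cases h4 : t < lo + d
              · exact Or.inl ⟨t, by omega, h4, htv⟩
              · exact Or.inr ⟨t, by omega, by omega, htv⟩
            obtain ⟨u, hu⟩ := this
            exact ⟨u, by omega, hu.2.2⟩
  · rintro s' hf ⟨e21, -⟩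
    have e4 : s'.reg 4 = B * (2 * d) := (hf.1 4 (by decide)).trans h4
    simp only [val_lt, val_reg, e21, e4, hb]
    rw [if_neg (by omega)]
  · rintro s' - ⟨-, h⟩
    exact h

/-- Merge adjacent blocks of memory `1`, and double the block length. -/
def mergePass : Cmd :=
  .seq (.assign 21 0) <| .seq mergeBlocks <|
    .seq (.forUp 24 (.reg 4) (.store 1 (.reg 24) (.ld 2 (.reg 24))))
      (.assign 20 (.reg 20 + .reg 20))

theorem mergePass_spec {w d B : ℕ} {s : RamState} (hd : 0 < d) (hw : 2 ≤ w) (hB : 0 < B)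
    (hP : B * (2 * d) + 1 < 2 ^ w) (h4 : s.reg 4 = B * (2 * d)) (h20 : s.reg 20 = d)
    (hs : BlocksIncreasing (s.mem 1) d (B * (2 * d)))
    (hinj : ∀ a b, a < b → b < B * (2 * d) → s.mem 1 a ≠ s.mem 1 b) :
    Tri w mergePass s (19 * (B * (2 * d))) fun s' =>
      s'.reg 20 = 2 * d ∧ BlocksIncreasing (s'.mem 1) (2 * d) (B * (2 * d)) ∧
        SameValues (s.mem 1) (s'.mem 1) (B * (2 * d)) := by
  have hBd : B * 2 ≤ B * (2 * d) := Nat.mul_le_mul_left _ (by omega)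
  refine Tri.mono (T := 1 + ((B * (2 * d * 5 + 8) + 1) + ((B * (2 * d) * 3 + 2) + 1)))
    (Q := fun s' => s'.reg 20 = 2 * d ∧ BlocksIncreasing (s'.mem 1) (2 * d) (B * (2 * d)) ∧
        SameValues (s.mem 1) (s'.mem 1) (B * (2 * d)))
    (Tri.seq (Tri.assign (Tri.seq ?_))) (by nlinarith) (fun _ _ h => h)
  rw [val_zero]
  refine (mergeBlocks_spec (s := s.setReg 21 0) hd hw hP (by simp [h4]) (by simp [h20]) (by simp) hs hinj).mono
    le_rfl ?_
  rintro s₁ hf₁ ⟨hs₁, hv₁⟩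
  have e4 : s₁.reg 4 = B * (2 * d) := by rw [hf₁.1 4 (by decide)]; simp [h4]
  have e20 : s₁.reg 20 = d := by rw [hf₁.1 20 (by decide)]; simp [h20]
  refine Tri.seq ((Tri.forUp (fun _ => 1) (fun j s' => ∀ t, t < j → s'.mem 1 t = s₁.mem 2 t)
    (N := B * (2 * d)) (by omega) (by decide) (fun s' hf => by
      rw [val_reg, hf.1 4 (by decide), e4]) (by intro t ht; omega) ?_).mono
      (by simp [mul_comm]) ?_)
  · intro j hj s' hf e24 hI
    refine Tri.store ?_
    intro t ht
    simp only [val_reg, val_ld, setReg_mem, setMem_mem, if_true, e24]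
    rcases eq_or_ne t j with rfl | hne
    · rw [Function.update_self, hf.2 2 (by decide)]
    · rw [Function.update_of_ne hne, hI t (by omega)]
  · rintro s' hf ⟨hI, -⟩
    refine Tri.assign ?_
    have f : d + d < 2 ^ w := by nlinarith
    simp only [val_add, val_reg, hf.1 20 (by decide), e20, setReg_reg, if_true,
      Nat.mod_eq_of_lt f, setReg_mem]
    refine ⟨by ring, ?_, ?_⟩
    · intro a b hab hb h
      rw [hI a (by omega), hI b hb]
      exact hs₁ a b hab hb h
    · intro v
      refine Iff.trans ?_ (hv₁ v)
      refine exists_congr fun t => and_congr_right fun ht => ?_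
      rw [hI t ht]

/-- Sort memory `1` (length in register `4`, a power of two). -/
def sortCmd : Cmd :=
  .seq (.assign 20 1) (.while ((Ex.reg 20).lt (.reg 4)) mergePass)

theorem sortCmd_spec {w l : ℕ} {s : RamState} (hw : l + 2 ≤ w)
    (h4 : s.reg 4 = 2 ^ l) (hinj : ∀ a b, a < b → b < 2 ^ l → s.mem 1 a ≠ s.mem 1 b) :
    Tri w sortCmd s (l * (19 * 2 ^ l + 1) + 2) fun s' =>
      (∀ a b, a < b → b < 2 ^ l → s'.mem 1 a < s'.mem 1 b) ∧
        SameValues (s.mem 1) (s'.mem 1) (2 ^ l) := by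
  have hb : ∀ p : Prop, [Decidable p] → (if p then 1 else 0) % 2 ^ w = if p then 1 else 0 :=
    fun p _ => bool_mod (by omega) p
  have hW : 2 ^ l * 4 ≤ 2 ^ w := by
    rw [show 2 ^ l * 4 = 2 ^ (l + 2) by ring]; exact Nat.pow_le_pow_right (by norm_num) hw
  have hl : 1 ≤ 2 ^ l := Nat.one_le_two_pow
  refine Tri.mono (T := 1 + (∑ i ∈ Finset.range l, (19 * 2 ^ l + 1) + 1))
    (Q := fun s' => (∀ a b, a < b → b < 2 ^ l → s'.mem 1 a < s'.mem 1 b) ∧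
        SameValues (s.mem 1) (s'.mem 1) (2 ^ l))
    (Tri.seq (Tri.assign ?_)) (by simp; omega) (fun _ _ h => h)
  refine (Tri.while l (fun _ => 19 * 2 ^ l)
    (fun i s' => s'.reg 20 = 2 ^ i ∧ BlocksIncreasing (s'.mem 1) (2 ^ i) (2 ^ l) ∧
      SameValues (s.mem 1) (s'.mem 1) (2 ^ l)) ?_ ?_ ?_).mono le_rfl ?_
  · refine ⟨by simp [Nat.mod_eq_of_lt (by omega : 1 < 2 ^ w)], ?_, fun v => Iff.rfl⟩
    intro a b h _ h'
    simp at h'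
    omega
  · rintro i hi s' hf ⟨e20, hs, hv⟩
    have e4 : s'.reg 4 = 2 ^ l := by rw [hf.1 4 (by decide)]; simp [h4]
    have hlt : 2 ^ i < 2 ^ l := Nat.pow_lt_pow_right (by norm_num) hi
    obtain ⟨m, rfl⟩ := Nat.exists_eq_add_of_lt hi
    have hP : 2 ^ (i + m + 1) = 2 ^ m * (2 * 2 ^ i) := by ring
    refine ⟨?_, ?_⟩
    · simp only [val_lt, val_reg, e20, e4, hb]
      rw [if_pos hlt]; exact one_ne_zero
    have hinj' := hv.injOn hinj
    rw [hP] at hs hinj' e4 hW hl hv ⊢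
    refine (mergePass_spec (by positivity) (by omega) (by positivity) (by omega) e4 e20 hs
      hinj').mono le_rfl ?_
    rintro s'' - ⟨h1, h2, h3⟩
    rw [show 2 ^ (i + 1) = 2 * 2 ^ i by ring]
    exact ⟨h1, h2, fun v => (h3 v).trans (hv v)⟩
  · rintro s' hf ⟨e20, -⟩
    have e4 : s'.reg 4 = 2 ^ l := by rw [hf.1 4 (by decide)]; simp [h4]
    simp only [val_lt, val_reg, e20, e4, hb]
    rw [if_neg (by omega)]
  · rintro s' - ⟨-, h1, h2⟩
    refine ⟨fun a b hab hb => h1 a b hab hb ?_, h2⟩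
    rw [Nat.div_eq_of_lt hb, Nat.div_eq_of_lt (by omega)]

end WordRam

/-! ### Combinatorics of the reduction: group pairs, hashing, duplicate removal. -/

namespace WordRam

/-! ### The staircase of group pairs -/

/-- From the pair of groups `(i, j)` of size `g`, go to the next pair that may contain elements of
sum `T`. -/
def stairStep (X : ℕ → ℕ) (R g T : ℕ) (c : ℕ × ℕ) : ℕ × ℕ :=
  if c.1 + 1 < R ∧ (c.2 < 1 ∨ X (c.1 * g + g - 1) + X (c.2 * g - 1) < T) then (c.1 + 1, c.2)
  else (c.1, c.2 - 1)

/-- The `τ`-th pair of groups. -/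
def stair (X : ℕ → ℕ) (R g T : ℕ) : ℕ → ℕ × ℕ
  | 0 => (0, R - 1)
  | τ + 1 => stairStep X R g T (stair X R g T τ)

theorem stair_lt {X : ℕ → ℕ} {R g T : ℕ} (hR : 0 < R) (τ : ℕ) :
    (stair X R g T τ).1 < R ∧ (stair X R g T τ).2 < R := by
  induction τ with
  | zero => simp only [stair]; omega
  | succ τ ih =>
    rw [stair, stairStep]
    split_ifs with h
    · exact ⟨h.1, ih.2⟩
    · exact ⟨ih.1, by have := ih.2; simp only; omega⟩

/-- Each step raises the first or lowers the second coordinate by one, since the staircase can only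
stall at `(R - 1, 0)`, which it reaches at `τ = 2 * R - 2`. In particular the pair determines `τ`.
-/
theorem stair_sum {X : ℕ → ℕ} {R g T : ℕ} (hR : 0 < R) {τ : ℕ} (hτ : τ < 2 * R - 1) :
    (stair X R g T τ).1 + (R - 1) = τ + (stair X R g T τ).2 := by
  induction τ with
  | zero => simp [stair]
  | succ τ ih =>
    have h1 := ih (by omega)
    have h2 := stair_lt (X := X) (g := g) (T := T) hR τ
    rw [stair, stairStep]
    split_ifs with h
    · simp only; omega
    · simp only
      have : (stair X R g T τ).2 ≠ 0 := by
        intro h0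
        apply h
        exact ⟨by omega, Or.inl (by omega)⟩
      omega

/-- Saddleback search on groups. At `(i, j)` compare the maximum of group i plus the maximum of
group j - 1 with `T`. If the sum is smaller, group i has no partner below group j and can be left.
Otherwise everything above group i is too large for an element of group j, and j can be lowered. -/
theorem stair_complete {X : ℕ → ℕ} {R g T : ℕ} (hR : 0 < R) (hg : 0 < g)
    (hX : ∀ a b, a < b → b < R * g → X a < X b) {u v : ℕ} (hu : u < R * g) (hv : v < R * g)
    (huv : X u + X v = T) : ∃ τ, τ < 2 * R - 1 ∧ stair X R g T τ = (u / g, v / g) := by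
  have hX' : ∀ a b, a ≤ b → b < R * g → X a ≤ X b := fun a b hab hb => by
    rcases eq_or_lt_of_le hab with rfl | h
    · exact le_rfl
    · exact (hX a b h hb).le
  have hu' : u / g < R := Nat.div_lt_of_lt_mul (by rwa [mul_comm])
  have hv' : v / g < R := Nat.div_lt_of_lt_mul (by rwa [mul_comm])
  have hI1 := Nat.div_mul_le_self u g
  have hI2 : u < (u / g + 1) * g := Nat.lt_mul_of_div_lt (Nat.lt_succ_self _) hg
  have hJ1 := Nat.div_mul_le_self v g
  have hJ2 : v < (v / g + 1) * g := Nat.lt_mul_of_div_lt (Nat.lt_succ_self _) hg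
  generalize u / g = I at *
  generalize v / g = J at *
  by_contra hno
  push Not at hno
  -- As long as the pair `(I, J)` has not been visited, neither coordinate of the staircase has
  -- passed it. At the last position this forces `(R - 1, 0) = (I, J)`.
  have key : ∀ τ, τ < 2 * R - 1 →
      (stair X R g T τ).1 ≤ I ∧ J ≤ (stair X R g T τ).2 := by
    intro τ
    induction τ with
    | zero => intro _; simp only [stair]; omega
    | succ τ ih =>
      intro hτ
      obtain ⟨h1, h2⟩ := ih (by omega)
      have h3 := hno τ (by omega)
      have h5 := stair_sum (X := X) (g := g) (T := T) hR (τ := τ) (by omega)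
      have h4 := stair_lt (X := X) (g := g) (T := T) hR τ
      obtain ⟨⟨i, j⟩, hij⟩ : ∃ c, stair X R g T τ = c := ⟨_, rfl⟩
      rw [stair, stairStep]
      simp only [hij, ne_eq, Prod.mk.injEq, not_and] at h1 h2 h3 h4 h5 ⊢
      have hiR : (i + 1) * g ≤ R * g := Nat.mul_le_mul_right g h4.1
      have hjR : (j + 1) * g ≤ R * g := Nat.mul_le_mul_right g h4.2
      rw [add_mul, one_mul] at hiR hjR
      split_ifs with h
      · refine ⟨?_, h2⟩
        simp only
        by_contra hlt
        have e1 : i = I := by omega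
        have e2 : J < j := by have := h3 e1; omega
        rcases h.2 with h' | h'
        · omega
        -- Leaving `i = I` with `J < j` is impossible: `X u + X v` would be at most the tested sum,
        -- which is less than `T`.
        · have b1 : u < (i + 1) * g := e1 ▸ hI2
          have b2 : (J + 1) * g ≤ j * g := Nat.mul_le_mul_right g e2
          rw [add_mul, one_mul] at b1
          have := hX' u (i * g + g - 1) (by omega) (by omega)
          have := hX' v (j * g - 1) (by omega) (by omega)
          omega
      · refine ⟨h1, ?_⟩
        simp only
        by_contra hlt
        have e2 : J = j := by omega
        have e1 : i < I := by
          rcases eq_or_lt_of_le h1 with h' | h'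
          · exact absurd e2.symm (h3 h')
          · exact h'
        apply h
        refine ⟨by omega, ?_⟩
        by_contra hc
        push Not at hc
        -- Lowering `j = J` with `i < I` is impossible: `X u + X v` would exceed the tested sum,
        -- which is at least `T`.
        have b1 : (i + 1) * g ≤ u := (Nat.mul_le_mul_right g e1).trans hI1
        have b2 : j * g ≤ v := e2 ▸ hJ1
        rw [add_mul, one_mul] at b1
        have := hX (i * g + g - 1) u (by omega) hu
        have : 1 * g ≤ j * g := Nat.mul_le_mul_right g hc.1
        have := hX (j * g - 1) v (by omega) hv
        omega
  have hlast := key (2 * R - 2) (by omega)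
  have hs := stair_sum (X := X) (g := g) (T := T) hR (τ := 2 * R - 2) (by omega)
  have hl := stair_lt (X := X) (g := g) (T := T) hR (2 * R - 2)
  refine hno (2 * R - 2) (by omega) (Prod.ext ?_ ?_) <;> simp only <;> omega

/-! ### Multiply-shift hashing -/

/-- The hash value of `x` for the multiplier `a`, on words below `W`, with values below `W / L`. -/
def hash (W L a x : ℕ) : ℕ := a * x % W / L

theorem hash_lt {W L Q a x : ℕ} (hW : W = L * Q) (h0 : 0 < W) : hash W L a x < Q := by
  rw [hash]
  apply Nat.div_lt_of_lt_mul
  rw [← hW]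
  exact Nat.mod_lt _ h0

theorem hash_eq (W L a x : ℕ) (hL : 0 < L) : ∃ k r, r < L ∧ a * x = W * k + (L * hash W L a x + r) :=
  ⟨a * x / W, a * x % W % L, Nat.mod_lt _ hL, by
    rw [hash, Nat.div_add_mod, Nat.div_add_mod]⟩

/-- Hashing is almost linear. -/
theorem hash_add {W L Q a x y T : ℕ} (hW : W = L * Q) (hL : 0 < L) (hxy : x + y = T) :
    ∃ e, e < 2 ∧ (hash W L a x + e + hash W L a y) ≡ hash W L a T [MOD Q] := by
  obtain ⟨k1, r1, hr1, h1⟩ := hash_eq W L a x hL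
  obtain ⟨k2, r2, hr2, h2⟩ := hash_eq W L a y hL
  obtain ⟨k3, r3, hr3, h3⟩ := hash_eq W L a T hL
  have hsum : a * x + a * y = a * T := by rw [← hxy]; ring
  set hx := hash W L a x
  set hy := hash W L a y
  set hT := hash W L a T
  -- The rounding bit is the carry from adding the two remainders that the hash function cuts off.
  refine ⟨(r1 + r2) / L, by rw [Nat.div_lt_iff_lt_mul hL]; omega, ?_⟩
  have hr := Nat.div_add_mod (r1 + r2) L
  have hm := Nat.mod_lt (r1 + r2) hL
  set e := (r1 + r2) / L
  set r := (r1 + r2) % L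
  have key : L * (Q * k1 + Q * k2 + (hx + e + hy)) + r = L * (Q * k3 + hT) + r3 := by
    rw [hW] at h1 h2 h3
    have e1 : L * Q * k1 = L * (Q * k1) := by ring
    have e2 : L * Q * k2 = L * (Q * k2) := by ring
    have e3 : L * Q * k3 = L * (Q * k3) := by ring
    simp only [mul_add]
    omega
  have hq : Q * k1 + Q * k2 + (hx + e + hy) = Q * k3 + hT := by
    have := congrArg (· / L) key
    simpa [Nat.mul_add_div hL, Nat.div_eq_of_lt hm, Nat.div_eq_of_lt hr3] using this
  have := congrArg (· % Q) hq
  simpa [Nat.ModEq, ← mul_add, Nat.mul_add_mod] using this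

/-- A false positive puts a multiple of the multiplier into a short window. -/
theorem window_of_hash {W L Q a x y T e d : ℕ} (hW : W = L * Q) (hL : 0 < L) (he : e < 2)
    (hd : x + y = T + d ∨ T = x + y + d)
    (h : (hash W L a x + e + hash W L a y) ≡ hash W L a T [MOD Q]) :
    (a * d + 2 * L) % W < 4 * L := by
  -- For `W ≤ 4 * L` the window is everything, except when `W = 0`, where `% 0` is the identity and
  -- a separate argument is needed.
  have hW0 : W ≤ 4 * L ∨ 4 * L < W := le_or_gt _ _
  rcases hW0 with hW0 | hW0
  · rcases Nat.eq_zero_or_pos W with h0 | h0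
    · rcases Nat.mul_eq_zero.1 (hW ▸ h0) with h1 | h1
      · omega
      · obtain ⟨k1, r1, hr1, h1⟩ := hash_eq W L a x hL
        obtain ⟨k2, r2, hr2, h2⟩ := hash_eq W L a y hL
        obtain ⟨k3, r3, hr3, h3⟩ := hash_eq W L a T hL
        subst h0
        rename_i hQ0
        subst hQ0
        have h := Nat.modEq_zero_iff.1 h
        simp only [zero_mul, zero_add, Nat.mod_zero] at *
        have h' := congrArg (L * ·) h
        simp only [mul_add] at h'
        have he' : L * e ≤ L * 1 := Nat.mul_le_mul_left L (by omega)
        rcases hd with hd | hd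
        · have : a * x + a * y = a * T + a * d := by rw [← mul_add, hd, mul_add]
          omega
        · have : a * T = a * x + a * y + a * d := by rw [← mul_add, ← mul_add, hd]
          omega
    · exact (Nat.mod_lt _ h0).trans_le hW0
  obtain ⟨k1, r1, hr1, h1⟩ := hash_eq W L a x hL
  obtain ⟨k2, r2, hr2, h2⟩ := hash_eq W L a y hL
  obtain ⟨k3, r3, hr3, h3⟩ := hash_eq W L a T hL
  set hx := hash W L a x
  set hy := hash W L a y
  set hT := hash W L a T
  obtain ⟨m, hm⟩ := (Nat.modEq_iff_dvd.1 h)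
  have hW' : (W : ℤ) = L * Q := by exact_mod_cast hW
  zify at h1 h2 h3 hr1 hr2 hr3 hL hW0
  have he' : (0 : ℤ) ≤ L * e ∧ (L : ℤ) * e ≤ L := by
    constructor
    · positivity
    · have : (e : ℤ) ≤ 1 := by omega
      nlinarith
  have hTx : (a : ℤ) * (x + y - T) =
      W * (k1 + k2 - k3 - m) + (r1 + r2 - r3 - L * e) := by
    push_cast at hm
    have : (L : ℤ) * (hT - (hx + e + hy)) = W * m := by rw [hm, hW']; ring
    linarith
  -- The error ε is made of three remainders below `L` and one rounding term of at most `L`. Adding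
  -- `2 * L` afterwards makes it a nonnegative residue.
  have hfin : ∃ M ε : ℤ, (a : ℤ) * d = W * M + ε ∧ -(2 * L) ≤ ε ∧ ε < 2 * L := by
    rcases hd with hd | hd
    · refine ⟨k1 + k2 - k3 - m, r1 + r2 - r3 - L * e, ?_, ?_, ?_⟩
      · rw [← hTx]; zify at hd; rw [hd]; ring
      · linarith
      · linarith
    · refine ⟨-(k1 + k2 - k3 - m), -(r1 + r2 - r3 - L * e), ?_, ?_, ?_⟩
      · have : (a : ℤ) * d = -(a * (x + y - T)) := by zify at hd; rw [hd]; ring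
        rw [this, hTx]; ring
      · linarith
      · linarith
  obtain ⟨M, ε, hM, h5, h6⟩ := hfin
  zify
  rw [hM, show (W : ℤ) * M + ε + 2 * L = (ε + 2 * L) + W * M by ring, Int.add_mul_emod_self_left,
    Int.emod_eq_of_lt (by linarith) (by linarith)]
  linarith

/-- As `a` runs through the words, `a * d + 2 * L` moves in steps of `d` and has at most `d + 1`
quotients by `W`. For each quotient at most `4 * L / d + 1` values of `a` fall into the window.
Since `d` is small compared to `L`, the rounding terms are harmless, and neither `a` nor `d` has to
be odd. -/
theorem card_window_le {W L d : ℕ} (hd : 0 < d) (hdL : d + 1 ≤ 2 * L) :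
    ((Finset.range W).filter fun a => (a * d + 2 * L) % W < 4 * L).card ≤ 10 * L := by
  by_cases hW : W ≤ 10 * L
  · exact (Finset.card_filter_le _ _).trans (by simpa using hW)
  push Not at hW
  set S := (Finset.range W).filter fun a => (a * d + 2 * L) % W < 4 * L with hS
  have hmaps : ∀ a ∈ S, (a * d + 2 * L) / W ∈ Finset.range (d + 1) := by
    intro a ha
    rw [hS, Finset.mem_filter, Finset.mem_range] at ha
    rw [Finset.mem_range, Nat.div_lt_iff_lt_mul (by omega)]
    have : (a + 1) * d ≤ W * d := Nat.mul_le_mul_right _ ha.1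
    nlinarith
  have hfib : ∀ m ∈ Finset.range (d + 1),
      (S.filter fun a => (a * d + 2 * L) / W = m).card ≤ 4 * L / d + 1 := by
    intro m _
    rcases (S.filter fun a => (a * d + 2 * L) / W = m).eq_empty_or_nonempty with h | h
    · rw [h]; simp
    · set F := S.filter fun a => (a * d + 2 * L) / W = m with hF
      have hsub : F ⊆ Finset.Icc (F.min' h) (F.min' h + 4 * L / d) := by
        intro a ha
        have h0 := F.min'_mem h
        have hle := F.min'_le a ha
        rw [Finset.mem_Icc]
        refine ⟨hle, ?_⟩
        obtain ⟨c, hc⟩ := Nat.exists_eq_add_of_le hle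
        have e0 := Finset.mem_filter.1 h0
        have e1 := Finset.mem_filter.1 ha
        have f0 := (Finset.mem_filter.1 e0.1).2
        have f1 := (Finset.mem_filter.1 e1.1).2
        have g0 := Nat.div_add_mod (F.min' h * d + 2 * L) W
        have g1 := Nat.div_add_mod (a * d + 2 * L) W
        rw [e0.2] at g0
        rw [e1.2] at g1
        have : c ≤ 4 * L / d := by
          rw [Nat.le_div_iff_mul_le hd]
          rw [hc, add_mul] at g1 f1
          omega
        omega
      refine (Finset.card_le_card hsub).trans ?_
      rw [Nat.card_Icc]
      generalize 4 * L / d = c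
      omega
  calc S.card ≤ (4 * L / d + 1) * (Finset.range (d + 1)).card :=
        Finset.card_le_mul_card_image_of_maps_to hmaps _ hfib
    _ = 4 * L / d * d + 4 * L / d + d + 1 := by rw [Finset.card_range]; ring
    _ ≤ 4 * L + 4 * L + d + 1 := by
        have := Nat.div_mul_le_self (4 * L) d
        have := Nat.div_le_self (4 * L) d
        omega
    _ ≤ 10 * L := by omega

/-! ### Lists without repetitions -/

/-- The values `f 0, …, f (n - 1)` in the order of their first occurrences. -/
def uniqList (f : ℕ → ℕ) : ℕ → List ℕ
  | 0 => []
  | n + 1 => if f n ∈ uniqList f n then uniqList f n else uniqList f n ++ [f n]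

theorem mem_uniqList {f : ℕ → ℕ} {n v : ℕ} : v ∈ uniqList f n ↔ ∃ p, p < n ∧ f p = v := by
  induction n with
  | zero => simp [uniqList]
  | succ n ih =>
    have : (∃ p, p < n + 1 ∧ f p = v) ↔ (∃ p, p < n ∧ f p = v) ∨ f n = v := by
      constructor
      · rintro ⟨p, hp, h⟩
        rcases Nat.lt_succ_iff_lt_or_eq.1 hp with h' | rfl
        · exact Or.inl ⟨p, h', h⟩
        · exact Or.inr h
      · rintro (⟨p, hp, h⟩ | h)
        · exact ⟨p, by omega, h⟩
        · exact ⟨n, by omega, h⟩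
    rw [this, ← ih, uniqList]
    split_ifs with h
    · constructor
      · exact Or.inl
      · rintro (h' | rfl)
        · exact h'
        · exact h
    · simp [eq_comm]

theorem nodup_uniqList (f : ℕ → ℕ) (n : ℕ) : (uniqList f n).Nodup := by
  induction n with
  | zero => simp [uniqList]
  | succ n ih =>
    rw [uniqList]
    split_ifs with h
    · exact ih
    · rw [List.nodup_append]
      refine ⟨ih, by simp, ?_⟩
      intro a ha b hb
      rw [List.mem_singleton] at hb
      rintro rfl
      exact h (hb ▸ ha)

theorem length_uniqList_le (f : ℕ → ℕ) (n : ℕ) : (uniqList f n).length ≤ n := by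
  induction n with
  | zero => simp [uniqList]
  | succ n ih =>
    rw [uniqList]
    split_ifs
    · omega
    · simp; omega

/-- A list is stored as `getD · 0` in a memory that is zero elsewhere, so writing to the first free
cell is the same as appending. -/
theorem update_getD (l : List ℕ) (v : ℕ) :
    Function.update (fun i => l.getD i 0) l.length v = fun i => (l ++ [v]).getD i 0 := by
  funext i
  rcases lt_trichotomy i l.length with h | rfl | h
  · rw [Function.update_of_ne h.ne, List.getD_append _ _ _ _ h]
  · simp
  · rw [Function.update_of_ne h.ne']
    rw [List.getD_eq_default _ _ h.le, List.getD_eq_default]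
    simp; omega

end WordRam

/-! ### Parameters and keys. -/

namespace WordRam

/-! ### Parameters of the reduction -/

/-- The word length `w`, the number `n` of input numbers, and the logarithms of the padded number
of inputs, of the number of groups, and of the inverse false positive rate. -/
structure Par where
  (w n lam rho bet : ℕ)
  n_lt : n < 2 ^ lam
  rho_le : rho ≤ lam
  bet_le : bet ≤ lam
  hw : 8 * lam + 32 ≤ w

namespace Par

variable (p : Par)

/-- The word `0` is represented by. -/
def O : ℕ := 2 ^ (p.w / 4)
/-- The padded number of inputs. -/
def P : ℕ := 2 ^ p.lam
/-- The number of groups. -/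
def R : ℕ := 2 ^ p.rho
/-- The size of the groups. -/
def g : ℕ := 2 ^ (p.lam - p.rho)
/-- The number of shifts of a group. -/
def q : ℕ := 2 ^ (p.lam - p.rho + p.bet)
/-- The number of hash values. -/
def Q : ℕ := 2 ^ (2 * (p.lam - p.rho + p.bet))
/-- The logarithm of the number of words of the same hash value. -/
def sh : ℕ := p.w - 2 * (p.lam - p.rho + p.bet)
/-- The number of words of the same hash value. -/
def L : ℕ := 2 ^ p.sh
/-- The number of group pairs for one input number. -/
def S : ℕ := 2 * p.R - 1

theorem O_pos : 0 < p.O := by unfold O; positivity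
theorem P_pos : 0 < p.P := by unfold P; positivity
theorem R_pos : 0 < p.R := by unfold R; positivity
theorem g_pos : 0 < p.g := by unfold g; positivity
theorem q_pos : 0 < p.q := by unfold q; positivity
theorem Q_pos : 0 < p.Q := by unfold Q; positivity
theorem L_pos : 0 < p.L := by unfold L; positivity

theorem R_mul_g : p.R * p.g = p.P := by
  rw [R, g, P, ← pow_add, Nat.add_sub_cancel' p.rho_le]

theorem q_mul_q : p.q * p.q = p.Q := by
  rw [q, Q, ← pow_add, two_mul]

theorem W_eq : 2 ^ p.w = p.L * p.Q := by
  have h1 := p.rho_le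
  have h2 := p.bet_le
  have h3 := p.hw
  rw [L, Q, sh, ← pow_add, Nat.sub_add_cancel (by omega)]

theorem n_lt_P : p.n < p.P := p.n_lt

theorem P_le_O : p.P * 64 ≤ p.O := by
  have h3 := p.hw
  rw [P, O, show 2 ^ p.lam * 64 = 2 ^ (p.lam + 6) by ring]
  exact Nat.pow_le_pow_right (by norm_num) (by omega)

/-- Keys occupy about a quarter of the word length and hash values at most half of it. The gap puts
all differences between sums of two keys and targets within the range of `card_window_le`. -/
theorem O_le_L : p.O * 16 ≤ p.L := by
  have h1 := p.rho_le
  have h2 := p.bet_le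
  have h3 := p.hw
  rw [O, L, sh, show 2 ^ (p.w / 4) * 16 = 2 ^ (p.w / 4 + 4) by ring]
  exact Nat.pow_le_pow_right (by norm_num) (by omega)

theorem O_le_W : p.O * 64 ≤ 2 ^ p.w := by
  have h3 := p.hw
  rw [O, show 2 ^ (p.w / 4) * 64 = 2 ^ (p.w / 4 + 6) by ring]
  exact Nat.pow_le_pow_right (by norm_num) (by omega)

theorem pow_le_W : 2 ^ (8 * p.lam) * 64 ≤ 2 ^ p.w := by
  have h3 := p.hw
  rw [show 2 ^ (8 * p.lam) * 64 = 2 ^ (8 * p.lam + 6) by ring]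
  exact Nat.pow_le_pow_right (by norm_num) (by omega)

theorem R_le_P : p.R ≤ p.P := Nat.pow_le_pow_right (by norm_num) p.rho_le

theorem g_le_P : p.g ≤ p.P := Nat.pow_le_pow_right (by norm_num) (by omega)

theorem q_le : p.q ≤ p.P ^ 2 := by
  have := p.bet_le
  rw [q, P, ← pow_mul]
  exact Nat.pow_le_pow_right (by norm_num) (by omega)

theorem Q_le : p.Q ≤ p.P ^ 4 := by
  rw [← q_mul_q, show p.P ^ 4 = p.P ^ 2 * p.P ^ 2 by ring]
  exact Nat.mul_le_mul p.q_le p.q_le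

theorem P_pow_le_W : p.P ^ 8 * 64 ≤ 2 ^ p.w := by
  have := p.pow_le_W
  rwa [P, ← pow_mul, mul_comm p.lam]

/-- Powers of the number of inputs are far below the number of words. -/
theorem P_pow_le (k : ℕ) (hk : k ≤ 8) : p.P ^ k * 64 ≤ 2 ^ p.w :=
  (Nat.mul_le_mul_right _ (Nat.pow_le_pow_right p.P_pos hk)).trans p.P_pow_le_W

end Par

/-- The registers that hold the parameters. -/
structure Env (p : Par) (s : RamState) : Prop where
  r0 : s.reg 0 = p.n
  r1 : s.reg 1 = p.w
  r2 : s.reg 2 = p.O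
  r4 : s.reg 4 = p.P
  r5 : s.reg 5 = p.R
  r6 : s.reg 6 = p.g
  r7 : s.reg 7 = p.q
  r8 : s.reg 8 = p.Q
  r10 : s.reg 10 = p.sh
  r11 : s.reg 11 = p.S
  r12 : s.reg 12 = p.n * p.S

theorem Env.of_regs {p : Par} {s s' : RamState} (h : Env p s)
    (hr : ∀ r, r < 13 → r ≠ 9 → s'.reg r = s.reg r) : Env p s' := by
  constructor <;> rw [hr _ (by norm_num) (by norm_num)]
  exacts [h.r0, h.r1, h.r2, h.r4, h.r5, h.r6, h.r7, h.r8, h.r10, h.r11, h.r12]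

theorem Env.frame {p : Par} {s s' : RamState} {c : Cmd} (h : Env p s) (hf : Frame c s s')
    (hc : ∀ r ∈ c.regs, 13 ≤ r ∨ r = 9) : Env p s' :=
  h.of_regs fun r hr h9 => hf.1 r fun hm => by rcases hc r hm with h | h <;> omega

/-- The bit length `λ` of `n` (register `3`) and `2 ^ λ` (register `4`). -/
def sizeCmd : Cmd :=
  .seq (.assign 3 0) <| .seq (.assign 4 1) <|
    .while ((Ex.reg 4).lt (.reg 0 + 1)) (.seq (.assign 3 (.reg 3 + 1)) (.assign 4 (.reg 4 + .reg 4)))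

theorem sizeCmd_spec {w n : ℕ} {s : RamState} (h0 : s.reg 0 = n) (hn : n.size + 3 ≤ w) :
    Tri w sizeCmd s (n.size * 3 + 3) fun s' => s'.reg 3 = n.size ∧ s'.reg 4 = 2 ^ n.size := by
  have hlt := Nat.lt_size_self n
  have hW : 2 ^ n.size * 8 ≤ 2 ^ w := by
    rw [show 2 ^ n.size * 8 = 2 ^ (n.size + 3) by ring]
    exact Nat.pow_le_pow_right (by norm_num) hn
  have hsl : n.size < 2 ^ n.size := Nat.lt_two_pow_self
  have f1 : 1 < 2 ^ w := by omega
  have hb : ∀ p : Prop, [Decidable p] → (if p then 1 else 0) % 2 ^ w = if p then 1 else 0 :=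
    fun p _ => bool_mod (by omega) p
  refine Tri.mono (T := 1 + (1 + (∑ i ∈ Finset.range n.size, (2 + 1) + 1)))
    (Q := fun s' => s'.reg 3 = n.size ∧ s'.reg 4 = 2 ^ n.size)
    (Tri.seq (Tri.assign (Tri.seq (Tri.assign ?_)))) (by simp; omega) (fun _ _ h => h)
  refine Tri.while n.size (fun _ => 2) (fun i s' => s'.reg 3 = i ∧ s'.reg 4 = 2 ^ i) ?_ ?_ ?_
  · simp [Nat.mod_eq_of_lt f1]
  · rintro i hi s' hf ⟨h3, h4⟩
    have e0 : s'.reg 0 = n := by rw [hf.1 0 (by decide)]; simp [h0]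
    have hle := Nat.lt_size.1 hi
    have f2 : n + 1 < 2 ^ w := by omega
    have f3 : i + 1 < 2 ^ w := by omega
    have f4 : 2 ^ i + 2 ^ i < 2 ^ w := by omega
    constructor
    · simp only [val_lt, val_add, val_reg, val_one, Nat.mod_eq_of_lt f1, e0, h4,
        Nat.mod_eq_of_lt f2, hb]
      rw [if_pos (by omega)]; exact one_ne_zero
    · refine Tri.seq (Tri.assign (Tri.assign ?_))
      simp [h3, h4, Nat.mod_eq_of_lt f1, Nat.mod_eq_of_lt f3, Nat.mod_eq_of_lt f4]
      ring
  · rintro s' hf ⟨h3, h4⟩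
    have e0 : s'.reg 0 = n := by rw [hf.1 0 (by decide)]; simp [h0]
    have f2 : n + 1 < 2 ^ w := by omega
    simp only [val_lt, val_add, val_reg, val_one, Nat.mod_eq_of_lt f1, e0, h4,
        Nat.mod_eq_of_lt f2, hb]
    rw [if_neg (by omega)]

/-- Compute the parameters, for `ρ = λ a / d` and `β = λ b / d`. -/
def paramCmd (a b d : ℕ) : Cmd :=
  .seq sizeCmd <| .seq (.assign 2 ((1 : Ex).shl (.reg 1 / 4))) <|
  .seq (.assign 13 (.reg 3 * .lit a / .lit d)) <| .seq (.assign 14 (.reg 3 * .lit b / .lit d)) <|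
  .seq (.assign 5 ((1 : Ex).shl (.reg 13))) <| .seq (.assign 6 (.reg 4 / .reg 5)) <|
  .seq (.assign 7 (.reg 6 * (1 : Ex).shl (.reg 14))) <| .seq (.assign 8 (.reg 7 * .reg 7)) <|
  .seq (.assign 10 (.reg 1 - 2 * (.reg 3 - .reg 13 + .reg 14))) <|
  .seq (.assign 11 (.reg 5 + .reg 5 - 1)) (.assign 12 (.reg 0 * .reg 11))

theorem paramCmd_spec {a b d : ℕ} (ha : a ≤ d) (hb : b ≤ d) (p : Par)
    (hlam : p.lam = p.n.size) (hrho : p.rho = p.lam * a / d) (hbet : p.bet = p.lam * b / d)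
    (hdw : p.lam * d < 2 ^ p.w) (hdw' : d < 2 ^ p.w) {s : RamState} (h0 : s.reg 0 = p.n)
    (h1 : s.reg 1 = p.w) :
    Tri p.w (paramCmd a b d) s (p.lam * 3 + 13) (Env p) := by
  have hw := p.hw
  have hww : p.w < 2 ^ p.w := Nat.lt_two_pow_self
  have hrl := p.rho_le
  have hbl := p.bet_le
  have h64 := p.P_pow_le 0 (by norm_num)
  rw [pow_zero, one_mul] at h64
  refine Tri.mono (T := (p.n.size * 3 + 3) + 10)
    (Q := Env p)
    (Tri.seq ((sizeCmd_spec h0 (by omega)).mono le_rfl ?_)) (by omega) (fun _ _ h => h)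
  rintro s' hf ⟨e3, e4⟩
  rw [← hlam] at e3 e4
  have e0 : s'.reg 0 = p.n := (hf.1 0 (by decide)).trans h0
  have e1 : s'.reg 1 = p.w := (hf.1 1 (by decide)).trans h1
  have hP1 := p.P_pow_le 1 (by norm_num)
  rw [pow_one] at hP1
  have hO := p.O_le_W
  have hRP := p.R_le_P
  have hgP := p.g_le_P
  have hq1 := p.q_le
  have hP2 := p.P_pow_le 2 (by norm_num)
  have hP4 := p.P_pow_le 4 (by norm_num)
  have hQ1 := p.Q_le
  have hP0 := p.P_pos
  have hR0 := p.R_pos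
  have hn := p.n_lt_P
  have m1 : 1 % 2 ^ p.w = 1 := Nat.mod_eq_of_lt (by omega)
  have m2 : 2 % 2 ^ p.w = 2 := Nat.mod_eq_of_lt (by omega)
  have m4 : 4 % 2 ^ p.w = 4 := Nat.mod_eq_of_lt (by omega)
  have ma : a % 2 ^ p.w = a := Nat.mod_eq_of_lt (by omega)
  have mb : b % 2 ^ p.w = b := Nat.mod_eq_of_lt (by omega)
  have md : d % 2 ^ p.w = d := Nat.mod_eq_of_lt (by omega)
  have mla : p.lam * a % 2 ^ p.w = p.lam * a :=
    Nat.mod_eq_of_lt ((Nat.mul_le_mul_left _ ha).trans_lt hdw)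
  have mlb : p.lam * b % 2 ^ p.w = p.lam * b :=
    Nat.mod_eq_of_lt ((Nat.mul_le_mul_left _ hb).trans_lt hdw)
  have mw4 : p.w / 4 % 2 ^ p.w = p.w / 4 := Nat.mod_eq_of_lt (by omega)
  have mO : 2 ^ (p.w / 4) % 2 ^ p.w = p.O := Nat.mod_eq_of_lt (by rw [← Par.O]; omega)
  have mrho : p.rho % 2 ^ p.w = p.rho := Nat.mod_eq_of_lt (by omega)
  have mbet : p.bet % 2 ^ p.w = p.bet := Nat.mod_eq_of_lt (by omega)
  have mR : 2 ^ p.rho % 2 ^ p.w = p.R := Nat.mod_eq_of_lt (by rw [← Par.R]; omega)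
  have mB : 2 ^ p.bet % 2 ^ p.w = 2 ^ p.bet :=
    Nat.mod_eq_of_lt (Nat.pow_lt_pow_right (by norm_num) (by omega))
  have mg : p.P / p.R % 2 ^ p.w = p.g := by
    rw [← p.R_mul_g, Nat.mul_div_cancel_left _ p.R_pos]
    exact Nat.mod_eq_of_lt (by omega)
  have mq : p.g * 2 ^ p.bet % 2 ^ p.w = p.q := by
    rw [Par.g, ← pow_add, ← Par.q]
    exact Nat.mod_eq_of_lt (by omega)
  have mQ : p.Q % 2 ^ p.w = p.Q := Nat.mod_eq_of_lt (by omega)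
  have ms1 : (p.lam + (2 ^ p.w - p.rho)) % 2 ^ p.w = p.lam - p.rho := by
    have := sub_word (x := p.lam) (y := p.rho) (W := 2 ^ p.w) hrl (by omega)
    rwa [mrho] at this
  have ms2 : (p.lam - p.rho + p.bet) % 2 ^ p.w = p.lam - p.rho + p.bet :=
    Nat.mod_eq_of_lt (by omega)
  have ms3 : 2 * (p.lam - p.rho + p.bet) % 2 ^ p.w = 2 * (p.lam - p.rho + p.bet) :=
    Nat.mod_eq_of_lt (by omega)
  have ms4 : (p.w + (2 ^ p.w - 2 * (p.lam - p.rho + p.bet))) % 2 ^ p.w = p.sh := by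
    have := sub_word (x := p.w) (y := 2 * (p.lam - p.rho + p.bet)) (W := 2 ^ p.w) (by omega)
      (by omega)
    rwa [ms3] at this
  have mS1 : (p.R + p.R) % 2 ^ p.w = p.R + p.R := Nat.mod_eq_of_lt (by omega)
  have mS2 : (p.R + p.R + (2 ^ p.w - 1)) % 2 ^ p.w = p.S := by
    have := sub_word (x := p.R + p.R) (y := 1) (W := 2 ^ p.w) (by omega) (by omega)
    rw [m1] at this
    rw [this, Par.S, two_mul]
  have mnS : p.n * p.S % 2 ^ p.w = p.n * p.S := by
    apply Nat.mod_eq_of_lt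
    have : p.n * p.S ≤ p.P * (2 * p.P) := Nat.mul_le_mul (by omega) (by rw [Par.S]; omega)
    have h2 : p.P * (2 * p.P) = 2 * p.P ^ 2 := by ring
    omega
  rw [← Par.P] at e4
  refine Tri.assign_seq (v := p.O) (by simp [e1, m1, m4, mw4, mO]) ?_
  refine Tri.assign_seq (v := p.rho) (by simp [e3, ma, md, mla, ← hrho, mrho]) ?_
  refine Tri.assign_seq (v := p.bet) (by simp [e3, mb, md, mlb, ← hbet, mbet]) ?_
  refine Tri.assign_seq (v := p.R) (by simp [m1, mR]) ?_
  refine Tri.assign_seq (v := p.g) (by simp [e4, mg]) ?_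
  refine Tri.assign_seq (v := p.q) (by simp [m1, mB, mq]) ?_
  refine Tri.assign_seq (v := p.Q) (by simp [p.q_mul_q, mQ]) ?_
  refine Tri.assign_seq (v := p.sh) (by simp [e1, e3, m2, mrho, ms1, ms2, ms3, ms4]) ?_
  refine Tri.assign_seq (v := p.S) (by simp [m1, mS1, mS2]) ?_
  refine Tri.assign' (v := p.n * p.S) (by simp [e0, mnS]) ?_
  constructor <;> simp [e0, e1, e4]

/-! ### Keys -/

/-- The keys of the words `a` (the words shifted by `O`), and the keys they are padded with. -/
def padKey (p : Par) (raw : ℕ → ℕ) (i : ℕ) : ℕ :=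
  if i < p.n then (raw i + p.O) % 2 ^ p.w else 4 * p.O + i

/-- Write the padded keys to memory `1`, and mark the keys in memory `3`. -/
def keyCmd : Cmd :=
  .forUp 15 (.reg 4) <| .ite ((Ex.reg 15).lt (.reg 0))
    (.seq (.store 1 (.reg 15) (.ld 0 (.reg 15) + .reg 2)) (.store 3 (.ld 1 (.reg 15)) 1))
    (.store 1 (.reg 15) (4 * .reg 2 + .reg 15))

/-- Memory 3 becomes a lookup table addressed by key. Padding keys are not entered, so they can
never serve as partners; they start at `4 * p.O`, above all real keys and targets. -/
theorem keyCmd_spec {p : Par} {s : RamState} (he : Env p s) (h3 : s.mem 3 = 0) :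
    Tri p.w keyCmd s (p.P * 5 + 2) fun s' =>
      (∀ i, i < p.P → s'.mem 1 i = padKey p (s.mem 0) i) ∧
        ∀ v, s'.mem 3 v ≠ 0 ↔ ∃ i, i < p.n ∧ padKey p (s.mem 0) i = v := by
  have hw := p.hw
  have hP1 := p.P_pow_le 1 (by norm_num)
  rw [pow_one] at hP1
  have hO := p.O_le_W
  have hPO := p.P_le_O
  have hb : ∀ p' : Prop, [Decidable p'] → (if p' then 1 else 0) % 2 ^ p.w = if p' then 1 else 0 :=
    fun p _ => bool_mod (by omega) p
  have hnP := p.n_lt_P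
  have hP0 := p.P_pos
  have m1 : 1 % 2 ^ p.w = 1 := Nat.mod_eq_of_lt (by omega)
  have m4 : 4 % 2 ^ p.w = 4 := Nat.mod_eq_of_lt (by omega)
  refine (Tri.forUp (fun _ => 2 + 1) (fun j s' =>
      (∀ i, i < j → s'.mem 1 i = padKey p (s.mem 0) i) ∧
        ∀ v, s'.mem 3 v ≠ 0 ↔ ∃ i, i < j ∧ i < p.n ∧ padKey p (s.mem 0) i = v) (N := p.P)
    (by omega) (by decide) (fun s' hf => by rw [val_reg, hf.1 4 (by decide), he.r4])
    ⟨by omega, fun v => by simp [h3]⟩ ?_).mono ?_ ?_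
  · rintro j hj s' hf e15 ⟨hI1, hI2⟩
    have he' := he.frame hf (by decide)
    have e0 : s'.mem 0 = s.mem 0 := hf.2 0 (by decide)
    refine Tri.ite ?_ ?_
    · intro hc
      simp only [val_lt, val_reg, e15, he'.r0, hb, ne_eq, ite_eq_right_iff, one_ne_zero, imp_false,
        not_not] at hc
      have hpk : (s.mem 0 j + p.O) % 2 ^ p.w = padKey p (s.mem 0) j := by rw [padKey, if_pos hc]
      refine Tri.seq (Tri.store (Tri.store ?_))
      simp [e15, he'.r2, e0, hpk, m1]
      refine ⟨fun i hi => ?_, fun v => ?_⟩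
      · rcases eq_or_ne i j with rfl | hne
        · rw [Function.update_self]
        · rw [Function.update_of_ne hne, hI1 i (by omega)]
      · rcases eq_or_ne v (padKey p (s.mem 0) j) with rfl | hne
        · rw [Function.update_self]
          simp only [one_ne_zero, not_false_eq_true, true_iff]
          exact ⟨j, by omega, hc, rfl⟩
        · rw [Function.update_of_ne hne]
          refine (hI2 v).trans (exists_congr fun i => ?_)
          constructor
          · rintro ⟨h1, h2⟩; exact ⟨by omega, h2⟩
          · rintro ⟨h1, h2, h3⟩
            refine ⟨lt_of_le_of_ne (by omega) ?_, h2, h3⟩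
            rintro rfl
            exact hne h3.symm
    · intro hc
      simp only [val_lt, val_reg, e15, he'.r0, hb, ite_eq_right_iff, one_ne_zero, imp_false] at hc
      refine (Tri.store ?_).mono one_le_two (fun _ _ h => h)
      simp [e15, he'.r2, m4, Nat.mod_eq_of_lt (by omega : 4 * p.O < 2 ^ p.w),
        Nat.mod_eq_of_lt (by omega : 4 * p.O + j < 2 ^ p.w)]
      refine ⟨fun i hi => ?_, fun v => ?_⟩
      · rcases eq_or_ne i j with rfl | hne
        · rw [Function.update_self, padKey, if_neg hc]
        · rw [Function.update_of_ne hne, hI1 i (by omega)]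
      · refine (hI2 v).trans (exists_congr fun i => ?_)
        constructor
        · rintro ⟨h1, h2⟩; exact ⟨by omega, h2⟩
        · rintro ⟨h1, h2, h3⟩
          exact ⟨by omega, h2, h3⟩
  · simp
  · rintro s' - ⟨⟨h1, h2⟩, -⟩
    refine ⟨h1, fun v => (h2 v).trans (exists_congr fun i => ?_)⟩
    constructor
    · rintro ⟨-, h⟩; exact h
    · rintro ⟨h, h'⟩; exact ⟨by omega, h, h'⟩

end WordRam

/-! ### The program that writes the set families. -/

namespace WordRam

/-! ### Building the families of shifted sets -/

/-- The hash values of the elements of `X`, in both rounding variants, followed by their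
negatives. -/
def entry (p : Par) (X : ℕ → ℕ) (a x : ℕ) : ℕ :=
  if x < p.P + p.P then hash (2 ^ p.w) p.L a (X (x / 2)) + x % 2
  else p.Q - hash (2 ^ p.w) p.L a (X ((x - (p.P + p.P)) / 2))

theorem entry_le (p : Par) (X : ℕ → ℕ) (a x : ℕ) : entry p X a x ≤ p.Q := by
  have := hash_lt (a := a) (x := X (x / 2)) p.W_eq (by positivity)
  rw [entry]
  split_ifs <;> omega

/-- Write the entries to memory `4`. -/
def hashCmd : Cmd :=
  .forUp 15 (.reg 4 + .reg 4) <|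
    .seq (.assign 16 ((.reg 9 * .ld 1 (.reg 15 / 2) : Ex).shr (.reg 10))) <|
    .seq (.store 4 (.reg 15) (.reg 16 + .reg 15 % 2))
      (.store 4 (.reg 15 + (.reg 4 + .reg 4)) (.reg 8 - .reg 16))

theorem hashCmd_spec {p : Par} {s : RamState} (he : Env p s) {a : ℕ} (ha : s.reg 9 = a) :
    Tri p.w hashCmd s (10 * p.P + 2) fun s' =>
      ∀ x, x < 4 * p.P → s'.mem 4 x = entry p (s.mem 1) a x := by
  have hw := p.hw
  have hP1 := p.P_pow_le 1 (by norm_num)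
  rw [pow_one] at hP1
  have hP0 := p.P_pos
  have hQ := p.Q_le
  have hP4 := p.P_pow_le 4 (by norm_num)
  have m1 : 1 % 2 ^ p.w = 1 := Nat.mod_eq_of_lt (by omega)
  have m2 : 2 % 2 ^ p.w = 2 := Nat.mod_eq_of_lt (by omega)
  have mPP : (p.P + p.P) % 2 ^ p.w = p.P + p.P := Nat.mod_eq_of_lt (by omega)
  have hQ0 := p.Q_pos
  refine (Tri.forUp (fun _ => 3) (fun j s' => ∀ x, x < j →
      s'.mem 4 x = entry p (s.mem 1) a x ∧
      s'.mem 4 (x + (p.P + p.P)) = entry p (s.mem 1) a (x + (p.P + p.P))) (N := p.P + p.P)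
    (by omega) (by decide) (fun s' hf => by
      simp [(he.frame hf (by decide)).r4, mPP])
    (by intro x hx; omega) ?_).mono ?_ ?_
  · rintro j hj s' hf e15 hI
    have he' := he.frame hf (by decide)
    have e1 : s'.mem 1 = s.mem 1 := hf.2 1 (by decide)
    have e9 : s'.reg 9 = a := (hf.1 9 (by decide)).trans ha
    have hh : ∀ x, hash (2 ^ p.w) p.L a x < p.Q := fun x => hash_lt p.W_eq (by positivity)
    have hhj := hh (s.mem 1 (j / 2))
    refine Tri.assign_seq (v := hash (2 ^ p.w) p.L a (s.mem 1 (j / 2))) ?_ ?_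
    · simp only [val_shr, val_mul, val_reg, val_ld, val_div, val_two, e9, e1, e15, m2, he'.r10,
        Nat.mod_eq_of_lt (by omega : j / 2 < 2 ^ p.w)]
      rw [← Par.L, ← hash, Nat.mod_eq_of_lt (by omega)]
    refine Tri.store_seq (i := j) (v := hash (2 ^ p.w) p.L a (s.mem 1 (j / 2)) + j % 2)
      (by simp [e15]) ?_ ?_
    · simp [e15, m2, Nat.mod_eq_of_lt (by omega : j % 2 < 2 ^ p.w)]
      exact Nat.mod_eq_of_lt (by omega)
    refine (Tri.store' (i := j + (p.P + p.P)) (v := p.Q - hash (2 ^ p.w) p.L a (s.mem 1 (j / 2)))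
      ?_ ?_ ?_).mono le_rfl (fun _ _ h => h)
    · simp [e15, he'.r4, mPP]
      exact Nat.mod_eq_of_lt (by omega)
    · simp [he'.r8]
      exact sub_word hhj.le (by omega)
    · intro x hx
      simp only [setReg_mem, setMem_mem, if_true]
      have hx2 : (x + (p.P + p.P) - (p.P + p.P)) / 2 = x / 2 := by congr 1; omega
      rcases eq_or_ne x j with rfl | hne
      · rw [Function.update_of_ne (by omega), Function.update_self, Function.update_self,
          entry, entry, if_pos hj, if_neg (by omega), hx2]
        exact ⟨rfl, rfl⟩
      · rw [Function.update_of_ne (by omega), Function.update_of_ne (by omega),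
          Function.update_of_ne (by omega), Function.update_of_ne (by omega)]
        exact hI x (by omega)
  · simp; omega
  · rintro s' - ⟨h, -⟩ x hx
    by_cases hx' : x < p.P + p.P
    · exact (h x hx').1
    · have := (h (x - (p.P + p.P)) (by omega)).2
      rwa [Nat.sub_add_cancel (by omega)] at this

/-- The amount by which the `t`-th set is shifted. -/
def setShift (p : Par) (t : ℕ) : ℕ := if t / p.q < p.R then p.Q - t % p.q * p.q else t % p.q

/-- An element of the `t`-th set that makes it nonempty. -/
def dummy (p : Par) (t : ℕ) : ℕ := if t / p.q < p.R then p.Q else p.Q + 1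

/-- The elements of the `t`-th set, with repetitions. -/
def elem (p : Par) (E : ℕ → ℕ) (t x : ℕ) : ℕ :=
  (E (t / p.q * (p.g + p.g) + x) + setShift p t) % p.Q

/-- The `t`-th set. -/
def shiftedSet (p : Par) (E : ℕ → ℕ) (t : ℕ) : List ℕ :=
  dummy p t :: uniqList (elem p E t) (p.g + p.g)

/-- All hash values with the dummies, followed by the first `m` sets. -/
def setList (p : Par) (E : ℕ → ℕ) (m : ℕ) : List (List ℕ) :=
  List.range (p.Q + 2) :: (List.range m).map (shiftedSet p E)

theorem setList_succ (p : Par) (E : ℕ → ℕ) (m : ℕ) :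
    setList p E (m + 1) = setList p E m ++ [shiftedSet p E m] := by
  simp [setList, List.range_succ]

theorem length_setList (p : Par) (E : ℕ → ℕ) (m : ℕ) : (setList p E m).length = m + 1 := by
  simp [setList]

theorem length_flatten_setList_le (p : Par) (E : ℕ → ℕ) (m : ℕ) :
    (setList p E m).flatten.length ≤ p.Q + 2 + m * (2 * p.g + 1) := by
  induction m with
  | zero => simp [setList]
  | succ m ih =>
    have := length_uniqList_le (elem p E m) (p.g + p.g)
    rw [setList_succ, List.flatten_append, List.length_append, shiftedSet]
    simp only [List.flatten_singleton, List.length_cons]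
    rw [add_mul]
    omega

/-- The starting positions of the sets of `l`. -/
def startPos (l : List (List ℕ)) (i : ℕ) : ℕ :=
  if i ≤ l.length then (l.take i).flatten.length else 0

theorem update_startPos (l : List (List ℕ)) (S : List ℕ) :
    Function.update (startPos l) (l.length + 1) (l ++ [S]).flatten.length =
      startPos (l ++ [S]) := by
  funext i
  rcases lt_trichotomy i (l.length + 1) with h | rfl | h
  · rw [Function.update_of_ne h.ne, startPos, startPos, if_pos (by omega), if_pos (by simp; omega),
      List.take_append_of_le_length (by omega)]
  · rw [Function.update_self, startPos, if_pos (by simp), List.take_of_length_le (by simp)]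
  · rw [Function.update_of_ne h.ne', startPos, startPos, if_neg (by omega), if_neg (by simp; omega)]

/-- Append an element to the current set if it is new. -/
def elemCmd : Cmd :=
  .seq (.assign 24 ((.ld 4 (.reg 19 * (.reg 6 + .reg 6) + .reg 23) + .reg 21) % .reg 8)) <|
    .ite ((Ex.ld 5 (.reg 24)).eq (.reg 18 + 1)) (.assign 24 (.reg 24))
      (.seq (.store 5 (.reg 24) (.reg 18 + 1)) <| .seq (.store 20 (.reg 17) (.reg 24))
        (.assign 17 (.reg 17 + 1)))

/-- The bound on the total size. -/
def Par.N (p : Par) : ℕ := p.Q + 2 + 2 * p.R * p.q * (2 * p.g + 1)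

theorem Par.Rq_le (p : Par) : p.R * p.q ≤ p.P ^ 3 := by
  calc p.R * p.q ≤ p.P * p.P ^ 2 := Nat.mul_le_mul p.R_le_P p.q_le
    _ = p.P ^ 3 := by ring

theorem Par.one_le_P_pow (p : Par) (k : ℕ) : 1 ≤ p.P ^ k := Nat.one_le_pow _ _ p.P_pos

theorem Par.N_le (p : Par) : p.N ≤ 9 * p.P ^ 4 := by
  have h1 := p.Q_le
  have h2 := p.Rq_le
  have h3 := p.q_le
  have h0 := p.one_le_P_pow 4
  have h4 : p.R * p.q * p.g ≤ p.P ^ 3 := by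
    calc p.R * p.q * p.g = p.P * p.q := by rw [← p.R_mul_g]; ring
      _ ≤ p.P * p.P ^ 2 := Nat.mul_le_mul_left _ h3
      _ = p.P ^ 3 := by ring
  have h5 : p.P ^ 3 ≤ p.P ^ 4 := Nat.pow_le_pow_right p.P_pos (by norm_num)
  have h6 : p.N = p.Q + 2 + 4 * (p.R * p.q * p.g) + 2 * (p.R * p.q) := by rw [Par.N]; ring
  omega

theorem Par.N_lt (p : Par) : p.N * 7 ≤ 2 ^ p.w := by
  have h1 := p.N_le
  have h2 := p.P_pow_le 4 (by norm_num)
  omega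

/-- The part of the state that the inner loop for set `t` maintains. -/
structure ElemInv (b : List ℕ) (f : ℕ → ℕ) (t x : ℕ) (s : RamState) : Prop where
  data : s.mem 20 = fun i => (b ++ uniqList f x).getD i 0
  pos : s.reg 17 = (b ++ uniqList f x).length
  mark : ∀ v, s.mem 5 v = t + 1 ↔ v ∈ uniqList f x
  mark_le : ∀ v, s.mem 5 v ≤ t + 1

/-- Repetitions are recognized in constant time by marking each element with the number `t + 1` of
the set being written. Marks of earlier sets are smaller, so the marks are never cleared; the offset
separates set 0 from untouched cells. -/
theorem elemCmd_spec {p : Par} {s : RamState} (he : Env p s) {b : List ℕ} {t x : ℕ}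
    (h18 : s.reg 18 = t) (h19 : s.reg 19 = t / p.q) (h21 : s.reg 21 = setShift p t)
    (h23 : s.reg 23 = x) (ht : t < 2 * p.R * p.q) (hx : x < p.g + p.g)
    (hE : ∀ y, y < 4 * p.P → s.mem 4 y ≤ p.Q) (hb : b.length + (p.g + p.g) ≤ p.N)
    (hI : ElemInv b (elem p (s.mem 4) t) t x s) :
    Tri p.w elemCmd s 5 (ElemInv b (elem p (s.mem 4) t) t (x + 1)) := by
  have hN := p.N_lt
  have hNe : p.N = p.Q + 2 + 2 * p.R * p.q * (2 * p.g + 1) := rfl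
  have hq0 := p.q_pos
  have hP1 := p.P_pow_le 1 (by norm_num)
  rw [pow_one] at hP1
  have hP0 := p.P_pos
  have hQ0 := p.Q_pos
  have hg := p.g_le_P
  have hRg := p.R_mul_g
  have m1 : 1 % 2 ^ p.w = 1 := Nat.mod_eq_of_lt (by omega)
  have hblk : t / p.q < 2 * p.R := Nat.div_lt_of_lt_mul (by rwa [mul_comm])
  have hblk' : (t / p.q + 1) * (p.g + p.g) ≤ 2 * p.R * (p.g + p.g) := Nat.mul_le_mul_right _ hblk
  have hblk2 : 2 * p.R * (p.g + p.g) = 4 * p.P := by rw [← hRg]; ring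
  rw [add_mul, one_mul, hblk2] at hblk'
  have hsh : setShift p t ≤ p.Q := by
    rw [setShift]
    split_ifs
    · omega
    · have := Nat.mod_lt t hq0
      have : p.q * 1 ≤ p.q * p.q := Nat.mul_le_mul_left _ hq0
      rw [p.q_mul_q] at this
      omega
  have htN : t + 1 < 2 ^ p.w := by
    have : 2 * p.R * p.q * 1 ≤ 2 * p.R * p.q * (2 * p.g + 1) := Nat.mul_le_mul_left _ (by omega)
    omega
  set f := elem p (s.mem 4) t with hf
  have hfx : f x < p.Q := Nat.mod_lt _ hQ0
  have hlen := length_uniqList_le f x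
  refine Tri.mono (T := 1 + (3 + 1)) (Q := ElemInv b f t (x + 1)) (Tri.seq (Tri.assign' (v := f x)
    ?_ (Tri.ite ?_ ?_))) le_rfl (fun _ _ h => h)
  · have f1 : p.g + p.g < 2 ^ p.w := by omega
    have f2 : t / p.q * (p.g + p.g) < 2 ^ p.w := by omega
    have f3 : t / p.q * (p.g + p.g) + x < 2 ^ p.w := by omega
    have hE' := hE (t / p.q * (p.g + p.g) + x) (by omega)
    have f4 : s.mem 4 (t / p.q * (p.g + p.g) + x) + setShift p t < 2 ^ p.w := by omega
    simp [h19, h21, h23, he.r6, he.r8, Nat.mod_eq_of_lt f1, Nat.mod_eq_of_lt f2,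
      Nat.mod_eq_of_lt f3, Nat.mod_eq_of_lt f4]
    exact Nat.mod_eq_of_lt ((Nat.mod_lt _ hQ0).trans (by omega))
  · intro hc
    have hmem : s.mem 5 (f x) = t + 1 := by
      by_contra h
      simp [h18, m1, Nat.mod_eq_of_lt htN, h] at hc
    refine (Tri.assign' (v := f x) (by simp) ?_).mono (by norm_num) (fun _ _ h => h)
    have hu : uniqList f (x + 1) = uniqList f x := by
      rw [uniqList, if_pos ((hI.mark _).1 hmem)]
    refine ⟨?_, ?_, ?_, ?_⟩
    · rw [hu]; exact hI.data
    · rw [hu]; simpa using hI.pos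
    · rw [hu]; exact hI.mark
    · exact hI.mark_le
  · intro hc
    have hmem : s.mem 5 (f x) ≠ t + 1 := by
      intro h
      simp [h18, m1, Nat.mod_eq_of_lt htN, h] at hc
    have hu : uniqList f (x + 1) = uniqList f x ++ [f x] := by
      rw [uniqList, if_neg (fun h => hmem ((hI.mark _).2 h))]
    refine Tri.store_seq (i := f x) (v := t + 1) (by simp)
      (by simp [h18, m1, Nat.mod_eq_of_lt htN]) ?_
    refine Tri.store_seq (i := (b ++ uniqList f x).length) (v := f x) (by simp [hI.pos])
      (by simp) ?_
    have hl : (b ++ uniqList f x).length + 1 < 2 ^ p.w := by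
      rw [List.length_append]; omega
    refine Tri.assign' (v := (b ++ uniqList f x).length + 1) ?_ ?_
    · simp only [val_add, val_reg, val_one, setMem_reg, setReg_reg, hI.pos, m1]
      norm_num
      rw [List.length_append] at hl
      exact Nat.mod_eq_of_lt hl
    refine ⟨?_, ?_, ?_, ?_⟩
    · rw [hu, ← List.append_assoc, ← update_getD, ← hI.data]
      simp
    · rw [hu, ← List.append_assoc]
      simp; omega
    · intro v
      rw [hu, List.mem_append, List.mem_singleton, ← hI.mark]
      rcases eq_or_ne v (f x) with rfl | hne
      · simp
      · simp [hne]
    · intro v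
      rcases eq_or_ne v (f x) with rfl | hne
      · simp
      · simpa [hne] using hI.mark_le v

/-- Write the set with the number in register `18`. -/
def setCmd : Cmd :=
  .seq (.assign 19 (.reg 18 / .reg 7)) <| .seq (.assign 20 (.reg 18 % .reg 7)) <|
  .seq (.ite ((Ex.reg 19).lt (.reg 5))
      (.seq (.assign 21 (.reg 8 - .reg 20 * .reg 7)) (.assign 22 (.reg 8)))
      (.seq (.assign 21 (.reg 20)) (.assign 22 (.reg 8 + 1)))) <|
  .seq (.store 20 (.reg 17) (.reg 22)) <| .seq (.assign 17 (.reg 17 + 1)) <|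
  .seq (.forUp 23 (.reg 6 + .reg 6) elemCmd) (.store 21 (.reg 18 + 2) (.reg 17))

/-- The part of the state that the loop over the sets maintains. -/
structure SetInv (l : List (List ℕ)) (t : ℕ) (s : RamState) : Prop where
  data : s.mem 20 = fun i => l.flatten.getD i 0
  pos : s.reg 17 = l.flatten.length
  start : s.mem 21 = startPos l
  mark_le : ∀ v, s.mem 5 v ≤ t

theorem setCmd_spec {p : Par} {s : RamState} (he : Env p s) {t : ℕ}
    (h18 : s.reg 18 = t) (ht : t < 2 * p.R * p.q)
    (hE : ∀ y, y < 4 * p.P → s.mem 4 y ≤ p.Q) (hI : SetInv (setList p (s.mem 4) t) t s) :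
    Tri p.w setCmd s (14 * p.g + 10) (SetInv (setList p (s.mem 4) (t + 1)) (t + 1)) := by
  have hN := p.N_lt
  have hNe : p.N = p.Q + 2 + 2 * p.R * p.q * (2 * p.g + 1) := rfl
  have hw := p.hw
  have hq0 := p.q_pos
  have hQ0 := p.Q_pos
  have hqQ : p.q ≤ p.Q := by
    have : p.q * 1 ≤ p.q * p.q := Nat.mul_le_mul_left _ hq0
    rwa [mul_one, p.q_mul_q] at this
  have hP1 := p.P_pow_le 1 (by norm_num)
  rw [pow_one] at hP1
  have hP0 := p.P_pos
  have hg := p.g_le_P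
  have hlen := length_flatten_setList_le p (s.mem 4) t
  have hsz : t * (2 * p.g + 1) + (2 * p.g + 1) ≤ 2 * p.R * p.q * (2 * p.g + 1) := by
    have : (t + 1) * (2 * p.g + 1) ≤ 2 * p.R * p.q * (2 * p.g + 1) := Nat.mul_le_mul_right _ ht
    rwa [add_mul, one_mul] at this
  have htt : t * 1 ≤ t * (2 * p.g + 1) := Nat.mul_le_mul_left _ (by omega)
  have m1 : 1 % 2 ^ p.w = 1 := Nat.mod_eq_of_lt (by omega)
  have m2 : 2 % 2 ^ p.w = 2 := Nat.mod_eq_of_lt (by omega)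
  have hdt := Nat.div_le_self t p.q
  have hmt := Nat.mod_lt t hq0
  have hmq : t % p.q * p.q ≤ p.Q := by
    rw [← p.q_mul_q]; exact Nat.mul_le_mul_right _ hmt.le
  have hb : ∀ p' : Prop, [Decidable p'] → (if p' then 1 else 0) % 2 ^ p.w = if p' then 1 else 0 :=
    fun p _ => bool_mod (by omega) p
  refine Tri.mono (T := ((2 + 1) + ((((p.g + p.g) * 7 + 2) + 1) + 1 + 1)) + 1 + 1)
    (Q := SetInv (setList p (s.mem 4) (t + 1)) (t + 1)) ?_ (by omega) (fun _ _ h => h)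
  refine Tri.assign_seq (v := t / p.q)
    (by simp [h18, he.r7, Nat.mod_eq_of_lt (by omega : t / p.q < 2 ^ p.w)]) ?_
  refine Tri.assign_seq (v := t % p.q)
    (by simp [h18, he.r7, Nat.mod_eq_of_lt (by omega : t % p.q < 2 ^ p.w)]) ?_
  refine Tri.seq ?_
  have hif : Tri p.w (.ite ((Ex.reg 19).lt (.reg 5))
      (.seq (.assign 21 (.reg 8 - .reg 20 * .reg 7)) (.assign 22 (.reg 8)))
      (.seq (.assign 21 (.reg 20)) (.assign 22 (.reg 8 + 1))))
      ((s.setReg 19 (t / p.q)).setReg 20 (t % p.q)) (2 + 1)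
      (fun s' => s'.reg 21 = setShift p t ∧ s'.reg 22 = dummy p t) := by
    refine Tri.ite (fun hc => ?_) (fun hc => ?_)
    · have hlt : t / p.q < p.R := by
        by_contra h
        simp [he.r5, h] at hc
      refine Tri.assign_seq (v := setShift p t) ?_ (Tri.assign' (v := dummy p t) ?_ ?_)
      · simp [he.r8, he.r7, setShift, hlt,
          Nat.mod_eq_of_lt (by omega : t % p.q * p.q < 2 ^ p.w)]
        have := sub_word hmq (by omega : p.Q < 2 ^ p.w)
        rwa [Nat.mod_eq_of_lt (by omega : t % p.q * p.q < 2 ^ p.w)] at this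
      · simp [he.r8, dummy, hlt]
      · simp
    · have hlt : ¬ t / p.q < p.R := by
        intro h
        simp [he.r5, h, m1] at hc
      refine Tri.assign_seq (v := setShift p t) ?_ (Tri.assign' (v := dummy p t) ?_ ?_)
      · simp [setShift, hlt]
      · simp [he.r8, dummy, hlt, m1, Nat.mod_eq_of_lt (by omega : p.Q + 1 < 2 ^ p.w)]
      · simp
  refine hif.mono le_rfl ?_
  rintro s₁ hf₁ ⟨e21, e22⟩
  have he₁ : Env p s₁ := Env.frame (he.of_regs fun r hr _ => by
    rw [setReg_reg, if_neg (by omega), setReg_reg, if_neg (by omega)]) hf₁ (by decide)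
  have e17 : s₁.reg 17 = (setList p (s.mem 4) t).flatten.length := by
    rw [hf₁.1 17 (by decide)]; simpa using hI.pos
  have e18 : s₁.reg 18 = t := by
    rw [hf₁.1 18 (by decide)]; simpa using h18
  have e19 : s₁.reg 19 = t / p.q := by
    rw [hf₁.1 19 (by decide)]; simp
  have em : s₁.mem = s.mem := by
    funext a
    rw [hf₁.2 a (by simp [Cmd.mems])]; simp
  set b := (setList p (s.mem 4) t).flatten with hbdef
  refine Tri.store_seq (i := b.length) (v := dummy p t) (by simp [e17]) (by simp [e22]) ?_
  refine Tri.assign_seq (v := b.length + 1)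
    (by simp [e17, m1, Nat.mod_eq_of_lt (by omega : b.length + 1 < 2 ^ p.w)]) ?_
  refine Tri.seq (T₁ := (p.g + p.g) * 7 + 2) (T₂ := 1) ((Tri.forUp (w := p.w) (i := 23) (e := .reg 6 + .reg 6) (c := elemCmd)
      (fun _ => 5) (fun x s' => ElemInv (b ++ [dummy p t])
      (elem p (s.mem 4) t) t x s') (N := p.g + p.g) (by omega) (by decide) (fun s' hf => ?_) ?_
      ?_).mono (T' := (p.g + p.g) * 7 + 2) (by simp) ?_)
  · simp [hf.1 6 (by decide), he₁.r6, Nat.mod_eq_of_lt (by omega : p.g + p.g < 2 ^ p.w)]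
  · refine ⟨?_, by simp [uniqList], fun v => ?_, fun v => ?_⟩
    · rw [uniqList, List.append_nil, ← update_getD, ← hI.data]
      simp [em]
    · have := hI.mark_le v
      simp [uniqList, em]
      omega
    · have := hI.mark_le v
      simp [em]
      omega
  · rintro x hx s' hf e23 hI'
    have e4 : s'.mem 4 = s.mem 4 := by rw [hf.2 4 (by decide)]; simp [em]
    have := elemCmd_spec (s := s') (b := b ++ [dummy p t]) (t := t) (x := x)
      (Env.frame (he₁.of_regs fun r hr _ => by
        rw [setReg_reg, if_neg (by omega), setMem_reg]) hf (by decide))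
      (by rw [hf.1 18 (by decide)]; simp [e18]) (by rw [hf.1 19 (by decide)]; simp [e19])
      (by rw [hf.1 21 (by decide)]; simp [e21]) e23 ht hx (by rwa [e4])
      (by rw [List.length_append, List.length_singleton]; omega) (by rwa [e4])
    rw [e4] at this
    refine this.mono le_rfl fun s'' _ h => ?_
    exact ⟨h.data, by simpa using h.pos, h.mark, h.mark_le⟩
  · rintro s₂ hf₂ ⟨hI₂, -⟩
    have e18' : s₂.reg 18 = t := by rw [hf₂.1 18 (by decide)]; simp [e18]
    have e21' : s₂.mem 21 = s.mem 21 := by rw [hf₂.2 21 (by decide)]; simp [em]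
    have hfl : b ++ [dummy p t] ++ uniqList (elem p (s.mem 4) t) (p.g + p.g) =
        (setList p (s.mem 4) (t + 1)).flatten := by
      rw [setList_succ, List.flatten_append, List.flatten_singleton, shiftedSet]
      simp [hbdef]
    refine Tri.store' (i := t + 2) (v := (setList p (s.mem 4) (t + 1)).flatten.length)
      (by simp [e18', m2, Nat.mod_eq_of_lt (by omega : t + 2 < 2 ^ p.w)])
      (by rw [val_reg, hI₂.pos, hfl]) ?_
    refine ⟨?_, ?_, ?_, ?_⟩
    · rw [← hfl]
      simpa using hI₂.data
    · rw [← hfl]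
      simpa using hI₂.pos
    · have := update_startPos (setList p (s.mem 4) t) (shiftedSet p (s.mem 4) t)
      rw [← setList_succ, length_setList, ← hI.start, ← e21'] at this
      simpa using this
    · simpa using hI₂.mark_le

/-- Write all sets to memory `20`, and their starting positions to memory `21`. -/
def buildCmd : Cmd :=
  .seq (.forUp 15 (.reg 8 + 2) (.store 20 (.reg 15) (.reg 15))) <|
  .seq (.assign 17 (.reg 8 + 2)) <| .seq (.store 21 1 (.reg 17))
  (.forUp 18 ((.reg 5 + .reg 5) * .reg 7) setCmd)

theorem buildCmd_spec {p : Par} {s : RamState} (he : Env p s)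
    (hE : ∀ y, y < 4 * p.P → s.mem 4 y ≤ p.Q) (h5 : s.mem 5 = 0) (h20 : s.mem 20 = 0)
    (h21 : s.mem 21 = 0) :
    Tri p.w buildCmd s (12 * p.N + 6) fun s' =>
      s'.mem 20 = (fun i => (setList p (s.mem 4) (2 * p.R * p.q)).flatten.getD i 0) ∧
      s'.mem 21 = startPos (setList p (s.mem 4) (2 * p.R * p.q)) ∧
      s'.reg 17 = (setList p (s.mem 4) (2 * p.R * p.q)).flatten.length := by
  have hN := p.N_lt
  have hNe : p.N = p.Q + 2 + 2 * p.R * p.q * (2 * p.g + 1) := rfl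
  have hQ0 := p.Q_pos
  have hR0 := p.R_pos
  have hq0 := p.q_pos
  have hsz : 2 * p.R * p.q * 1 ≤ 2 * p.R * p.q * (2 * p.g + 1) := Nat.mul_le_mul_left _ (by omega)
  have hsz2 : 2 * p.R * 1 ≤ 2 * p.R * p.q := Nat.mul_le_mul_left _ hq0
  have m1 : 1 % 2 ^ p.w = 1 := Nat.mod_eq_of_lt (by omega)
  have m2 : 2 % 2 ^ p.w = 2 := Nat.mod_eq_of_lt (by omega)
  have mQ : (p.Q + 2) % 2 ^ p.w = p.Q + 2 := Nat.mod_eq_of_lt (by omega)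
  have mR : (p.R + p.R) * p.q % 2 ^ p.w = 2 * p.R * p.q := by
    rw [← two_mul]; exact Nat.mod_eq_of_lt (by omega)
  have mR' : (p.R + p.R) % 2 ^ p.w = p.R + p.R := Nat.mod_eq_of_lt (by omega)
  refine Tri.mono (T := ((p.Q + 2) * 3 + 2) + ((2 * p.R * p.q * (14 * p.g + 12) + 2) + 1 + 1))
    (Q := fun s' =>
      s'.mem 20 = (fun i => (setList p (s.mem 4) (2 * p.R * p.q)).flatten.getD i 0) ∧
      s'.mem 21 = startPos (setList p (s.mem 4) (2 * p.R * p.q)) ∧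
      s'.reg 17 = (setList p (s.mem 4) (2 * p.R * p.q)).flatten.length) (Tri.seq ?_) ?_
    (fun _ _ h => h)
  swap
  · rw [hNe]
    have : 2 * p.R * p.q * (14 * p.g + 12) ≤ 2 * p.R * p.q * (12 * (2 * p.g + 1)) :=
      Nat.mul_le_mul_left _ (by omega)
    have h2 : 2 * p.R * p.q * (12 * (2 * p.g + 1)) = 12 * (2 * p.R * p.q * (2 * p.g + 1)) := by
      ring
    omega
  refine (Tri.forUp (fun _ => 1) (fun j s' => s'.mem 20 = fun i => (List.range j).getD i 0)
    (N := p.Q + 2) (by omega) (by decide) (fun s' hf => by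
      simp [(he.frame hf (by decide)).r8, m2, mQ]) (by simp [h20]; rfl) ?_).mono (by simp) ?_
  · rintro j hj s' hf e15 hI
    refine Tri.store' (i := j) (v := j) (by simp [e15]) (by simp [e15]) ?_
    have := update_getD (List.range j) j
    rw [List.length_range, ← List.range_succ, ← hI] at this
    simpa using this
  rintro s₁ hf₁ ⟨hI₁, -⟩
  have he₁ := he.frame hf₁ (by decide)
  refine Tri.assign_seq (v := p.Q + 2) (by simp [he₁.r8, m2, mQ]) ?_
  refine Tri.store_seq (i := 1) (v := p.Q + 2) (by simp [m1]) (by simp) ?_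
  refine (Tri.forUp (fun _ => 14 * p.g + 10) (fun t s' => SetInv (setList p (s.mem 4) t) t s')
    (N := 2 * p.R * p.q) (by omega) (by decide) (fun s' hf => ?_) ?_ ?_).mono (by simp) ?_
  · have : Env p s' := Env.frame (he₁.of_regs fun r hr _ => by
      rw [setMem_reg, setReg_reg, if_neg (by omega)]) hf (by decide)
    simp [this.r5, this.r7, mR, mR']
  · refine ⟨by simpa [setList] using hI₁, by simp [setList], ?_, fun v => ?_⟩
    · have h := update_startPos [] (List.range (p.Q + 2))
      simp only [List.nil_append, List.length_nil, zero_add, List.flatten_singleton,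
        List.length_range] at h
      simp only [setList, List.range_zero, List.map_nil, setReg_mem, setMem_mem, if_true, ← h,
        hf₁.2 21 (by decide), h21]
      congr 1
      funext i
      simp [startPos]
    · simp [hf₁.2 5 (by decide), h5]
  · rintro t ht s' hf e18 hI
    have e4 : s'.mem 4 = s.mem 4 := by
      rw [hf.2 4 (by decide)]; simp [hf₁.2 4 (by decide)]
    have := setCmd_spec (s := s') (t := t) (Env.frame (he₁.of_regs fun r hr _ => by
      rw [setMem_reg, setReg_reg, if_neg (by omega)]) hf (by decide)) e18 ht (by rwa [e4])
      (by rwa [e4])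
    rw [e4] at this
    refine this.mono le_rfl fun s'' _ h => ?_
    exact ⟨h.data, by simpa using h.pos, h.start, h.mark_le⟩
  · rintro s' - ⟨h, -⟩
    exact ⟨h.data, h.start, h.pos⟩

end WordRam

/-! ### The programs that write the queries and verify the hits. -/

namespace WordRam

/-! ### The queries -/

/-- The sum that two elements must have to be a solution with the `i`-th input number. -/
def target (p : Par) (raw : ℕ → ℕ) (i : ℕ) : ℕ := padKey p raw i + p.O

/-- The pair of groups of a query. -/
def queryCell (p : Par) (raw X : ℕ → ℕ) (x : ℕ) : ℕ × ℕ :=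
  stair X p.R p.g (target p raw (x / p.S)) (x % p.S)

/-- The hash value of the target of a query. -/
def queryHash (p : Par) (raw : ℕ → ℕ) (a x : ℕ) : ℕ :=
  hash (2 ^ p.w) p.L a (target p raw (x / p.S))

/-- Write the next query, and go to the next pair of groups. -/
def stairCmd : Cmd :=
  .seq (.assign 21 (.reg 15 * .reg 11 + .reg 20)) <|
  .seq (.store 6 (.reg 21) (1 + .reg 18 * .reg 7 + .reg 17 / .reg 7)) <|
  .seq (.store 7 (.reg 21) (.reg 19 * .reg 7 + .reg 17 % .reg 7)) <|
  .seq (.store 9 (.reg 21) (.reg 18)) <|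
  .ite (((Ex.reg 18 + 1).lt (.reg 5)) * ((Ex.reg 19).lt 1 +
      (.ld 1 (.reg 18 * .reg 6 + .reg 6 - 1) + .ld 1 (.reg 19 * .reg 6 - 1) : Ex).lt (.reg 16)))
    (.assign 18 (.reg 18 + 1)) (.assign 19 (.reg 19 - (0 : Ex).lt (.reg 19)))

/-- Write all queries: the indices of the sets to memories `6` and `7`, and the group of the first
set to memory `9`. -/
def queryCmd : Cmd :=
  .forUp 15 (.reg 0) <| .seq (.assign 16 (.ld 0 (.reg 15) + .reg 2 + .reg 2)) <|
  .seq (.assign 17 ((.reg 9 * .reg 16 : Ex).shr (.reg 10))) <| .seq (.assign 18 0) <|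
  .seq (.assign 19 (.reg 5 - 1)) (.forUp 20 (.reg 11) stairCmd)

/-- The first `m` queries have been written. -/
def QueryInv (p : Par) (raw X : ℕ → ℕ) (a m : ℕ) (s : RamState) : Prop :=
  ∀ x, x < m →
    s.mem 6 x = 1 + (queryCell p raw X x).1 * p.q + queryHash p raw a x / p.q ∧
    s.mem 7 x = (queryCell p raw X x).2 * p.q + queryHash p raw a x % p.q ∧
    s.mem 9 x = (queryCell p raw X x).1

theorem Par.S_pos (p : Par) : 0 < p.S := by
  have := p.R_pos
  rw [S]; omega

theorem Par.S_le (p : Par) : p.S ≤ 2 * p.P := by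
  have := p.R_le_P
  rw [S]; omega

theorem Par.nS_lt (p : Par) : p.n * p.S * 16 < 2 ^ p.w := by
  have h2 := p.P_pow_le 2 (by norm_num)
  have h3 := p.one_le_P_pow 2
  have : p.n * p.S ≤ p.P * (2 * p.P) := Nat.mul_le_mul p.n_lt_P.le p.S_le
  have h4 : p.P * (2 * p.P) = 2 * p.P ^ 2 := by ring
  omega

theorem stairCmd_spec {p : Par} {s : RamState} (he : Env p s) {a i τ : ℕ} {raw : ℕ → ℕ}
    (h15 : s.reg 15 = i) (h20 : s.reg 20 = τ) (hi : i < p.n) (hτ : τ < p.S)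
    (h16 : s.reg 16 = target p raw i) (h17 : s.reg 17 = hash (2 ^ p.w) p.L a (target p raw i))
    (hX : ∀ x, x < p.P → s.mem 1 x < 5 * p.O)
    (h18 : s.reg 18 = (stair (s.mem 1) p.R p.g (target p raw i) τ).1)
    (h19 : s.reg 19 = (stair (s.mem 1) p.R p.g (target p raw i) τ).2)
    (hI : QueryInv p raw (s.mem 1) a (i * p.S + τ) s) :
    Tri p.w stairCmd s 6 fun s' =>
      QueryInv p raw (s.mem 1) a (i * p.S + (τ + 1)) s' ∧
      s'.reg 18 = (stair (s.mem 1) p.R p.g (target p raw i) (τ + 1)).1 ∧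
      s'.reg 19 = (stair (s.mem 1) p.R p.g (target p raw i) (τ + 1)).2 := by
  have hS := p.nS_lt
  have hiS : (i + 1) * p.S ≤ p.n * p.S := Nat.mul_le_mul_right _ hi
  rw [add_mul, one_mul] at hiS
  have hw := p.hw
  have hO := p.O_le_W
  have hR0 := p.R_pos
  have hg0 := p.g_pos
  have hq0 := p.q_pos
  have hP3 := p.P_pow_le 3 (by norm_num)
  have hP4 := p.P_pow_le 4 (by norm_num)
  have hP3' := p.one_le_P_pow 3
  have hP1 := p.P_pow_le 1 (by norm_num)
  rw [pow_one] at hP1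
  have hRP := p.R_le_P
  have hP0 := p.P_pos
  have hRg := p.R_mul_g
  have hRq := p.Rq_le
  have hQ := p.Q_le
  have m1 : 1 % 2 ^ p.w = 1 := Nat.mod_eq_of_lt (by omega)
  have hb : ∀ p' : Prop, [Decidable p'] → (if p' then 1 else 0) % 2 ^ p.w = if p' then 1 else 0 :=
    fun p _ => bool_mod (by omega) p
  have hst := stair_lt (X := s.mem 1) (g := p.g) (T := target p raw i) hR0 τ
  have hstep : stair (s.mem 1) p.R p.g (target p raw i) (τ + 1) =
      stairStep (s.mem 1) p.R p.g (target p raw i) (s.reg 18, s.reg 19) := by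
    rw [h18, h19]; rfl
  have hhash := hash_lt (a := a) (x := target p raw i) p.W_eq (by positivity)
  obtain ⟨h, hh⟩ : ∃ h, hash (2 ^ p.w) p.L a (target p raw i) = h := ⟨_, rfl⟩
  rw [hh] at h17 hhash
  have hcell : queryCell p raw (s.mem 1) (i * p.S + τ) =
      stair (s.mem 1) p.R p.g (target p raw i) τ := by
    rw [queryCell, Nat.add_mod, Nat.mul_mod_left, zero_add, Nat.mod_mod, Nat.mod_eq_of_lt hτ,
      mul_comm, Nat.mul_add_div p.S_pos, Nat.div_eq_of_lt hτ, add_zero]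
  have hqh : queryHash p raw a (i * p.S + τ) = h := by
    rw [queryHash, mul_comm, Nat.mul_add_div p.S_pos, Nat.div_eq_of_lt hτ, add_zero, hh]
  obtain ⟨⟨c, d⟩, hcd⟩ : ∃ c, stair (s.mem 1) p.R p.g (target p raw i) τ = c := ⟨_, rfl⟩
  rw [hcd] at h18 h19 hst hcell
  rw [hstep, h18, h19]
  simp only at h18 h19 hst
  have hc1 : (c + 1) * p.g ≤ p.R * p.g := Nat.mul_le_mul_right _ hst.1
  have hd1 : (d + 1) * p.g ≤ p.R * p.g := Nat.mul_le_mul_right _ hst.2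
  have hc2 : (c + 1) * p.q ≤ p.R * p.q := Nat.mul_le_mul_right _ hst.1
  have hd2 : (d + 1) * p.q ≤ p.R * p.q := Nat.mul_le_mul_right _ hst.2
  rw [add_mul, one_mul] at hc1 hd1 hc2 hd2
  have hdivq : h / p.q < p.q := Nat.div_lt_of_lt_mul (by rwa [p.q_mul_q])
  have hmodq : h % p.q < p.q := Nat.mod_lt _ hq0
  refine Tri.assign_seq (T := 5) (v := i * p.S + τ) ?_ ?_
  · simp [h15, h20, he.r11, Nat.mod_eq_of_lt (by omega : i * p.S < 2 ^ p.w),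
      Nat.mod_eq_of_lt (by omega : i * p.S + τ < 2 ^ p.w)]
  refine Tri.store_seq (T := 4) (i := i * p.S + τ) (v := 1 + c * p.q + h / p.q) (by simp) ?_ ?_
  · simp [h18, h17, he.r7, m1, Nat.mod_eq_of_lt (by omega : c * p.q < 2 ^ p.w),
      Nat.mod_eq_of_lt (by omega : h / p.q < 2 ^ p.w),
      Nat.mod_eq_of_lt (by omega : 1 + c * p.q < 2 ^ p.w)]
    exact Nat.mod_eq_of_lt (by omega)
  refine Tri.store_seq (T := 3) (i := i * p.S + τ) (v := d * p.q + h % p.q) (by simp) ?_ ?_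
  · simp [h19, h17, he.r7, Nat.mod_eq_of_lt (by omega : d * p.q < 2 ^ p.w)]
    exact Nat.mod_eq_of_lt (by omega)
  refine Tri.store_seq (T := 2) (i := i * p.S + τ) (v := c) (by simp) (by simp [h18]) ?_
  set s₁ := (((s.setReg 21 (i * p.S + τ)).setMem 6 (i * p.S + τ) (1 + c * p.q + h / p.q)).setMem 7
    (i * p.S + τ) (d * p.q + h % p.q)).setMem 9 (i * p.S + τ) c with hs₁
  have hI₁ : QueryInv p raw (s.mem 1) a (i * p.S + (τ + 1)) s₁ := by
    intro x hx
    rcases eq_or_ne x (i * p.S + τ) with rfl | hne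
    · rw [hcell, hqh]
      simp [hs₁]
    · have := hI x (by omega)
      simpa [hs₁, Function.update_of_ne hne] using this
  have r1 : s₁.mem 1 = s.mem 1 := by simp [hs₁]
  have rr : ∀ r, r ≠ 21 → s₁.reg r = s.reg r := fun r hr => by simp [hs₁, hr]
  have r5 := (rr 5 (by norm_num)).trans he.r5
  have r6 := (rr 6 (by norm_num)).trans he.r6
  have r16 := (rr 16 (by norm_num)).trans h16
  have r18 := (rr 18 (by norm_num)).trans h18
  have r19 := (rr 19 (by norm_num)).trans h19
  clear_value s₁
  have i1 : (c * p.g + p.g + (2 ^ p.w - 1)) % 2 ^ p.w = c * p.g + p.g - 1 := by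
    have := sub_word (x := c * p.g + p.g) (y := 1) (W := 2 ^ p.w) (by omega) (by omega)
    rwa [m1] at this
  have hcond : (((Ex.reg 18 + 1).lt (.reg 5)) * ((Ex.reg 19).lt 1 +
      (.ld 1 (.reg 18 * .reg 6 + .reg 6 - 1) + .ld 1 (.reg 19 * .reg 6 - 1) : Ex).lt
      (.reg 16))).val p.w s₁ = 0 ↔ ¬ (c + 1 < p.R ∧ (d < 1 ∨
        s.mem 1 (c * p.g + p.g - 1) + s.mem 1 (d * p.g - 1) < target p raw i)) := by
    simp only [val_mul, val_lt, val_add, val_sub, val_ld, val_reg, val_one, m1, r5, r6, r16, r18,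
      r19, r1, hb, Nat.mod_eq_of_lt (by omega : c + 1 < 2 ^ p.w),
      Nat.mod_eq_of_lt (by omega : c * p.g < 2 ^ p.w),
      Nat.mod_eq_of_lt (by omega : d * p.g < 2 ^ p.w),
      Nat.mod_eq_of_lt (by omega : c * p.g + p.g < 2 ^ p.w), i1]
    rw [and_or_word (by omega)]
    refine not_congr (and_congr_right fun hc => ?_)
    -- For `d = 0` the address `d * g - 1` wraps around and a meaningless cell is read, but then the
    -- other disjunct already decides the test.
    by_cases hd : d < 1
    · simp [hd]
    · have hdg : 1 * p.g ≤ d * p.g := Nat.mul_le_mul_right _ (by omega)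
      have i2 : (d * p.g + (2 ^ p.w - 1)) % 2 ^ p.w = d * p.g - 1 := by
        have := sub_word (x := d * p.g) (y := 1) (W := 2 ^ p.w) (by omega) (by omega)
        rwa [m1] at this
      have b1 := hX (c * p.g + p.g - 1) (by omega)
      have b2 := hX (d * p.g - 1) (by omega)
      rw [i2, Nat.mod_eq_of_lt (by omega)]
  refine Tri.ite (T := 1) (fun hc => ?_) (fun hc => ?_)
  · rw [Ne, hcond, not_not] at hc
    refine Tri.assign' (v := c + 1) (by
      simp [r18, m1, Nat.mod_eq_of_lt (by omega : c + 1 < 2 ^ p.w)]) ?_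
    rw [stairStep, if_pos hc]
    exact ⟨hI₁, by simp, by simp [r19]⟩
  · rw [hcond] at hc
    refine Tri.assign' (v := d - 1) ?_ ?_
    · simp only [val_sub, val_lt, val_reg, val_zero, r19, hb]
      have := sub_word (x := d) (y := if 0 < d then 1 else 0) (W := 2 ^ p.w)
        (by split_ifs <;> omega) (by omega)
      rw [hb] at this
      rw [this]
      split_ifs <;> omega
    · rw [stairStep, if_neg hc]
      exact ⟨hI₁, by simp [r18], by simp⟩

/-- The queries depend on the input and on the multiplier `a` alone, not on any answer, so they can
all be written down before the data structure is used. -/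
theorem queryCmd_spec {p : Par} {s : RamState} (he : Env p s) {a : ℕ} (h9 : s.reg 9 = a)
    (hkey : ∀ i, i < p.n → padKey p (s.mem 0) i < 2 * p.O)
    (hX : ∀ x, x < p.P → s.mem 1 x < 5 * p.O) :
    Tri p.w queryCmd s (p.n * (8 * p.S + 8) + 2)
      (QueryInv p (s.mem 0) (s.mem 1) a (p.n * p.S)) := by
  have hP1 := p.P_pow_le 1 (by norm_num)
  rw [pow_one] at hP1
  have hn := p.n_lt_P
  have hO := p.O_le_W
  have hR0 := p.R_pos
  have hRP := p.R_le_P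
  have hO0 := p.O_pos
  have m1 : 1 % 2 ^ p.w = 1 := Nat.mod_eq_of_lt (by omega)
  have hS := p.S_le
  have hQ := p.Q_le
  have hP4 := p.P_pow_le 4 (by norm_num)
  refine (Tri.forUp (fun _ => 8 * p.S + 2 + 1 + 1 + 1 + 1)
    (fun j s' => QueryInv p (s.mem 0) (s.mem 1) a (j * p.S) s') (N := p.n)
    (by omega) (by decide) (fun s' hf => by simp [(he.frame hf (by decide)).r0])
    (by intro x hx; omega) ?_).mono (by simp) (fun s' _ h => h.1)
  rintro j hj s' hf e15 hI
  have he' := he.frame hf (by decide)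
  have e0 : s'.mem 0 = s.mem 0 := hf.2 0 (by decide)
  have e1 : s'.mem 1 = s.mem 1 := hf.2 1 (by decide)
  have e9 : s'.reg 9 = a := (hf.1 9 (by decide)).trans h9
  have hk := hkey j hj
  have hpk : (s.mem 0 j + p.O) % 2 ^ p.w = padKey p (s.mem 0) j := by rw [padKey, if_pos hj]
  refine Tri.assign_seq (v := target p (s.mem 0) j) ?_ ?_
  · simp [e15, e0, he'.r2]
    rw [Nat.add_mod, hpk, Nat.mod_eq_of_lt (by omega : p.O < _), Nat.mod_eq_of_lt (by omega)]
    rfl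
  refine Tri.assign_seq (v := hash (2 ^ p.w) p.L a (target p (s.mem 0) j)) ?_ ?_
  · have hlt := hash_lt (a := a) (x := target p (s.mem 0) j) p.W_eq (by positivity)
    simp only [val_shr, val_mul, val_reg, setReg_reg, e9, he'.r10]
    norm_num
    rw [← Par.L, ← hash, Nat.mod_eq_of_lt (by omega)]
  refine Tri.assign_seq (v := 0) (by simp) ?_
  refine Tri.assign_seq (v := p.R - 1) ?_ ?_
  · have := sub_word (x := p.R) (y := 1) (W := 2 ^ p.w) (by omega) (by omega)
    simpa [he'.r5] using this
  refine (Tri.forUp (fun _ => 6) (fun τ s₁ => QueryInv p (s.mem 0) (s.mem 1) a (j * p.S + τ) s₁ ∧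
      s₁.reg 18 = (stair (s.mem 1) p.R p.g (target p (s.mem 0) j) τ).1 ∧
      s₁.reg 19 = (stair (s.mem 1) p.R p.g (target p (s.mem 0) j) τ).2) (N := p.S)
      (by omega) (by decide) (fun s₁ hf₁ => ?_) ?_ ?_).mono (by simp [mul_comm]) ?_
  · rw [val_reg, hf₁.1 11 (by decide)]
    simpa using he'.r11
  · refine ⟨fun x hx => ?_, by simp [stair], by simp [stair]⟩
    simpa using hI x hx
  · rintro τ hτ s₁ hf₁ e20 ⟨hI₁, e18, e19⟩
    have he₁ : Env p s₁ := Env.frame (he'.of_regs fun r hr _ => by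
      simp (disch := omega) only [setReg_reg, if_neg]) hf₁ (by decide)
    have f1 : s₁.mem 1 = s.mem 1 := by rw [hf₁.2 1 (by decide)]; simp [e1]
    have := stairCmd_spec (s := s₁) (a := a) (i := j) (τ := τ) (raw := s.mem 0) he₁
      (by rw [hf₁.1 15 (by decide)]; simp [e15]) e20 hj hτ
      (by rw [hf₁.1 16 (by decide)]; simp) (by rw [hf₁.1 17 (by decide)]; simp)
      (by rwa [f1]) (by rwa [f1]) (by rwa [f1]) (by rwa [f1])
    rw [f1] at this
    refine this.mono le_rfl ?_
    rintro s₂ - ⟨g1, g2, g3⟩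
    exact ⟨fun x hx => by simpa using g1 x hx, by simpa using g2, by simpa using g3⟩
  · rintro s₁ - ⟨⟨hI₁, -⟩, -⟩ x hx
    have : (j + 1) * p.S = j * p.S + p.S := by ring
    simpa using hI₁ x (by omega)

/-! ### Verification of hits -/

/-- The element `x` of the sorted sequence is part of a solution with target `T`. -/
def Good (p : Par) (raw : ℕ → ℕ) (T x : ℕ) : Prop :=
  ∃ j, j < p.n ∧ x + padKey p raw j = T ∧ x ≠ padKey p raw j ∧ x ≠ p.O ∧ padKey p raw j ≠ p.O

/-- The first group of the query contains an element that is part of a solution. -/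
def Genuine (p : Par) (raw X : ℕ → ℕ) (x : ℕ) : Prop :=
  ∃ u, u < p.g ∧ Good p raw (target p raw (x / p.S)) (X ((queryCell p raw X x).1 * p.g + u))

/-- Look for a partner of an element. -/
def partnerCmd : Cmd :=
  .seq (.assign 20 (.ld 1 (.reg 18 * .reg 6 + .reg 19))) <|
  .seq (.assign 21 (.reg 17 - .reg 20)) <|
  .ite (.ld 3 (.reg 21)) (.ite ((Ex.reg 20).eq (.reg 21)) (.assign 20 0)
    (.ite ((Ex.reg 20).eq (.reg 2)) (.assign 20 0)
      (.ite ((Ex.reg 21).eq (.reg 2)) (.assign 20 0) (.assign 15 1)))) (.assign 20 0)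

/-- The partner is looked up among all keys in memory 3 rather than searched for in the second
group. This makes the check of one hit linear in `g` instead of quadratic. -/
theorem partnerCmd_spec {p : Par} {s : RamState} (he : Env p s) {raw : ℕ → ℕ} {T c u f : ℕ}
    (hT : T < 3 * p.O) (hkey : ∀ i, i < p.n → padKey p raw i < 2 * p.O)
    (h3 : ∀ v, s.mem 3 v ≠ 0 ↔ ∃ i, i < p.n ∧ padKey p raw i = v)
    (h15 : s.reg 15 = f) (h17 : s.reg 17 = T) (h18 : s.reg 18 = c) (h19 : s.reg 19 = u)
    (hu : u < p.g) (hc : c < p.R) (hX : s.mem 1 (c * p.g + u) < 5 * p.O) :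
    Tri p.w partnerCmd s 7 fun s' =>
      (Good p raw T (s.mem 1 (c * p.g + u)) → s'.reg 15 = 1) ∧
      (¬ Good p raw T (s.mem 1 (c * p.g + u)) → s'.reg 15 = f) := by
  have hO := p.O_le_W
  have hP1 := p.P_pow_le 1 (by norm_num)
  rw [pow_one] at hP1
  have hRg := p.R_mul_g
  have hc1 : (c + 1) * p.g ≤ p.R * p.g := Nat.mul_le_mul_right _ hc
  rw [add_mul, one_mul] at hc1
  have hO0 := p.O_pos
  have m1 : 1 % 2 ^ p.w = 1 := Nat.mod_eq_of_lt (by omega)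
  obtain ⟨x, hx⟩ : ∃ x, s.mem 1 (c * p.g + u) = x := ⟨_, rfl⟩
  rw [hx] at hX ⊢
  refine Tri.assign_seq (T := 6) (v := x) ?_ ?_
  · simp [h18, h19, he.r6, Nat.mod_eq_of_lt (by omega : c * p.g < 2 ^ p.w),
      Nat.mod_eq_of_lt (by omega : c * p.g + u < 2 ^ p.w), hx]
  obtain ⟨y, hy⟩ : ∃ y, (T + (2 ^ p.w - x % 2 ^ p.w)) % 2 ^ p.w = y := ⟨_, rfl⟩
  refine Tri.assign_seq (T := 5) (v := y) (by simpa [h17] using hy) ?_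
  rw [Nat.mod_eq_of_lt (by omega : x < 2 ^ p.w)] at hy
  have hgood : Good p raw T x ↔ s.mem 3 y ≠ 0 ∧ x ≠ y ∧ x ≠ p.O ∧ y ≠ p.O := by
    have hyx : x ≤ T → y = T - x := fun h => by
      rw [← hy, show T + (2 ^ p.w - x) = T - x + 2 ^ p.w by omega, Nat.add_mod_right,
        Nat.mod_eq_of_lt (by omega)]
    have hyx' : ¬ x ≤ T → y = T + (2 ^ p.w - x) := fun h => by
      rw [← hy, Nat.mod_eq_of_lt (by omega)]
    constructor
    · rintro ⟨j, hj, h1, h2, h3', h4⟩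
      have : y = padKey p raw j := by rw [hyx (by omega)]; omega
      rw [this]
      exact ⟨(h3 _).2 ⟨j, hj, rfl⟩, h2, h3', h4⟩
    · rintro ⟨h1, h2, h3', h4⟩
      obtain ⟨j, hj, hjy⟩ := (h3 y).1 h1
      have hk := hkey j hj
      -- If the subtraction wrapped around, its result would be far above `2 * p.O` and could not be
      -- a key.
      have hxT : x ≤ T := by
        by_contra h
        have := hyx' h
        omega
      have := hyx hxT
      exact ⟨j, hj, by omega, by rwa [hjy], h3', by rwa [hjy]⟩
  rw [hgood]
  refine Tri.ite (T := 4) (fun h => Tri.ite (T := 3) (fun h' => ?_) (fun h' =>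
    Tri.ite (T := 2) (fun h'' => ?_) (fun h'' => Tri.ite (T := 1) (fun h''' => ?_) (fun h''' => ?_))))
    (fun h => ?_)
  · have : x = y := by by_contra hn; simp [hn] at h'
    refine (Tri.assign ?_).mono (by norm_num) (fun _ _ h => h)
    simp [this, h15]
  · have : x = p.O := by by_contra hn; simp [hn, he.r2] at h''
    refine (Tri.assign ?_).mono (by norm_num) (fun _ _ h => h)
    simp [this, h15]
  · have : y = p.O := by by_contra hn; simp [hn, he.r2] at h'''
    refine (Tri.assign ?_).mono (by norm_num) (fun _ _ h => h)
    simp [this, h15]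
  · refine (Tri.assign' (v := 1) (by simp [m1]) ?_)
    have h1 : x ≠ y := by rintro rfl; simp [m1] at h'
    have h2 : x ≠ p.O := by rintro rfl; simp [m1, he.r2] at h''
    have h3 : y ≠ p.O := by rintro rfl; simp [m1, he.r2] at h'''
    have h4 : s.mem 3 y ≠ 0 := by simpa using h
    simp [h1, h2, h3, h4]
  · refine (Tri.assign ?_).mono (by norm_num) (fun _ _ h => h)
    have h4 : s.mem 3 y = 0 := by simpa using h
    simp [h4, h15]

/-- Verify the hits that are marked in memory `8`, until a solution is found. -/
def verifyCmd : Cmd :=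
  .seq (.assign 15 0) <| .seq (.forUp 16 (.reg 12) <|
    .ite (.reg 15) (.assign 20 0) <| .ite (.ld 8 (.reg 16))
      (.seq (.assign 17 (.ld 0 (.reg 16 / .reg 11) + .reg 2 + .reg 2)) <|
        .seq (.assign 18 (.ld 9 (.reg 16))) (.forUp 19 (.reg 6) partnerCmd))
      (.assign 20 0)) (.assign 0 (.reg 15))

-- Once a genuine hit is found, later hits are skipped. So a scan of a group is paid for each false
-- hit and for at most one genuine hit.
open Classical in
theorem verifyCmd_spec {p : Par} {s : RamState} (he : Env p s) {raw X : ℕ → ℕ}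
    (hkey : ∀ i, i < p.n → padKey p raw i < 2 * p.O) (h0 : s.mem 0 = raw) (h1 : s.mem 1 = X)
    (h3 : ∀ v, s.mem 3 v ≠ 0 ↔ ∃ i, i < p.n ∧ padKey p raw i = v)
    (hX : ∀ x, x < p.P → X x < 5 * p.O)
    (h9 : ∀ x, x < p.n * p.S → s.mem 9 x = (queryCell p raw X x).1) :
    Tri p.w verifyCmd s (8 * (p.n * p.S) + 9 * p.g *
        (((Finset.range (p.n * p.S)).filter fun x =>
          s.mem 8 x ≠ 0 ∧ ¬ Genuine p raw X x).card + 1) + 4)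
      fun s' => s'.reg 0 ≠ 0 ↔ ∃ x, x < p.n * p.S ∧ s.mem 8 x ≠ 0 ∧ Genuine p raw X x := by
  have hnS := p.nS_lt
  have hO := p.O_le_W
  have hO0 := p.O_pos
  have hP1 := p.P_pow_le 1 (by norm_num)
  rw [pow_one] at hP1
  have hRg := p.R_mul_g
  have hgP := p.g_le_P
  have hn := p.n_lt_P
  have m1 : 1 % 2 ^ p.w = 1 := Nat.mod_eq_of_lt (by omega)
  set H : ℕ → Prop := fun x => s.mem 8 x ≠ 0 with hH
  set G : ℕ → Prop := fun x => Genuine p raw X x with hG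
  -- Counts the hits that are really scanned: those not preceded by a genuine one.
  let cnt : ℕ → ℕ := fun x => if H x ∧ ∀ y, y < x → ¬ (H y ∧ G y) then 1 else 0
  have hcnt : ∑ x ∈ Finset.range (p.n * p.S), cnt x ≤
      ((Finset.range (p.n * p.S)).filter fun x => H x ∧ ¬ G x).card + 1 := by
    rw [Finset.sum_boole, Nat.cast_id]
    have hsub : (Finset.range (p.n * p.S)).filter (fun x => H x ∧ ∀ y, y < x → ¬ (H y ∧ G y)) ⊆
        ((Finset.range (p.n * p.S)).filter fun x => H x ∧ ¬ G x) ∪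
        ((Finset.range (p.n * p.S)).filter fun x => (H x ∧ G x) ∧ ∀ y, y < x → ¬ (H y ∧ G y)) := by
      intro x hx
      simp only [Finset.mem_union, Finset.mem_filter] at hx ⊢
      by_cases hg : G x
      · exact Or.inr ⟨hx.1, ⟨hx.2.1, hg⟩, hx.2.2⟩
      · exact Or.inl ⟨hx.1, hx.2.1, hg⟩
    refine (Finset.card_le_card hsub).trans ((Finset.card_union_le _ _).trans
      (Nat.add_le_add_left ?_ _))
    rw [Finset.card_le_one]
    intro x hx y hy
    simp only [Finset.mem_filter] at hx hy
    rcases lt_trichotomy x y with h | h | h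
    · exact absurd hx.2.1 (hy.2.2 x h)
    · exact h
    · exact absurd hy.2.1 (hx.2.2 y h)
  refine Tri.mono (T := (∑ x ∈ Finset.range (p.n * p.S), ((6 + 9 * p.g * cnt x) + 2) + 2) + 1 + 1)
    (Q := fun s' => s'.reg 0 ≠ 0 ↔ ∃ x, x < p.n * p.S ∧ s.mem 8 x ≠ 0 ∧ Genuine p raw X x) ?_ ?_
    (fun _ _ h => h)
  swap
  · have e : ∑ x ∈ Finset.range (p.n * p.S), ((6 + 9 * p.g * cnt x) + 2) =
        8 * (p.n * p.S) + 9 * p.g * ∑ x ∈ Finset.range (p.n * p.S), cnt x := by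
      rw [Finset.mul_sum]
      simp only [Finset.sum_add_distrib, Finset.sum_const, Finset.card_range, smul_eq_mul]
      ring
    have := Nat.mul_le_mul_left (9 * p.g) hcnt
    rw [e]
    show _ ≤ 8 * (p.n * p.S) + 9 * p.g *
      (((Finset.range (p.n * p.S)).filter fun x => H x ∧ ¬ G x).card + 1) + 4
    omega
  refine Tri.assign_seq (v := 0) (by simp) ?_
  refine Tri.seq (T₂ := 1) ((Tri.forUp (w := p.w) (fun x => 6 + 9 * p.g * cnt x)
    (fun m s' => s'.reg 15 = if ∃ x, x < m ∧ H x ∧ G x then 1 else 0) (N := p.n * p.S)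
    (by omega) (by decide) (fun s' hf => ?_) (by simp) ?_).mono le_rfl ?_)
  · rw [val_reg, hf.1 12 (by decide)]
    simpa using he.r12
  · rintro m hm s' hf e16 hI
    have he' : Env p s' := he.of_regs fun r hr h9 => by
      by_cases h12 : r = 12
      · subst h12
        rw [hf.1 12 (by decide)]; simp
      · rw [hf.1 r (by simp [Cmd.forUp, Cmd.regs, partnerCmd]; omega), setReg_reg,
          if_neg (by omega)]
    have e0 : s'.mem 0 = raw := by rw [hf.2 0 (by decide)]; simpa using h0
    have e1 : s'.mem 1 = X := by rw [hf.2 1 (by decide)]; simpa using h1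
    have e3 : s'.mem 3 = s.mem 3 := by rw [hf.2 3 (by decide)]; simp
    have e8 : s'.mem 8 = s.mem 8 := by rw [hf.2 8 (by decide)]; simp
    have e9 : s'.mem 9 m = (queryCell p raw X m).1 := by
      rw [hf.2 9 (by decide)]; simpa using h9 m hm
    refine Tri.ite (T := 5 + 9 * p.g * cnt m) (fun hc => ?_) (fun hc => ?_) |>.mono (by omega)
      (fun _ _ h => h)
    · have hex : ∃ x, x < m ∧ H x ∧ G x := by
        by_contra h
        simp [hI, h] at hc
      have hex' : ∃ x, x < m + 1 ∧ H x ∧ G x := by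
        obtain ⟨x, hx, h⟩ := hex
        exact ⟨x, by omega, h⟩
      refine (Tri.assign ?_).mono (by omega) (fun _ _ h => h)
      rw [if_pos hex']
      rw [if_pos hex] at hI
      simpa using hI
    · have hnex : ¬ ∃ x, x < m ∧ H x ∧ G x := by
        intro h
        simp [hI, h] at hc
      rw [if_neg hnex] at hI
      have hsucc : (∃ x, x < m + 1 ∧ H x ∧ G x) ↔ H m ∧ G m := by
        constructor
        · rintro ⟨x, hx, h⟩
          rcases Nat.lt_succ_iff_lt_or_eq.1 hx with h' | rfl
          · exact absurd ⟨x, h', h⟩ hnex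
          · exact h
        · intro h; exact ⟨m, by omega, h⟩
      refine Tri.ite (T := 4 + 9 * p.g * cnt m) (fun hc' => ?_) (fun hc' => ?_) |>.mono (by omega)
        (fun _ _ h => h)
      · have hHm : H m := by
          rw [val_ld, val_reg, e16, e8] at hc'
          exact hc'
        have hcm : cnt m = 1 := if_pos ⟨hHm, fun y hy h => hnex ⟨y, hy, h⟩⟩
        have hiS : m / p.S < p.n := Nat.div_lt_of_lt_mul (by rwa [mul_comm])
        have hk := hkey _ hiS
        have hpk : (raw (m / p.S) + p.O) % 2 ^ p.w = padKey p raw (m / p.S) := by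
          rw [padKey, if_pos hiS]
        have hcl := (stair_lt (X := X) (g := p.g) (T := target p raw (m / p.S)) p.R_pos
          (m % p.S)).1
        rw [← queryCell] at hcl
        rw [hcm, mul_one]
        refine Tri.mono (T := ((p.g * 9 + 2) + 1) + 1) ?_ (by omega) (fun _ _ h => h)
        refine Tri.assign_seq (v := target p raw (m / p.S)) ?_ ?_
        · simp [e16, e0, he'.r2, he'.r11, Nat.mod_eq_of_lt (by omega : m / p.S < 2 ^ p.w)]
          rw [Nat.add_mod, hpk, Nat.mod_eq_of_lt (by omega : p.O < _), Nat.mod_eq_of_lt (by omega)]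
          rfl
        refine Tri.assign_seq (v := (queryCell p raw X m).1) (by simp [e16, e9]) ?_
        refine (Tri.forUp (w := p.w) (fun _ => 7) (fun u s₁ => s₁.reg 15 =
          if ∃ u', u' < u ∧ Good p raw (target p raw (m / p.S))
            (X ((queryCell p raw X m).1 * p.g + u')) then 1 else 0) (N := p.g)
          (by omega) (by decide) (fun s₁ hf₁ => ?_) (by simp [hI]) ?_).mono (by simp) ?_
        · rw [val_reg, hf₁.1 6 (by decide)]
          simpa using he'.r6
        · rintro u hu s₁ hf₁ e19 hI₁
          have he₁ : Env p s₁ := Env.frame (he'.of_regs fun r hr _ => by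
            simp (disch := omega) only [setReg_reg, if_neg]) hf₁ (by decide)
          have f1 : s₁.mem 1 = X := by rw [hf₁.2 1 (by decide)]; simpa using e1
          have f3 : s₁.mem 3 = s.mem 3 := by rw [hf₁.2 3 (by decide)]; simpa using e3
          have hcg : ((queryCell p raw X m).1 + 1) * p.g ≤ p.R * p.g := Nat.mul_le_mul_right _ hcl
          rw [add_mul, one_mul] at hcg
          have := partnerCmd_spec (s := s₁) (raw := raw) (T := target p raw (m / p.S))
            (c := (queryCell p raw X m).1) (u := u) he₁ (by rw [target]; omega) hkey (by rwa [f3])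
            hI₁ (by rw [hf₁.1 17 (by decide)]; simp) (by rw [hf₁.1 18 (by decide)]; simp) e19 hu hcl
            (by rw [f1]; exact hX _ (by omega))
          rw [f1] at this
          refine this.mono le_rfl ?_
          rintro s₂ - ⟨g1, g2⟩
          rw [setReg_reg, if_neg (by norm_num)]
          by_cases hg : Good p raw (target p raw (m / p.S)) (X ((queryCell p raw X m).1 * p.g + u))
          · rw [g1 hg, if_pos ⟨u, by omega, hg⟩]
          · rw [g2 hg]
            congr 1
            refine propext (exists_congr fun u' => ?_)
            constructor
            · rintro ⟨h, h'⟩; exact ⟨by omega, h'⟩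
            · rintro ⟨h, h'⟩
              refine ⟨lt_of_le_of_ne (by omega) ?_, h'⟩
              rintro rfl; exact hg h'
        · rintro s₁ - ⟨h, -⟩
          rw [setReg_reg, if_neg (by norm_num), h]
          congr 1
          rw [hsucc]
          exact propext ⟨fun h => ⟨hHm, h⟩, fun h => h.2⟩
      · have hHm : ¬ H m := by
          rw [val_ld, val_reg, e16, e8] at hc'
          exact not_not.2 hc'
        refine (Tri.assign ?_).mono (by omega) (fun _ _ h => h)
        rw [if_neg (by rw [hsucc]; exact fun h => hHm h.1)]
        simpa using hI
  · rintro s' - ⟨hI, -⟩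
    refine Tri.assign ?_
    rw [setReg_reg, if_pos rfl, val_reg, hI]
    by_cases h : ∃ x, x < p.n * p.S ∧ H x ∧ G x
    · rw [if_pos h]; exact ⟨fun _ => h, fun _ => one_ne_zero⟩
    · rw [if_neg h]; exact ⟨fun h' => absurd rfl h', fun h' => absurd h' h⟩

end WordRam

/-! ### Correctness of the reduction, and the number of false hits. -/

namespace WordRam

/-! ### The SetDisjointness instance -/

theorem elem_lt (p : Par) (E : ℕ → ℕ) (t x : ℕ) : elem p E t x < p.Q := Nat.mod_lt _ p.Q_pos

theorem le_dummy (p : Par) (t : ℕ) : p.Q ≤ dummy p t ∧ dummy p t < p.Q + 2 := by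
  rw [dummy]
  split_ifs <;> omega

theorem nodup_shiftedSet (p : Par) (E : ℕ → ℕ) (t : ℕ) : (shiftedSet p E t).Nodup := by
  rw [shiftedSet, List.nodup_cons]
  refine ⟨fun h => ?_, nodup_uniqList _ _⟩
  obtain ⟨x, -, hx⟩ := mem_uniqList.1 h
  have := elem_lt p E t x
  have := (le_dummy p t).1
  omega

theorem mem_setList_lt {p : Par} {E : ℕ → ℕ} {m : ℕ} {S : List ℕ} (hS : S ∈ setList p E m) :
    S ≠ [] ∧ S.Nodup ∧ ∀ x ∈ S, x < p.Q + 2 := by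
  rw [setList, List.mem_cons, List.mem_map] at hS
  rcases hS with rfl | ⟨t, -, rfl⟩
  · refine ⟨by simp, List.nodup_range, fun x hx => List.mem_range.1 hx⟩
  · refine ⟨by simp [shiftedSet], nodup_shiftedSet p E t, fun x hx => ?_⟩
    rw [shiftedSet, List.mem_cons] at hx
    rcases hx with rfl | hx
    · exact (le_dummy p t).2
    · obtain ⟨y, -, rfl⟩ := mem_uniqList.1 hx
      have := elem_lt p E t y
      omega

/-- The second family. -/
def secondFamily (p : Par) (E : ℕ → ℕ) : List (List ℕ) :=
  (List.range (p.R * p.q)).map fun t => shiftedSet p E (p.R * p.q + t)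

theorem setList_append_secondFamily (p : Par) (E : ℕ → ℕ) :
    setList p E (p.R * p.q) ++ secondFamily p E = setList p E (2 * p.R * p.q) := by
  rw [setList, setList, secondFamily, List.cons_append,
    show 2 * p.R * p.q = p.R * p.q + p.R * p.q by ring, List.range_add (m := p.R * p.q),
    List.map_append, List.map_map]
  rfl

/-- The instance of SetDisjointness with the shifted sets of hash values. -/
def families (p : Par) (E : ℕ → ℕ) : SetFamilies where
  A := setList p E (p.R * p.q)
  B := secondFamily p E
  nonempty S hS := by
    rw [setList_append_secondFamily] at hS
    exact (mem_setList_lt hS).1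
  nodup S hS := by
    rw [setList_append_secondFamily] at hS
    exact (mem_setList_lt hS).2.1
  lt_size S hS x hx := by
    rw [setList_append_secondFamily] at hS ⊢
    -- This is the purpose of the additional first set: its `Q + 2` elements alone make the total
    -- size larger than every element name.
    refine ((mem_setList_lt hS).2.2 x hx).trans_le ?_
    simp [setList]

theorem families_append (p : Par) (E : ℕ → ℕ) :
    (families p E).A ++ (families p E).B = setList p E (2 * p.R * p.q) :=
  setList_append_secondFamily p E

theorem length_families_A (p : Par) (E : ℕ → ℕ) : (families p E).A.length = p.R * p.q + 1 :=
  length_setList p E _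

theorem length_families_B (p : Par) (E : ℕ → ℕ) : (families p E).B.length = p.R * p.q := by
  simp [families, secondFamily]

theorem size_families_le (p : Par) (E : ℕ → ℕ) : (families p E).size ≤ p.N := by
  rw [SetFamilies.size, families_append]
  exact length_flatten_setList_le p E _

theorem input_families (p : Par) (E : ℕ → ℕ) (w : ℕ) :
    (families p E).input w =
      { reg := fun r => if r = 0 then p.R * p.q + 1 else if r = 1 then p.R * p.q
          else if r = 2 then (setList p E (2 * p.R * p.q)).flatten.length
          else if r = 3 then w else 0
        mem := fun a i => if a = 0 then (setList p E (2 * p.R * p.q)).flatten.getD i 0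
          else if a = 1 then startPos (setList p E (2 * p.R * p.q)) i else 0 } := by
  rw [SetFamilies.input, SetFamilies.size, families_append, length_families_A, length_families_B]
  rfl

/-- Two elements of the pair of groups have hash values that sum up to `h`. -/
def Hit (p : Par) (X : ℕ → ℕ) (a : ℕ) (c : ℕ × ℕ) (h : ℕ) : Prop :=
  ∃ u v e, u < p.g ∧ v < p.g ∧ e < 2 ∧
    hash (2 ^ p.w) p.L a (X (c.1 * p.g + u)) + e + hash (2 ^ p.w) p.L a (X (c.2 * p.g + v))
      ≡ h [MOD p.Q]

/-- Adding `i + H₂` to both sides removes the complements `Q - i` and `Q - H₂`, which represent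
negatives modulo `Q`. -/
theorem modEq_shift {Q H₁ H₂ e i j : ℕ} (hi : i ≤ Q) (h₂ : H₂ ≤ Q) :
    (H₁ + e + (Q - i)) % Q = (Q - H₂ + j) % Q ↔ H₁ + e + H₂ ≡ i + j [MOD Q] := by
  rw [← Nat.ModEq]
  constructor
  · intro h
    have h1 := h.add_right (i + H₂)
    rw [show H₁ + e + (Q - i) + (i + H₂) = H₁ + e + H₂ + Q by omega,
      show Q - H₂ + j + (i + H₂) = i + j + Q by omega] at h1
    exact Nat.ModEq.add_right_cancel' _ h1
  · intro h
    apply Nat.ModEq.add_right_cancel' (i + H₂)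
    rw [show H₁ + e + (Q - i) + (i + H₂) = H₁ + e + H₂ + Q by omega,
      show Q - H₂ + j + (i + H₂) = i + j + Q by omega]
    exact h.add_right _

/-- The target hash value is written in base `q`; its high digit is absorbed by the shift of the
first set and its low digit by that of the second. The dummies `Q` and `Q + 1` differ from each
other and from all residues, so they create no intersection. Both values of the rounding bit are
present in the first set. -/
theorem not_disjoint_iff {p : Par} {E X : ℕ → ℕ} {a : ℕ}
    (hE : ∀ x, x < 4 * p.P → E x = entry p X a x) {c d i j : ℕ} (hc : c < p.R) (hd : d < p.R)
    (hi : i < p.q) (hj : j < p.q) :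
    ¬ List.Disjoint (shiftedSet p E (c * p.q + i)) (shiftedSet p E (p.R * p.q + (d * p.q + j))) ↔
      Hit p X a (c, d) (i * p.q + j) := by
  have hq := p.q_pos
  have hg := p.g_pos
  have hQ := p.q_mul_q
  have hRg := p.R_mul_g
  have t1 : (c * p.q + i) / p.q = c := by
    rw [mul_comm, Nat.mul_add_div hq, Nat.div_eq_of_lt hi, add_zero]
  have t2 : (c * p.q + i) % p.q = i := by
    rw [Nat.add_mod, Nat.mul_mod_left, zero_add, Nat.mod_mod, Nat.mod_eq_of_lt hi]
  have t3 : (p.R * p.q + (d * p.q + j)) / p.q = p.R + d := by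
    rw [← add_assoc, ← add_mul, mul_comm, Nat.mul_add_div hq, Nat.div_eq_of_lt hj, add_zero]
  have t4 : (p.R * p.q + (d * p.q + j)) % p.q = j := by
    rw [← add_assoc, ← add_mul, Nat.add_mod, Nat.mul_mod_left, zero_add, Nat.mod_mod,
      Nat.mod_eq_of_lt hj]
  have hiq : i * p.q ≤ p.Q := by rw [← hQ]; exact Nat.mul_le_mul_right _ hi.le
  have hcg : (c + 1) * p.g ≤ p.R * p.g := Nat.mul_le_mul_right _ hc
  have hdg : (d + 1) * p.g ≤ p.R * p.g := Nat.mul_le_mul_right _ hd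
  rw [add_mul, one_mul] at hcg hdg
  have e1 : ∀ u, u < p.g → ∀ e, e < 2 → elem p E (c * p.q + i) (2 * u + e) =
      (hash (2 ^ p.w) p.L a (X (c * p.g + u)) + e + (p.Q - i * p.q)) % p.Q := by
    intro u hu e he
    have e0 : c * (p.g + p.g) = 2 * (c * p.g) := by ring
    rw [elem, setShift, t1, t2, if_pos hc, hE _ (by omega), entry, if_pos (by omega),
      show (c * (p.g + p.g) + (2 * u + e)) / 2 = c * p.g + u by omega,
      show (c * (p.g + p.g) + (2 * u + e)) % 2 = e by omega]
  have e2 : ∀ v, v < p.g → ∀ e, e < 2 → elem p E (p.R * p.q + (d * p.q + j)) (2 * v + e) =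
      (p.Q - hash (2 ^ p.w) p.L a (X (d * p.g + v)) + j) % p.Q := by
    intro u hu e he
    have e0 : (p.R + d) * (p.g + p.g) = 2 * (p.R * p.g) + 2 * (d * p.g) := by ring
    rw [elem, setShift, t3, t4, if_neg (by omega), hE _ (by omega), entry, if_neg (by omega),
      show ((p.R + d) * (p.g + p.g) + (2 * u + e) - (p.P + p.P)) / 2 = d * p.g + u by omega]
  have hh : ∀ x, hash (2 ^ p.w) p.L a x ≤ p.Q := fun x => (hash_lt p.W_eq (by positivity)).le
  constructor
  · intro h
    simp only [List.Disjoint, not_forall, not_not] at h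
    obtain ⟨v, h1, h2, -⟩ := h
    rw [shiftedSet, List.mem_cons, mem_uniqList] at h1 h2
    rcases h1 with h1 | ⟨x, hx, h1⟩
    · rw [dummy, t1, if_pos hc] at h1
      rcases h2 with h2 | ⟨y, hy, h2⟩
      · rw [dummy, t3, if_neg (by omega)] at h2
        omega
      · have := elem_lt p E (p.R * p.q + (d * p.q + j)) y
        omega
    · rcases h2 with h2 | ⟨y, hy, h2⟩
      · have := elem_lt p E (c * p.q + i) x
        have := (le_dummy p (p.R * p.q + (d * p.q + j))).1
        omega
      · rw [← Nat.div_add_mod x 2, e1 (x / 2) (by omega) _ (by omega)] at h1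
        rw [← Nat.div_add_mod y 2, e2 (y / 2) (by omega) _ (by omega), ← h1] at h2
        exact ⟨x / 2, y / 2, x % 2, by omega, by omega, by omega,
          (modEq_shift hiq (hh _)).1 h2.symm⟩
  · rintro ⟨u, v, e, hu, hv, he, h⟩ hdis
    have h' := (modEq_shift hiq (hh _)).2 h
    rw [← e1 u hu e he, ← e2 v hv 0 (by norm_num)] at h'
    refine hdis (a := elem p E (c * p.q + i) (2 * u + e)) ?_ ?_
    · exact List.mem_cons_of_mem _ (mem_uniqList.2 ⟨_, by omega, rfl⟩)
    · exact List.mem_cons_of_mem _ (mem_uniqList.2 ⟨2 * v + 0, by omega, h'.symm⟩)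

theorem not_isDisjoint_iff {p : Par} {E X : ℕ → ℕ} {a : ℕ}
    (hE : ∀ x, x < 4 * p.P → E x = entry p X a x) {c d h : ℕ} (hc : c < p.R) (hd : d < p.R)
    (hh : h < p.Q) (Qu : (families p E).Query) (h1 : Qu.1.val = 1 + c * p.q + h / p.q)
    (h2 : Qu.2.val = d * p.q + h % p.q) :
    ¬ (families p E).IsDisjoint Qu ↔ Hit p X a (c, d) h := by
  have hdiv : h / p.q < p.q := Nat.div_lt_of_lt_mul (by rwa [p.q_mul_q])
  have := not_disjoint_iff hE hc hd hdiv (Nat.mod_lt h p.q_pos)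
  rw [mul_comm (h / p.q), Nat.div_add_mod] at this
  rw [← this, SetFamilies.IsDisjoint]
  have g1 : (families p E).A.get Qu.1 = shiftedSet p E (c * p.q + h / p.q) := by
    rw [List.get_eq_getElem]
    simp only [h1]
    simp only [families, setList, show 1 + c * p.q + h / p.q = c * p.q + h / p.q + 1 by ring,
      List.getElem_cons_succ, List.getElem_map, List.getElem_range]
  have g2 : (families p E).B.get Qu.2 = shiftedSet p E (p.R * p.q + (d * p.q + h % p.q)) := by
    rw [List.get_eq_getElem]
    simp only [h2]
    simp only [families, secondFamily, List.getElem_map, List.getElem_range]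
  rw [g1, g2]

/-! ### Hits and solutions -/

theorem target_lt {p : Par} {raw : ℕ → ℕ} (hkey : ∀ i, i < p.n → padKey p raw i < 2 * p.O) {i : ℕ}
    (hi : i < p.n) : target p raw i < 3 * p.O := by
  have := hkey i hi
  rw [target]
  omega

/-- `X` lists the padded keys in increasing order. -/
structure Sorted (p : Par) (raw X : ℕ → ℕ) : Prop where
  key_lt : ∀ i, i < p.n → padKey p raw i < 2 * p.O
  mono : ∀ a b, a < b → b < p.P → X a < X b
  same : SameValues (padKey p raw) X p.P

theorem Sorted.inj {p : Par} {raw X : ℕ → ℕ} (h : Sorted p raw X) {x y : ℕ} (hx : x < p.P)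
    (hy : y < p.P) (hxy : X x = X y) : x = y := by
  rcases lt_trichotomy x y with h' | h' | h'
  · exact absurd hxy (h.mono _ _ h' hy).ne
  · exact h'
  · exact absurd hxy (h.mono _ _ h' hx).ne'

theorem queryCell_lt (p : Par) (raw X : ℕ → ℕ) (x : ℕ) :
    (queryCell p raw X x).1 < p.R ∧ (queryCell p raw X x).2 < p.R := stair_lt p.R_pos _

theorem cell_lt {p : Par} {c u : ℕ} (hc : c < p.R) (hu : u < p.g) : c * p.g + u < p.P := by
  have h : (c + 1) * p.g ≤ p.R * p.g := Nat.mul_le_mul_right _ hc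
  rw [add_mul, one_mul, p.R_mul_g] at h
  omega

theorem Sorted.lt {p : Par} {raw X : ℕ → ℕ} (h : Sorted p raw X) {x : ℕ} (hx : x < p.P) :
    X x < 5 * p.O := by
  obtain ⟨i, hi, hix⟩ := (h.same (X x)).1 ⟨x, hx, rfl⟩
  have h1 := p.P_le_O
  by_cases hn : i < p.n
  · have := h.key_lt i hn
    omega
  · rw [padKey, if_neg hn] at hix
    omega

theorem Sorted.exists_key {p : Par} {raw X : ℕ → ℕ} (h : Sorted p raw X) {x : ℕ} (hx : x < p.P)
    (hX : X x < 4 * p.O) : ∃ i, i < p.n ∧ padKey p raw i = X x := by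
  obtain ⟨i, hi, hix⟩ := (h.same (X x)).1 ⟨x, hx, rfl⟩
  refine ⟨i, ?_, hix⟩
  by_contra hn
  rw [padKey, if_neg hn] at hix
  omega

/-- The hits of a query with the hash function given by `a`. -/
def QueryHit (p : Par) (raw X : ℕ → ℕ) (a x : ℕ) : Prop :=
  Hit p X a (queryCell p raw X x) (queryHash p raw a x)

/-- A genuine query exhibits a solution by itself. Conversely a solution lies in a pair of the
staircase, and almost linearity of hashing makes that query a hit for every multiplier. So the
answer does not depend on `a`. -/
theorem exists_genuine_iff {p : Par} {raw X : ℕ → ℕ} (h : Sorted p raw X) (a : ℕ) :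
    (∃ x, x < p.n * p.S ∧ QueryHit p raw X a x ∧ Genuine p raw X x) ↔
      ∃ i j l, i < p.n ∧ j < p.n ∧ l < p.n ∧ padKey p raw j + padKey p raw l = target p raw i ∧
        padKey p raw j ≠ padKey p raw l ∧ padKey p raw j ≠ p.O ∧ padKey p raw l ≠ p.O := by
  constructor
  · rintro ⟨x, hx, -, u, hu, l, hl, h1, h2, h3, h4⟩
    have hi : x / p.S < p.n := Nat.div_lt_of_lt_mul (by rwa [mul_comm])
    have hT := target_lt h.key_lt hi
    -- An element that does not exceed a target is below `3 * p.O`, hence not a padding key.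
    obtain ⟨j, hj, hjx⟩ := h.exists_key (cell_lt (queryCell_lt p raw X x).1 hu) (by omega)
    rw [← hjx] at h1 h2 h3
    exact ⟨_, j, l, hi, hj, hl, h1, h2, h3, h4⟩
  · rintro ⟨i, j, l, hi, hj, hl, h1, h2, h3, h4⟩
    have hnP := p.n_lt_P
    have hg := p.g_pos
    obtain ⟨x, hx, hxj⟩ := (h.same (padKey p raw j)).2 ⟨j, by omega, rfl⟩
    obtain ⟨y, hy, hyl⟩ := (h.same (padKey p raw l)).2 ⟨l, by omega, rfl⟩
    have hxy : X x + X y = target p raw i := by rw [hxj, hyl, h1]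
    rw [← p.R_mul_g] at hx hy
    obtain ⟨τ, hτ, hst⟩ := stair_complete p.R_pos hg
      (fun a b hab hb => h.mono a b hab (by rwa [← p.R_mul_g])) hx hy hxy
    change τ < p.S at hτ
    have hd : (i * p.S + τ) / p.S = i := by
      rw [mul_comm, Nat.mul_add_div p.S_pos, Nat.div_eq_of_lt hτ, add_zero]
    have hm : (i * p.S + τ) % p.S = τ := by
      rw [Nat.add_mod, Nat.mul_mod_left, zero_add, Nat.mod_mod, Nat.mod_eq_of_lt hτ]
    have hcell : queryCell p raw X (i * p.S + τ) = (x / p.g, y / p.g) := by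
      rw [queryCell, hd, hm, hst]
    refine ⟨i * p.S + τ, ?_, ?_, ?_⟩
    · have : (i + 1) * p.S ≤ p.n * p.S := Nat.mul_le_mul_right _ hi
      rw [add_mul, one_mul] at this
      have : τ < p.S := hτ
      omega
    · obtain ⟨e, he, hh⟩ := hash_add (a := a) p.W_eq p.L_pos hxy
      refine ⟨x % p.g, y % p.g, e, Nat.mod_lt _ hg, Nat.mod_lt _ hg, he, ?_⟩
      rw [hcell, queryHash, hd, Nat.div_add_mod', Nat.div_add_mod']
      exact hh
    · refine ⟨x % p.g, Nat.mod_lt _ hg, l, hl, ?_⟩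
      rw [hcell, hd, Nat.div_add_mod', hxj]
      exact ⟨h1, h2, h3, h4⟩

/-- The query is hit whatever the hash function is, but not because of a solution. -/
def Degenerate (p : Par) (raw X : ℕ → ℕ) (x : ℕ) : Prop :=
  ∃ u v, u < p.g ∧ v < p.g ∧
    X ((queryCell p raw X x).1 * p.g + u) + X ((queryCell p raw X x).2 * p.g + v) =
      target p raw (x / p.S) ∧
    ¬ Good p raw (target p raw (x / p.S)) (X ((queryCell p raw X x).1 * p.g + u))

-- An exact sum is no solution only if both summands are equal or one of them represents 0. For a
-- given target this leaves three values for the first summand. The value fixes both summands, hence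
-- the pair of groups, hence the place on the staircase.
open Classical in
theorem card_degenerate_le {p : Par} {raw X : ℕ → ℕ} (h : Sorted p raw X) :
    ((Finset.range (p.n * p.S)).filter (Degenerate p raw X)).card ≤ 3 * p.n := by
  have hg := p.g_pos
  -- The first summand when the summands are equal, when the first represents 0, and when the second
  -- does.
  let val (i : ℕ) (m : ℕ) : ℕ :=
    if m = 0 then target p raw i / 2 else if m = 1 then p.O else target p raw i - p.O
  have hcard : (Finset.range p.n ×ˢ Finset.range 3).card = 3 * p.n := by
    rw [Finset.card_product, Finset.card_range, Finset.card_range, mul_comm]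
  rw [← hcard]
  refine Finset.card_le_card_of_forall_subsingleton (fun x b => x / p.S = b.1 ∧ ∃ u v,
    u < p.g ∧ v < p.g ∧ X ((queryCell p raw X x).1 * p.g + u) = val b.1 b.2 ∧
    X ((queryCell p raw X x).1 * p.g + u) + X ((queryCell p raw X x).2 * p.g + v) =
      target p raw b.1) ?_ ?_
  · intro x hx
    rw [Finset.mem_filter, Finset.mem_range] at hx
    obtain ⟨hx, u, v, hu, hv, hs, hG⟩ := hx
    have hi : x / p.S < p.n := Nat.div_lt_of_lt_mul (by rwa [mul_comm])
    have hT := target_lt h.key_lt hi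
    obtain ⟨l, hl, hlx⟩ := h.exists_key (cell_lt (queryCell_lt p raw X x).2 hv) (by omega)
    have hcase : X ((queryCell p raw X x).1 * p.g + u) = X ((queryCell p raw X x).2 * p.g + v) ∨
        X ((queryCell p raw X x).1 * p.g + u) = p.O ∨
        X ((queryCell p raw X x).2 * p.g + v) = p.O := by
      by_contra hn
      push Not at hn
      exact hG ⟨l, hl, by rw [hlx, hs], by rw [hlx]; exact hn.1, hn.2.1, by rw [hlx]; exact hn.2.2⟩
    rcases hcase with hc | hc | hc
    · exact ⟨(x / p.S, 0), by simp [hi], rfl, u, v, hu, hv, by simp only [val, if_true]; omega, hs⟩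
    · exact ⟨(x / p.S, 1), by simp [hi], rfl, u, v, hu, hv, by simp [val, hc], hs⟩
    · exact ⟨(x / p.S, 2), by simp [hi], rfl, u, v, hu, hv, by simp [val]; omega, hs⟩
  · rintro ⟨i, m⟩ -
    rintro x ⟨-, hxi, u, v, hu, hv, h1, h2⟩ y ⟨-, hyi, u', v', hu', hv', h1', h2'⟩
    simp only at hxi h1 h2 hyi h1' h2'
    have hcx := queryCell_lt p raw X x
    have hcy := queryCell_lt p raw X y
    have k1 := h.inj (cell_lt hcx.1 hu) (cell_lt hcy.1 hu') (by rw [h1, h1'])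
    have k2 := h.inj (cell_lt hcx.2 hv) (cell_lt hcy.2 hv') (by omega)
    have d1 : (queryCell p raw X x).1 = (queryCell p raw X y).1 := by
      have := congrArg (· / p.g) k1
      simpa [mul_comm _ p.g, Nat.mul_add_div hg, Nat.div_eq_of_lt hu, Nat.div_eq_of_lt hu'] using this
    have d2 : (queryCell p raw X x).2 = (queryCell p raw X y).2 := by
      have := congrArg (· / p.g) k2
      simpa [mul_comm _ p.g, Nat.mul_add_div hg, Nat.div_eq_of_lt hv, Nat.div_eq_of_lt hv'] using this
    -- Two queries with the same target and the same pair of groups coincide, because the pair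
    -- determines the position.
    have s1 := stair_sum (X := X) (g := p.g) (T := target p raw (x / p.S)) p.R_pos
      (Nat.mod_lt x p.S_pos)
    have s2 := stair_sum (X := X) (g := p.g) (T := target p raw (y / p.S)) p.R_pos
      (Nat.mod_lt y p.S_pos)
    change (queryCell p raw X x).1 + _ = x % p.S + (queryCell p raw X x).2 at s1
    change (queryCell p raw X y).1 + _ = y % p.S + (queryCell p raw X y).2 at s2
    rw [← Nat.div_add_mod x p.S, ← Nat.div_add_mod y p.S, hxi, hyi]
    omega

-- Union bound over the `g * g` pairs of elements. Neither genuine nor degenerate means that no pair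
-- has exactly the target as its sum, so each pair misses it by some nonzero `d`, and a hit forces a
-- multiple of `d` into a short window.
open Classical in
theorem card_falsePositive_le {p : Par} {raw X : ℕ → ℕ} (h : Sorted p raw X) {x : ℕ}
    (hx : x < p.n * p.S) :
    ((Finset.range (2 ^ p.w)).filter fun a =>
      QueryHit p raw X a x ∧ ¬ Genuine p raw X x ∧ ¬ Degenerate p raw X x).card
      ≤ p.g * p.g * (10 * p.L) := by
  have hi : x / p.S < p.n := Nat.div_lt_of_lt_mul (by rwa [mul_comm])
  have hT := target_lt h.key_lt hi
  have hOL := p.O_le_L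
  have hO := p.O_pos
  set T := target p raw (x / p.S) with hTd
  let A (u : ℕ) := X ((queryCell p raw X x).1 * p.g + u)
  let B (v : ℕ) := X ((queryCell p raw X x).2 * p.g + v)
  -- The absolute difference: one of the two truncated differences is zero.
  let d (b : ℕ × ℕ) : ℕ := (A b.1 + B b.2 - T) + (T - (A b.1 + B b.2))
  let F (b : ℕ × ℕ) : Finset ℕ := if d b = 0 then ∅ else
    (Finset.range (2 ^ p.w)).filter fun a => (a * d b + 2 * p.L) % 2 ^ p.w < 4 * p.L
  have hcard : (Finset.range p.g ×ˢ Finset.range p.g).card = p.g * p.g := by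
    rw [Finset.card_product, Finset.card_range]
  have hA : ∀ u, u < p.g → A u < 5 * p.O := fun u hu => h.lt (cell_lt (queryCell_lt p raw X x).1 hu)
  have hB : ∀ u, u < p.g → B u < 5 * p.O := fun u hu => h.lt (cell_lt (queryCell_lt p raw X x).2 hu)
  rw [← hcard]
  refine (Finset.card_le_card (t := (Finset.range p.g ×ˢ Finset.range p.g).biUnion F) ?_).trans
    (Finset.card_biUnion_le_card_mul _ _ _ ?_)
  · intro a ha
    rw [Finset.mem_filter] at ha
    obtain ⟨ha, ⟨u, v, e, hu, hv, he, hh⟩, hG, hD⟩ := ha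
    rw [Finset.mem_biUnion]
    refine ⟨(u, v), by simp [hu, hv], ?_⟩
    have hd0 : d (u, v) ≠ 0 := by
      intro h0
      have hs : A u + B v = T := by simp only [d] at h0; omega
      refine hD ⟨u, v, hu, hv, hs, fun hg => hG ⟨u, hu, hg⟩⟩
    simp only [F, if_neg hd0]
    rw [Finset.mem_filter]
    refine ⟨ha, window_of_hash p.W_eq p.L_pos he (x := A u) (y := B v) (T := T) ?_ hh⟩
    simp only [d]
    omega
  · rintro ⟨u, v⟩ hb
    simp only [Finset.mem_product, Finset.mem_range] at hb
    have h1 := hA u hb.1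
    have h2 := hB v hb.2
    simp only [F]
    split_ifs with h0
    · simp
    · refine card_window_le (by omega) ?_
      simp only [d]
      omega

-- Degenerate queries are charged to every multiplier. The others are counted by exchanging the sums
-- over multipliers and queries.
open Classical in
theorem sum_card_hits_le {p : Par} {raw X : ℕ → ℕ} (h : Sorted p raw X) :
    ∑ a ∈ Finset.range (2 ^ p.w), ((Finset.range (p.n * p.S)).filter fun x =>
        QueryHit p raw X a x ∧ ¬ Genuine p raw X x).card
      ≤ 2 ^ p.w * (3 * p.n) + p.n * p.S * (p.g * p.g * (10 * p.L)) := by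
  have h1 : ∀ a, ((Finset.range (p.n * p.S)).filter fun x =>
        QueryHit p raw X a x ∧ ¬ Genuine p raw X x).card ≤ 3 * p.n +
      ((Finset.range (p.n * p.S)).filter fun x =>
        QueryHit p raw X a x ∧ ¬ Genuine p raw X x ∧ ¬ Degenerate p raw X x).card := by
    intro a
    refine le_trans ?_ (Nat.add_le_add_right (card_degenerate_le h) _)
    refine (Finset.card_le_card ?_).trans (Finset.card_union_le _ _)
    intro x hx
    rw [Finset.mem_filter] at hx
    rw [Finset.mem_union, Finset.mem_filter, Finset.mem_filter]
    by_cases hD : Degenerate p raw X x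
    · exact Or.inl ⟨hx.1, hD⟩
    · exact Or.inr ⟨hx.1, hx.2.1, hx.2.2, hD⟩
  refine (Finset.sum_le_sum fun a _ => h1 a).trans ?_
  rw [Finset.sum_add_distrib, Finset.sum_const, Finset.card_range, smul_eq_mul]
  refine Nat.add_le_add_left ?_ _
  refine (Finset.sum_card_bipartiteAbove_eq_sum_card_bipartiteBelow fun a x =>
    QueryHit p raw X a x ∧ ¬ Genuine p raw X x ∧ ¬ Degenerate p raw X x).le.trans ?_
  refine (Finset.sum_le_sum fun x hx => card_falsePositive_le h (Finset.mem_range.1 hx)).trans ?_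
  rw [Finset.sum_const, Finset.card_range, smul_eq_mul]

end WordRam

/-! ### The complete program. -/

namespace WordRam

/-! ### The program -/

/-- Compute the parameters and the sorted sequence of keys. -/
def setupCmd (a b d : ℕ) : Cmd := .seq (paramCmd a b d) (.seq keyCmd sortCmd)

/-- The sizes of the instance. -/
def sizesCmd : Cmd :=
  .seq (.assign 50 (.reg 5 * .reg 7 + 1)) <| .seq (.assign 51 (.reg 5 * .reg 7)) <|
  .seq (.assign 52 (.reg 17)) (.assign 53 (.reg 1))

/-- Compute the instance and the queries for the hash function in register `9`. -/
def instanceCmd : Cmd := .seq hashCmd <| .seq buildCmd <| .seq sizesCmd queryCmd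

/-- Start the loop over the queries. -/
def initCmd : Cmd := .seq (.assign 30 0) (.assign 31 ((Ex.reg 30).lt (.reg 12)))

/-- Pose the next query. -/
def askCmd : Cmd := .seq (.assign 50 (.ld 6 (.reg 30))) (.assign 51 (.ld 7 (.reg 30)))

/-- Record the answer. -/
def recordCmd : Cmd :=
  .seq (.store 8 (.reg 30) ((Ex.reg 50).eq 0)) <| .seq (.assign 30 (.reg 30 + 1))
    (.assign 31 ((Ex.reg 30).lt (.reg 12)))

/-- The loop over the queries. -/
def queryLoop (D : SetDisjointnessDS) : Prog :=
  .loop 31 (.seq askCmd.comp (.seq (rename D.query) recordCmd.comp))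

/-- The program for 3SUM. -/
def reduction (D : SetDisjointnessDS) (a b d : ℕ) : Prog :=
  .seq (setupCmd a b d).comp <| .seq (.rand 9) <| .seq instanceCmd.comp <|
    .seq (rename D.prep) <| .seq initCmd.comp <| .seq (queryLoop D) verifyCmd.comp

/-! ### Setting up -/

/-- The state after the keys have been sorted. -/
structure Ready (p : Par) (raw X : ℕ → ℕ) (s : RamState) : Prop where
  env : Env p s
  mem0 : s.mem 0 = raw
  mem1 : s.mem 1 = X
  mem3 : ∀ v, s.mem 3 v ≠ 0 ↔ ∃ i, i < p.n ∧ padKey p raw i = v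

theorem Ready.frame {p : Par} {raw X : ℕ → ℕ} {s s' : RamState} {c : Cmd} (h : Ready p raw X s)
    (hf : Frame c s s') (hc : ∀ r ∈ c.regs, 13 ≤ r ∨ r = 9) (h0 : 0 ∉ c.mems) (h1 : 1 ∉ c.mems)
    (h3 : 3 ∉ c.mems) : Ready p raw X s' where
  env := h.env.frame hf hc
  mem0 := (hf.2 0 h0).trans h.mem0
  mem1 := (hf.2 1 h1).trans h.mem1
  mem3 := by rw [hf.2 3 h3]; exact h.mem3

theorem setupCmd_spec {a b d : ℕ} (ha : a ≤ d) (hb : b ≤ d) (p : Par)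
    (hlam : p.lam = p.n.size) (hrho : p.rho = p.lam * a / d) (hbet : p.bet = p.lam * b / d)
    (hdw : p.lam * d < 2 ^ p.w) (hdw' : d < 2 ^ p.w) {s : RamState} (h0 : s.reg 0 = p.n)
    (h1 : s.reg 1 = p.w) (h3 : s.mem 3 = 0)
    (hkey : ∀ i, i < p.n → padKey p (s.mem 0) i < 2 * p.O)
    (hinj : ∀ i j, i < j → j < p.n → padKey p (s.mem 0) i ≠ padKey p (s.mem 0) j) :
    Tri p.w (setupCmd a b d) s (24 * (p.P * (p.lam + 1)) + 20) fun s' =>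
      ∃ X, Sorted p (s.mem 0) X ∧ Ready p (s.mem 0) X s' := by
  have hw := p.hw
  have hP0 := p.P_pos
  have hlP : p.lam < p.P := Nat.lt_two_pow_self
  refine Tri.mono (T := (p.lam * 3 + 13) + ((p.P * 5 + 2) + (p.lam * (19 * p.P + 1) + 2)))
    (Q := fun s' => ∃ X, Sorted p (s.mem 0) X ∧ Ready p (s.mem 0) X s') ?_ ?_ (fun _ _ h => h)
  swap
  · have : p.lam * 1 ≤ p.lam * p.P := Nat.mul_le_mul_left _ hP0
    have e1 : p.lam * (19 * p.P + 1) = 19 * (p.lam * p.P) + p.lam := by ring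
    have e2 : p.P * (p.lam + 1) = p.lam * p.P + p.P := by ring
    rw [e1, e2]
    omega
  refine Tri.seq ((paramCmd_spec ha hb p hlam hrho hbet hdw hdw' h0 h1).mono le_rfl ?_)
  intro s₁ hf₁ he₁
  have e0 : s₁.mem 0 = s.mem 0 := hf₁.2 0 (by simp [paramCmd, sizeCmd, Cmd.mems])
  have e3 : s₁.mem 3 = 0 := (hf₁.2 3 (by simp [paramCmd, sizeCmd, Cmd.mems])).trans h3
  refine Tri.seq ((keyCmd_spec he₁ e3).mono le_rfl ?_)
  rintro s₂ hf₂ ⟨hk, hm⟩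
  rw [e0] at hk hm
  have he₂ := he₁.frame hf₂ (by decide)
  have e0' : s₂.mem 0 = s.mem 0 := (hf₂.2 0 (by decide)).trans e0
  have hpad : ∀ i j, i < j → j < p.P → padKey p (s.mem 0) i ≠ padKey p (s.mem 0) j := by
    intro i j hij hj
    by_cases hjn : j < p.n
    · exact hinj i j hij hjn
    · by_cases hin : i < p.n
      · have := hkey i hin
        rw [padKey.eq_def p (s.mem 0) j, if_neg hjn]
        omega
      · rw [padKey, padKey, if_neg hjn, if_neg hin]
        omega
  refine (sortCmd_spec (l := p.lam) (by omega) he₂.r4 fun i j hij hj => ?_).mono le_rfl ?_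
  · rw [hk i (hij.trans hj), hk j hj]
    exact hpad i j hij hj
  · rintro s₃ hf₃ ⟨hmono, hsame⟩
    refine ⟨s₃.mem 1, ⟨hkey, hmono, fun v => ?_⟩, he₂.frame hf₃ (by decide),
      (hf₃.2 0 (by decide)).trans e0', rfl, by rw [hf₃.2 3 (by decide)]; exact hm⟩
    refine (hsame v).trans ?_
    constructor <;> rintro ⟨t, ht, h⟩ <;> refine ⟨t, ht, ?_⟩
    · rw [← hk t ht, h]
    · rw [hk t ht, h]

/-! ### The instance and the queries -/

theorem queryHash_lt (p : Par) (raw : ℕ → ℕ) (a x : ℕ) : queryHash p raw a x < p.Q :=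
  hash_lt p.W_eq (by positivity)

/-- The queries as queries to the instance. -/
def toQuery (p : Par) (E raw X : ℕ → ℕ) (a x : ℕ) : (families p E).Query :=
  (⟨1 + (queryCell p raw X x).1 * p.q + queryHash p raw a x / p.q, by
    have h1 : ((queryCell p raw X x).1 + 1) * p.q ≤ p.R * p.q :=
      Nat.mul_le_mul_right _ (queryCell_lt p raw X x).1
    have h2 : queryHash p raw a x / p.q < p.q :=
      Nat.div_lt_of_lt_mul (by rw [p.q_mul_q]; exact queryHash_lt p raw a x)
    rw [add_mul, one_mul] at h1
    rw [length_families_A]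
    omega⟩,
  ⟨(queryCell p raw X x).2 * p.q + queryHash p raw a x % p.q, by
    have h1 : ((queryCell p raw X x).2 + 1) * p.q ≤ p.R * p.q :=
      Nat.mul_le_mul_right _ (queryCell_lt p raw X x).2
    have h2 : queryHash p raw a x % p.q < p.q := Nat.mod_lt _ p.q_pos
    rw [add_mul, one_mul] at h1
    rw [length_families_B]
    omega⟩)

theorem not_isDisjoint_toQuery {p : Par} {E raw X : ℕ → ℕ} {a : ℕ}
    (hE : ∀ x, x < 4 * p.P → E x = entry p X a x) (x : ℕ) :
    ¬ (families p E).IsDisjoint (toQuery p E raw X a x) ↔ QueryHit p raw X a x :=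
  not_isDisjoint_iff hE (queryCell_lt p raw X x).1 (queryCell_lt p raw X x).2
    (queryHash_lt p raw a x) _ rfl rfl

theorem instanceCmd_spec {p : Par} {s : RamState} {raw X : ℕ → ℕ} (hs : Ready p raw X s)
    (hX : Sorted p raw X) {a : ℕ} (h9 : s.reg 9 = a) (h5 : s.mem 5 = 0)
    (hr : ∀ r, 50 ≤ r → s.reg r = 0) (hm : ∀ m, 20 ≤ m → s.mem m = 0) :
    Tri p.w instanceCmd s (10 * p.P + 12 * p.N + p.n * (8 * p.S + 8) + 14) fun s' =>
      ∃ E, (∀ x, x < 4 * p.P → E x = entry p X a x) ∧ Ready p raw X s' ∧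
        high s' = (families p E).input p.w ∧ QueryInv p raw X a (p.n * p.S) s' := by
  have hP1 := p.P_pow_le 3 (by norm_num)
  have hRq := p.Rq_le
  have h1P := p.one_le_P_pow 3
  refine Tri.mono (T := (10 * p.P + 2) + ((12 * p.N + 6) + (4 + (p.n * (8 * p.S + 8) + 2))))
    (Q := fun s' => ∃ E, (∀ x, x < 4 * p.P → E x = entry p X a x) ∧ Ready p raw X s' ∧
        high s' = (families p E).input p.w ∧ QueryInv p raw X a (p.n * p.S) s') ?_ (by omega)
    (fun _ _ h => h)
  refine Tri.seq ((hashCmd_spec hs.env h9).mono le_rfl ?_)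
  intro s₁ hf₁ hE
  rw [hs.mem1] at hE
  have hs₁ := hs.frame hf₁ (by decide) (by decide) (by decide) (by decide)
  refine Tri.seq ((buildCmd_spec hs₁.env (fun y hy => ?_) ((hf₁.2 5 (by decide)).trans h5)
    ((hf₁.2 20 (by decide)).trans (hm 20 (by norm_num)))
    ((hf₁.2 21 (by decide)).trans (hm 21 (by norm_num)))).mono le_rfl ?_)
  · rw [hE y hy]
    exact entry_le p X a y
  rintro s₂ hf₂ ⟨e20, e21, e17⟩
  have hs₂ := hs₁.frame hf₂ (by decide) (by decide) (by decide) (by decide)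
  have m1 : 1 % 2 ^ p.w = 1 := Nat.mod_eq_of_lt (by omega)
  have mR : p.R * p.q % 2 ^ p.w = p.R * p.q := Nat.mod_eq_of_lt (by omega)
  have mR1 : (p.R * p.q + 1) % 2 ^ p.w = p.R * p.q + 1 := Nat.mod_eq_of_lt (by omega)
  have hsz : Tri p.w sizesCmd s₂ 4 fun s' => s'.reg 50 = p.R * p.q + 1 ∧ s'.reg 51 = p.R * p.q ∧
      s'.reg 52 = s₂.reg 17 ∧ s'.reg 53 = p.w := by
    refine Tri.assign_seq (v := p.R * p.q + 1)
      (by simp [hs₂.env.r5, hs₂.env.r7, m1, mR, mR1]) ?_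
    refine Tri.assign_seq (v := p.R * p.q) (by simp [hs₂.env.r5, hs₂.env.r7, mR]) ?_
    refine Tri.assign_seq (v := s₂.reg 17) (by simp) ?_
    exact Tri.assign' (v := p.w) (by simp [hs₂.env.r1]) (by simp)
  refine Tri.seq (hsz.mono le_rfl ?_)
  rintro s₃ hf₃ ⟨e50, e51, e52, e53⟩
  have hs₃ := hs₂.frame hf₃ (by decide) (by decide) (by decide) (by decide)
  have e9 : s₃.reg 9 = a := by
    rw [hf₃.1 9 (by decide), hf₂.1 9 (by decide), hf₁.1 9 (by decide), h9]
  refine (queryCmd_spec hs₃.env e9 (by rw [hs₃.mem0]; exact hX.key_lt)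
    (by rw [hs₃.mem1]; exact fun x hx => hX.lt hx)).mono le_rfl ?_
  intro s₄ hf₄ hq
  rw [hs₃.mem0, hs₃.mem1] at hq
  refine ⟨s₁.mem 4, hE, hs₃.frame hf₄ (by decide) (by decide) (by decide) (by decide), ?_, hq⟩
  -- The data structure must find exactly its input format, so the registers and memories outside it
  -- must still be zero. They are, since no earlier command has touched them.
  rw [input_families, high, RamState.mk.injEq]
  constructor
  · funext r
    rw [hf₄.1 (r + 50) (by simp [queryCmd, stairCmd, Cmd.forUp, Cmd.regs])]
    split_ifs with h0 h1 h2 h3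
    · rw [h0, e50]
    · rw [h1, e51]
    · rw [h2, e52, e17]
    · rw [h3, e53]
    · rw [hf₃.1 (r + 50) (by simp [sizesCmd, Cmd.regs]; omega),
        hf₂.1 (r + 50) (by simp [buildCmd, setCmd, elemCmd, Cmd.forUp, Cmd.regs]),
        hf₁.1 (r + 50) (by simp [hashCmd, Cmd.forUp, Cmd.regs]), hr _ (by omega)]
  · funext m
    rw [hf₄.2 (m + 20) (by simp [queryCmd, stairCmd, Cmd.forUp, Cmd.mems]),
      hf₃.2 (m + 20) (by simp [sizesCmd, Cmd.mems])]
    by_cases h0 : m = 0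
    · subst h0
      simpa using e20
    by_cases h1 : m = 1
    · subst h1
      simpa using e21
    rw [hf₂.2 (m + 20) (by simp [buildCmd, setCmd, elemCmd, Cmd.forUp, Cmd.mems]; omega),
      hf₁.2 (m + 20) (by simp [hashCmd, Cmd.forUp, Cmd.mems]), hm _ (by omega)]
    funext i
    simp [h0, h1]

/-! ### The costs after the choice of the hash function -/

open Classical in
/-- The number of hits that are not due to a solution. -/
noncomputable def falseHits (p : Par) (raw X : ℕ → ℕ) (a : ℕ) : ℕ :=
  ((Finset.range (p.n * p.S)).filter fun x => QueryHit p raw X a x ∧ ¬ Genuine p raw X x).card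

variable {k : ℝ≥0∞} {f : RamState → ℝ≥0∞}

/-- Some input number is the sum of two different ones. -/
def HasSolution (p : Par) (raw : ℕ → ℕ) : Prop :=
  ∃ i j l, i < p.n ∧ j < p.n ∧ l < p.n ∧ padKey p raw j + padKey p raw l = target p raw i ∧
    padKey p raw j ≠ padKey p raw l ∧ padKey p raw j ≠ p.O ∧ padKey p raw l ≠ p.O

open Classical in
theorem verify_cost {p : Par} {s : RamState} {raw X : ℕ → ℕ} (hs : Ready p raw X s)
    (hX : Sorted p raw X) {a : ℕ} (hq : QueryInv p raw X a (p.n * p.S) s)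
    (h8 : ∀ x, x < p.n * p.S → (s.mem 8 x ≠ 0 ↔ QueryHit p raw X a x))
    (hf : ∀ s', (s'.reg 0 ≠ 0 ↔ HasSolution p raw) → f s' = 0) :
    CostLe p.w k f [verifyCmd.comp] s
      (k * (verifyCmd.wt * (8 * (p.n * p.S) + 9 * p.g * (falseHits p raw X a + 1) + 4) : ℕ)) := by
  rw [← add_zero (k * _)]
  refine CostLe.of_tri (by decide) ((verifyCmd_spec hs.env hX.key_lt hs.mem0 hs.mem1 hs.mem3
    (fun x hx => hX.lt hx) (fun x hx => (hq x hx).2.2)).mono ?_ ?_)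
  · rw [falseHits]
    have : ((Finset.range (p.n * p.S)).filter fun x => s.mem 8 x ≠ 0 ∧ ¬ Genuine p raw X x) =
        (Finset.range (p.n * p.S)).filter fun x =>
          QueryHit p raw X a x ∧ ¬ Genuine p raw X x :=
      Finset.filter_congr fun x hx => by rw [h8 x (Finset.mem_range.1 hx)]
    rw [this]
  · rintro s' - h s₁ hs₁
    rw [cost_nil, hf]
    rw [hs₁.1 0 (by decide), h, HasSolution, ← exists_genuine_iff hX a]
    refine exists_congr fun x => ⟨fun hx => ⟨hx.1, (h8 x hx.1).1 hx.2.1, hx.2.2⟩,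
      fun hx => ⟨hx.1, (h8 x hx.1).2 hx.2.1, hx.2.2⟩⟩

end WordRam

/-! ### The loop over the queries, and the cost for a fixed hash function. -/

namespace WordRam

variable {k : ℝ≥0∞} {f : RamState → ℝ≥0∞}

/-- The queries from `x` on, `m` in number. -/
def queriesFrom (p : Par) (E raw X : ℕ → ℕ) (a : ℕ) : ℕ → ℕ → List (families p E).Query
  | 0, _ => []
  | m + 1, x => toQuery p E raw X a x :: queriesFrom p E raw X a m (x + 1)

theorem length_queriesFrom (p : Par) (E raw X : ℕ → ℕ) (a m x : ℕ) :
    (queriesFrom p E raw X a m x).length = m := by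
  induction m generalizing x with
  | zero => rfl
  | succ m ih => rw [queriesFrom, List.length_cons, ih]

/-- The state at the beginning of the `x`-th round of the loop over the queries. -/
structure LoopInv (p : Par) (raw X : ℕ → ℕ) (a x : ℕ) (s : RamState) : Prop where
  ready : Ready p raw X s
  query : QueryInv p raw X a (p.n * p.S) s
  r30 : s.reg 30 = x
  r31 : s.reg 31 = if x < p.n * p.S then 1 else 0
  mem8 : ∀ y, y < x → (s.mem 8 y ≠ 0 ↔ QueryHit p raw X a y)

theorem askCmd_spec {p : Par} {raw X E : ℕ → ℕ} {a x : ℕ} {s : RamState}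
    (h : LoopInv p raw X a x s) (hx : x < p.n * p.S) :
    Tri p.w askCmd s 2 fun s' => LoopInv p raw X a x s' ∧
      high s' = (families p E).pose (toQuery p E raw X a x) (high s) := by
  obtain ⟨h1, h2, -⟩ := h.query x hx
  refine Tri.assign_seq (T := 1) (v := (toQuery p E raw X a x).1) (by simp [h.r30, h1, toQuery]) ?_
  refine Tri.assign' (v := (toQuery p E raw X a x).2) (by simp [h.r30, h2, toQuery]) ⟨⟨?_, ?_, ?_, ?_, ?_⟩, ?_⟩
  · refine ⟨h.ready.env.of_regs fun r hr _ => ?_, h.ready.mem0, h.ready.mem1, h.ready.mem3⟩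
    rw [setReg_reg, if_neg (by omega), setReg_reg, if_neg (by omega)]
  · exact h.query
  · simpa using h.r30
  · simpa using h.r31
  · exact h.mem8
  · rw [SetFamilies.pose, RamState.setReg, RamState.setReg, high, high, RamState.mk.injEq]
    refine ⟨?_, rfl⟩
    funext r
    simp only [RamState.setReg, Function.update_apply]
    by_cases h1 : r = 1
    · simp [h1]
    by_cases h0 : r = 0
    · simp [h0]
    · simp [h0, h1]

theorem glue_loopInv {p : Par} {raw X : ℕ → ℕ} {a x : ℕ} {s : RamState}
    (h : LoopInv p raw X a x s) (d : RamState) : LoopInv p raw X a x (glue s d) where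
  ready := ⟨h.ready.env.of_regs fun r hr _ => by simp only [glue]; rw [if_pos (by omega)],
    h.ready.mem0, h.ready.mem1, h.ready.mem3⟩
  query := h.query
  r30 := h.r30
  r31 := h.r31
  mem8 := h.mem8

theorem recordCmd_spec {p : Par} {raw X E : ℕ → ℕ} {a x : ℕ} {s : RamState}
    (hE : ∀ x, x < 4 * p.P → E x = entry p X a x)
    (h : LoopInv p raw X a x s) (hx : x < p.n * p.S)
    (h50 : s.reg 50 ≠ 0 ↔ (families p E).IsDisjoint (toQuery p E raw X a x)) :
    Tri p.w recordCmd s 3 fun s' => LoopInv p raw X a (x + 1) s' ∧ high s' = high s := by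
  have hnS := p.nS_lt
  have hb : ∀ p' : Prop, [Decidable p'] → (if p' then 1 else 0) % 2 ^ p.w = if p' then 1 else 0 :=
    fun p' _ => bool_mod (by have := p.hw; omega) p'
  have m1 : 1 % 2 ^ p.w = 1 := Nat.mod_eq_of_lt (by omega)
  refine Tri.store_seq (T := 2) (i := x) (v := if s.reg 50 = 0 then 1 else 0) (by simp [h.r30])
    (by simp [hb]) ?_
  refine Tri.assign_seq (T := 1) (v := x + 1)
    (by simp [h.r30, m1, Nat.mod_eq_of_lt (by omega : x + 1 < 2 ^ p.w)]) ?_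
  refine Tri.assign' (v := if x + 1 < p.n * p.S then 1 else 0)
    (by simp [h.ready.env.r12, hb]) ⟨⟨?_, ?_, ?_, ?_, ?_⟩, ?_⟩
  · refine ⟨h.ready.env.of_regs fun r hr _ => ?_, h.ready.mem0, h.ready.mem1, h.ready.mem3⟩
    rw [setReg_reg, if_neg (by omega), setReg_reg, if_neg (by omega)]
    rfl
  · exact h.query
  · simp
  · simp
  · intro y hy
    rcases eq_or_ne y x with rfl | hne
    · rw [← not_isDisjoint_toQuery hE y, ← h50]
      simp
    · have := h.mem8 y (by omega)
      simpa [hne] using this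
  · rw [high, high, RamState.mk.injEq]
    constructor
    · funext r
      rw [setReg_reg, if_neg (by omega), setReg_reg, if_neg (by omega)]
      rfl
    · funext m
      rw [setReg_mem, setReg_mem, setMem_mem, if_neg (by omega)]

/-- Induction on the number of remaining queries, in step with the recursions of `expQueriesTime`
and `AnswersCorrectly`. The expected time of the remaining queries is carried along as a function of
the data structure's current state. -/
theorem loop_cost (D : SetDisjointnessDS) {p : Par} {raw X E : ℕ → ℕ} (hX : Sorted p raw X) {a : ℕ}
    (hE : ∀ x, x < 4 * p.P → E x = entry p X a x)
    (hf : ∀ s', (s'.reg 0 ≠ 0 ↔ HasSolution p raw) → f s' = 0) {m x : ℕ} (hm : x + m = p.n * p.S)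
    {s : RamState} (hs : LoopInv p raw X a x s)
    (hans : AnswersCorrectly p.w D.query (families p E) (queriesFrom p E raw X a m x) (high s)) :
    CostLe p.w k f [queryLoop D, verifyCmd.comp] s
      (k * expQueriesTime p.w D.query (families p E) (queriesFrom p E raw X a m x) (high s) +
        (k * ((3 + askCmd.wt * 2 + recordCmd.wt * 3) * m + 1 + verifyCmd.wt *
          (8 * (p.n * p.S) + 9 * p.g * (falseHits p raw X a + 1) + 4) : ℕ))) := by
  induction m generalizing x s with
  | zero =>
    refine CostLe.mono (CostLe.loop_zero (by decide) (by rw [hs.r31, if_neg (by omega)])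
      (verify_cost hs.ready hX hs.query (fun y hy => hs.mem8 y (by omega)) hf)) ?_
    rw [queriesFrom, expQueriesTime]
    refine le_of_eq ?_
    push_cast
    ring
  | succ m ih =>
    have hx : x < p.n * p.S := by omega
    set rest := queriesFrom p E raw X a m (x + 1) with hrest
    set V := (k * ((3 + askCmd.wt * 2 + recordCmd.wt * 3) * m + 1 + verifyCmd.wt *
          (8 * (p.n * p.S) + 9 * p.g * (falseHits p raw X a + 1) + 4) : ℕ)) with hV
    set Qx := toQuery p E raw X a x with hQx
    have h1 : CostLe p.w k f [queryLoop D, verifyCmd.comp] s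
        (k + (k + (k * (askCmd.wt * 2 : ℕ) + (k +
          (k * expTime p.w D.query ((families p E).pose Qx (high s)) +
            k * expFinal p.w D.query ((families p E).pose Qx (high s))
              (expQueriesTime p.w D.query (families p E) rest) +
            (k * (recordCmd.wt * 3 : ℕ) + V)))))) := by
      refine CostLe.loop_pos (by decide) (by rw [hs.r31, if_pos hx]; norm_num) (CostLe.seq
        (CostLe.of_tri (by decide) ((askCmd_spec (E := E) hs hx).mono le_rfl ?_)))
      rintro s₁ - ⟨hs₁, hh⟩
      rw [← hQx] at hh
      refine CostLe.seq ?_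
      rw [← hh]
      refine CostLe.rename fun d' hd' => ?_
      rw [hh] at hd'
      obtain ⟨ha, hans'⟩ := hans d' hd'
      refine CostLe.mono (CostLe.of_tri (by decide) ((recordCmd_spec hE (glue_loopInv hs₁ d') hx
        ?_).mono le_rfl (Q' := fun s' => CostLe p.w k f [queryLoop D, verifyCmd.comp] s'
          (k * expQueriesTime p.w D.query (families p E) rest d' + V)) ?_)) (le_of_eq ?_)
      · rw [← hQx, ← ha]
        rfl
      · rintro s₂ - ⟨hs₂, hh₂⟩
        rw [high_glue] at hh₂
        have := ih (by omega) hs₂ (by rw [hh₂]; exact hans')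
        rwa [hh₂] at this
      · ring
    refine h1.mono (le_of_eq ?_)
    rw [queriesFrom, expQueriesTime, ← hQx, ← hrest, hV]
    push_cast
    ring

/-- The cost apart from that of the data structure and of the false hits. -/
def baseCost (p : Par) : ℕ :=
  instanceCmd.wt * (10 * p.P + 12 * p.N + p.n * (8 * p.S + 8) + 14) + initCmd.wt * 2 + 5 +
    (3 + askCmd.wt * 2 + recordCmd.wt * 3) * (p.n * p.S) +
    verifyCmd.wt * (8 * (p.n * p.S) + 9 * p.g + 4)

theorem instance_cost (D : SetDisjointnessDS) {p : Par} {raw X : ℕ → ℕ} (hX : Sorted p raw X)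
    (hf : ∀ s', (s'.reg 0 ≠ 0 ↔ HasSolution p raw) → f s' = 0) {s : RamState}
    (hs : Ready p raw X s) {a : ℕ} (h9 : s.reg 9 = a) (h5 : s.mem 5 = 0)
    (hr : ∀ r, 50 ≤ r → s.reg r = 0) (hm : ∀ m, 20 ≤ m → s.mem m = 0)
    (hfit : WordsFit D.c p.N p.w) :
    CostLe p.w k f [.seq instanceCmd.comp <|
      .seq (rename D.prep) <| .seq initCmd.comp <| .seq (queryLoop D) verifyCmd.comp] s
      (k * (D.prepTime p.N + (p.n * p.S : ℕ) * D.queryTime p.N + baseCost p +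
        (verifyCmd.wt * 9 * p.g * falseHits p raw X a : ℕ))) := by
  have hnS := p.nS_lt
  have hb : ∀ p' : Prop, [Decidable p'] → (if p' then 1 else 0) % 2 ^ p.w = if p' then 1 else 0 :=
    fun p' _ => bool_mod (by have := p.hw; omega) p'
  set V := (k * ((3 + askCmd.wt * 2 + recordCmd.wt * 3) * (p.n * p.S) + 1 + verifyCmd.wt *
          (8 * (p.n * p.S) + 9 * p.g * (falseHits p raw X a + 1) + 4) : ℕ)) with hV
  have h1 : CostLe p.w k f [.seq instanceCmd.comp <|
      .seq (rename D.prep) <| .seq initCmd.comp <| .seq (queryLoop D) verifyCmd.comp] s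
      (k + (k * (instanceCmd.wt * (10 * p.P + 12 * p.N + p.n * (8 * p.S + 8) + 14) : ℕ) + (k +
        (k * D.prepTime p.N + k * ((p.n * p.S : ℕ) * D.queryTime p.N) +
          (k + (k * (initCmd.wt * 2 : ℕ) + (k + V))))))) := by
    refine CostLe.seq (CostLe.of_tri (by decide)
      ((instanceCmd_spec hs hX h9 h5 hr hm).mono le_rfl ?_))
    rintro s₁ - ⟨E, hE, hs₁, hh, hq⟩
    have hfit' : WordsFit D.c (families p E).size p.w :=
      le_trans (Nat.pow_le_pow_left (by have := size_families_le p E; omega) _) hfit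
    set qs := queriesFrom p E raw X a (p.n * p.S) 0 with hqs
    refine CostLe.seq (CostLe.mono (CostLe.rename
      (g := expQueriesTime p.w D.query (families p E) qs)
      (V := k + (k * (initCmd.wt * 2 : ℕ) + (k + V))) fun d' hd' => ?_) ?_)
    · rw [hh] at hd'
      have hans := D.correct (families p E) p.w hfit' d' hd' qs
      have hs₂ : Ready p raw X (glue s₁ d') :=
        ⟨hs₁.env.of_regs fun r hr _ => by simp only [glue]; rw [if_pos (by omega)],
          hs₁.mem0, hs₁.mem1, hs₁.mem3⟩
      have hinit : Tri p.w initCmd (glue s₁ d') 2 fun s' =>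
          LoopInv p raw X a 0 s' ∧ high s' = d' := by
        refine Tri.assign_seq (T := 1) (v := 0) (by simp) ?_
        refine Tri.assign' (v := if 0 < p.n * p.S then 1 else 0)
          (by simp [hs₂.env.r12, hb]) ⟨⟨?_, ?_, ?_, ?_, ?_⟩, ?_⟩
        · refine ⟨hs₂.env.of_regs fun r hr _ => ?_, hs₁.mem0, hs₁.mem1, hs₁.mem3⟩
          rw [setReg_reg, if_neg (by omega), setReg_reg, if_neg (by omega)]
        · exact hq
        · simp
        · simp
        · intro y hy
          omega
        · conv_rhs => rw [← high_glue s₁ d']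
          rw [high, high, RamState.mk.injEq]
          refine ⟨funext fun r => ?_, rfl⟩
          rw [setReg_reg, if_neg (by omega), setReg_reg, if_neg (by omega)]
      refine CostLe.mono (CostLe.seq (CostLe.of_tri (by decide) (hinit.mono le_rfl
        (Q' := fun s' => CostLe p.w k f [.seq (queryLoop D) verifyCmd.comp] s'
          (k + (k * expQueriesTime p.w D.query (families p E) qs d' + V))) ?_))) (le_of_eq ?_)
      · rintro s₃ - ⟨hs₃, hh₃⟩
        refine CostLe.seq ?_
        have := loop_cost (k := k) D hX hE hf (m := p.n * p.S) (x := 0) (by omega) hs₃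
          (by rw [hh₃]; exact hans)
        rwa [hh₃] at this
      · ring
    · rw [hh]
      gcongr
      · exact le_iSup_of_le (families p E) (le_iSup_of_le p.w (le_iSup_of_le (size_families_le p E)
          (le_iSup_of_le hfit' le_rfl)))
      -- The amortized time only speaks about nonempty sequences; without queries the total time is
      -- zero.
      · rcases Nat.eq_zero_or_pos (p.n * p.S) with h0 | h0
        · rw [hqs, h0, queriesFrom]
          simp [expFinal, expQueriesTime]
        · have hne : qs ≠ [] := by
            intro h
            have := length_queriesFrom p E raw X a (p.n * p.S) 0
            rw [← hqs, h, List.length_nil] at this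
            omega
          have hle : expFinal p.w D.prep ((families p E).input p.w)
              (expQueriesTime p.w D.query (families p E) qs) / (qs.length : ℝ≥0∞) ≤
              D.queryTime p.N :=
            le_iSup_of_le (families p E) (le_iSup_of_le p.w (le_iSup_of_le (size_families_le p E)
              (le_iSup_of_le hfit' (le_iSup_of_le qs (le_iSup_of_le hne le_rfl)))))
          rw [hqs, length_queriesFrom, ← hqs] at hle
          rw [ENNReal.div_le_iff (by exact_mod_cast h0.ne') (ENNReal.natCast_ne_top _)] at hle
          rwa [mul_comm]
  refine h1.mono (le_of_eq ?_)
  rw [hV, baseCost]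
  push_cast
  ring

end WordRam

/-! ### Averaging over the hash function, and the resulting 3SUM algorithm. -/

namespace WordRam

variable {k : ℝ≥0∞} {f : RamState → ℝ≥0∞}

/-! ### The expected cost of the reduction -/

theorem Par.W_eq_mul (p : Par) : 2 ^ p.w = p.g * p.g * p.L * 2 ^ (2 * p.bet) := by
  have : p.q = p.g * 2 ^ p.bet := by rw [Par.q, Par.g, pow_add]
  rw [p.W_eq, ← p.q_mul_q, this, mul_comm 2 p.bet, pow_mul]
  ring

/-- The fraction of bad multipliers per pair of groups is of order `g * g * L / 2 ^ w = 2 ^ (-2β)`.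
The final `+ 1` pays for the rounding of the quotient. -/
theorem sum_falseHits_le {p : Par} {raw X : ℕ → ℕ} (h : Sorted p raw X) :
    ∑ a ∈ Finset.range (2 ^ p.w), falseHits p raw X a
      ≤ 2 ^ p.w * (3 * p.n + 10 * (p.n * p.S) / 2 ^ (2 * p.bet) + 1) := by
  refine (sum_card_hits_le h).trans ?_
  rw [add_assoc, mul_add]
  refine Nat.add_le_add_left ?_ _
  have h1 := Nat.lt_mul_div_succ (10 * (p.n * p.S)) (Nat.two_pow_pos (2 * p.bet))
  calc p.n * p.S * (p.g * p.g * (10 * p.L)) = p.g * p.g * p.L * (10 * (p.n * p.S)) := by ring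
    _ ≤ p.g * p.g * p.L * (2 ^ (2 * p.bet) * (10 * (p.n * p.S) / 2 ^ (2 * p.bet) + 1)) :=
      Nat.mul_le_mul_left _ h1.le
    _ = 2 ^ p.w * (10 * (p.n * p.S) / 2 ^ (2 * p.bet) + 1) := by rw [p.W_eq_mul]; ring

/-- The cost apart from that of the data structure. -/
def totalCost (a b d : ℕ) (p : Par) : ℕ :=
  (setupCmd a b d).wt * (24 * (p.P * (p.lam + 1)) + 20) + 3 + baseCost p +
    verifyCmd.wt * 9 * p.g * (3 * p.n + 10 * (p.n * p.S) / 2 ^ (2 * p.bet) + 1)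

/-- Both k and f are left free: k = 0 yields correctness of every halting run, k = 1 the expected
time. The bound is a multiple of k because f vanishes at every final state with the right answer. -/
theorem reduction_cost (D : SetDisjointnessDS) {a b d : ℕ} (ha : a ≤ d) (hb : b ≤ d) (p : Par)
    (hlam : p.lam = p.n.size) (hrho : p.rho = p.lam * a / d) (hbet : p.bet = p.lam * b / d)
    (hdw : p.lam * d < 2 ^ p.w) (hdw' : d < 2 ^ p.w) {s : RamState} {raw : ℕ → ℕ}
    (h0 : s.reg 0 = p.n) (h1 : s.reg 1 = p.w) (hr : ∀ r, 50 ≤ r → s.reg r = 0)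
    (hraw : s.mem 0 = raw) (hm : ∀ m, 0 < m → s.mem m = 0)
    (hkey : ∀ i, i < p.n → padKey p raw i < 2 * p.O)
    (hinj : ∀ i j, i < j → j < p.n → padKey p raw i ≠ padKey p raw j)
    (hfit : WordsFit D.c p.N p.w)
    (hf : ∀ s', (s'.reg 0 ≠ 0 ↔ HasSolution p raw) → f s' = 0) :
    CostLe p.w k f [reduction D a b d] s
      (k * (D.prepTime p.N + (p.n * p.S : ℕ) * D.queryTime p.N + totalCost a b d p)) := by
  subst hraw
  set A := D.prepTime p.N + (p.n * p.S : ℕ) * D.queryTime p.N + baseCost p with hA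
  set c := verifyCmd.wt * 9 * p.g with hc
  set B := 3 * p.n + 10 * (p.n * p.S) / 2 ^ (2 * p.bet) + 1 with hB
  have hW : (2 ^ p.w : ℝ≥0∞)⁻¹ * 2 ^ p.w = 1 :=
    ENNReal.inv_mul_cancel (by positivity) (by finiteness)
  refine CostLe.mono (V := k + (k * ((setupCmd a b d).wt * (24 * (p.P * (p.lam + 1)) + 20) : ℕ) +
    (k + (k + k * (A + (c * B : ℕ)))))) (CostLe.seq (CostLe.of_tri (by
      -- The property does not depend on the literals `a`, `b`, `d`; with concrete ones it is
      -- decidable by evaluation.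
      show (setupCmd 0 0 0).Ok
      decide)
    ((setupCmd_spec ha hb p hlam hrho hbet hdw hdw' h0 h1 (hm 3 (by norm_num)) hkey
      hinj).mono le_rfl ?_))) ?_
  · rintro s₁ hf₁ ⟨X, hX, hs₁⟩
    refine CostLe.seq (CostLe.mono (CostLe.rand (V := fun v =>
      k * (A + (c * falseHits p (s.mem 0) X v : ℕ))) fun v hv => ?_) ?_)
    · refine instance_cost D hX hf (s := s₁.setReg 9 v) ⟨hs₁.env.of_regs fun r hr h9 => by
        rw [setReg_reg, if_neg h9], hs₁.mem0, hs₁.mem1, hs₁.mem3⟩ (by simp) ?_ ?_ ?_ hfit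
      · rw [setReg_mem, hf₁.2 5 (by
          simp [setupCmd, paramCmd, sizeCmd, keyCmd, Cmd.forUp, Cmd.mems]; decide)]
        exact hm 5 (by norm_num)
      · intro r hr'
        have hnot : r ∉ (setupCmd a b d).regs := by
          intro hmem
          have : ∀ x ∈ (setupCmd a b d).regs, x < 50 := by
            show ∀ x ∈ (setupCmd 0 0 0).regs, x < 50
            decide
          exact absurd (this r hmem) (by omega)
        rw [setReg_reg, if_neg (by omega), hf₁.1 r hnot]
        exact hr r hr'
      · intro m hm'
        have hnot : m ∉ (setupCmd a b d).mems := by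
          intro hmem
          have : ∀ x ∈ (setupCmd a b d).mems, x < 20 := by
            show ∀ x ∈ (setupCmd 0 0 0).mems, x < 20
            decide
          exact absurd (this m hmem) (by omega)
        rw [setReg_mem, hf₁.2 m hnot]
        exact hm m (by omega)
    · have hle := sum_falseHits_le hX
      rw [← hB] at hle
      have hle' : ∑ v ∈ Finset.range (2 ^ p.w), (falseHits p (s.mem 0) X v : ℝ≥0∞) ≤
          2 ^ p.w * B := by exact_mod_cast hle
      refine add_le_add le_rfl ?_
      -- Averaging over the multiplier: only the number of false hits depends on it, and linearly.
      calc ∑ v ∈ Finset.range (2 ^ p.w), (2 ^ p.w : ℝ≥0∞)⁻¹ *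
            (k * (A + (c * falseHits p (s.mem 0) X v : ℕ)))
          = k * ((2 ^ p.w : ℝ≥0∞)⁻¹ * (2 ^ p.w) * A + c * ((2 ^ p.w : ℝ≥0∞)⁻¹ *
              ∑ v ∈ Finset.range (2 ^ p.w), (falseHits p (s.mem 0) X v : ℝ≥0∞))) := by
            rw [← Finset.mul_sum, ← Finset.mul_sum, Finset.sum_add_distrib, Finset.sum_const,
              Finset.card_range]
            push_cast
            rw [← Finset.mul_sum, nsmul_eq_mul]
            push_cast
            ring
        _ ≤ k * ((2 ^ p.w : ℝ≥0∞)⁻¹ * (2 ^ p.w) * A + c * ((2 ^ p.w : ℝ≥0∞)⁻¹ *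
              (2 ^ p.w * B))) := by gcongr
        _ = k * (A + (c * B : ℕ)) := by
            rw [← mul_assoc (2 ^ p.w : ℝ≥0∞)⁻¹, hW]
            push_cast
            ring
  · refine le_of_eq ?_
    rw [totalCost, ← hc, ← hB, hA]
    push_cast
    ring

/-- The dominant terms of the cost. -/
def mainTerm (p : Par) : ℕ :=
  p.P * (p.lam + 1) + p.N + p.P * p.R + p.P * p.P / 2 ^ (2 * p.bet)

/-- The constant factor of the cost. -/
def costFactor : ℕ :=
  (setupCmd 0 0 0).wt * 44 + 3 + (instanceCmd.wt * 60 + initCmd.wt * 2 + 5 +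
    (3 + askCmd.wt * 2 + recordCmd.wt * 3) * 2 + verifyCmd.wt * 29) + verifyCmd.wt * 9 * 24

/-- Scanning for the degenerate hits costs about `g * n`, which is below `N`. Scanning for the
random false hits costs `g` times about `n * R / 2 ^ (2β)`, and `g * R = P` turns this into `P * P /
2 ^ (2β)`. -/
theorem totalCost_le (a b d : ℕ) (p : Par) : totalCost a b d p ≤ costFactor * mainTerm p := by
  have hP := p.P_pos
  have hR := p.R_pos
  have hn := p.n_lt_P
  have hS : p.S + 1 = 2 * p.R := by rw [Par.S]; omega
  have hq : p.g ≤ p.q := Nat.pow_le_pow_right (by norm_num) (by omega)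
  have hRg := p.R_mul_g
  have hZ : mainTerm p =
    p.P * (p.lam + 1) + p.N + p.P * p.R + p.P * p.P / 2 ^ (2 * p.bet) := rfl
  have h1 : p.P ≤ p.P * (p.lam + 1) := Nat.le_mul_of_pos_right _ (by omega)
  have h2 : p.P ≤ p.P * p.R := Nat.le_mul_of_pos_right _ hR
  have h3 : p.n * p.S ≤ 2 * (p.P * p.R) := by
    calc p.n * p.S ≤ p.P * (2 * p.R) := Nat.mul_le_mul hn.le (by omega)
      _ = 2 * (p.P * p.R) := by ring
  have h4 : p.g * p.P ≤ p.N := by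
    have e1 : p.N = p.Q + 2 + 4 * (p.R * p.g * p.q) + 2 * (p.R * p.q) := by rw [Par.N]; ring
    have e2 : p.g * p.P ≤ p.R * p.g * p.q := by
      rw [hRg, mul_comm]; exact Nat.mul_le_mul_left _ hq
    omega
  have h5 : p.g * p.n ≤ p.g * p.P := Nat.mul_le_mul_left _ hn.le
  have h6 := p.g_le_P
  have h7 : p.g * (10 * (p.n * p.S) / 2 ^ (2 * p.bet)) ≤
      20 * (p.P * p.P / 2 ^ (2 * p.bet)) + 20 := by
    have k1 : p.g * (10 * (p.n * p.S)) ≤ 20 * (p.P * p.P) := by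
      calc p.g * (10 * (p.n * p.S)) ≤ p.g * (10 * (2 * (p.P * p.R))) := by gcongr
        _ = 20 * (p.P * (p.R * p.g)) := by ring
        _ = 20 * (p.P * p.P) := by rw [hRg]
    have hb0 := Nat.two_pow_pos (2 * p.bet)
    have k2 := Nat.lt_mul_div_succ (p.P * p.P) hb0
    have k3 := Nat.mul_div_le (10 * (p.n * p.S)) (2 ^ (2 * p.bet))
    refine Nat.le_of_mul_le_mul_left (c := 2 ^ (2 * p.bet)) ?_ hb0
    calc 2 ^ (2 * p.bet) * (p.g * (10 * (p.n * p.S) / 2 ^ (2 * p.bet)))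
        = p.g * (2 ^ (2 * p.bet) * (10 * (p.n * p.S) / 2 ^ (2 * p.bet))) := by ring
      _ ≤ p.g * (10 * (p.n * p.S)) := Nat.mul_le_mul_left _ k3
      _ ≤ 20 * (p.P * p.P) := k1
      _ ≤ 20 * (2 ^ (2 * p.bet) * (p.P * p.P / 2 ^ (2 * p.bet) + 1)) :=
        Nat.mul_le_mul_left _ k2.le
      _ = _ := by ring
  have hw : (setupCmd a b d).wt = (setupCmd 0 0 0).wt := rfl
  rw [totalCost, baseCost, costFactor, hw]
  have t1 : 24 * (p.P * (p.lam + 1)) + 20 ≤ 44 * mainTerm p := by omega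
  have t2 : 10 * p.P + 12 * p.N + p.n * (8 * p.S + 8) + 14 ≤ 60 * mainTerm p := by
    have : p.n * (8 * p.S + 8) = 8 * (p.n * p.S) + 8 * p.n := by ring
    omega
  have t3 : p.n * p.S ≤ 2 * mainTerm p := by omega
  have t4 : 8 * (p.n * p.S) + 9 * p.g + 4 ≤ 29 * mainTerm p := by omega
  have t5 : p.g * (3 * p.n + 10 * (p.n * p.S) / 2 ^ (2 * p.bet) + 1) ≤ 24 * mainTerm p := by
    have : p.g * (3 * p.n + 10 * (p.n * p.S) / 2 ^ (2 * p.bet) + 1) =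
      3 * (p.g * p.n) + p.g * (10 * (p.n * p.S) / 2 ^ (2 * p.bet)) + p.g := by ring
    have hN2 : 1 ≤ p.N := by rw [Par.N]; omega
    omega
  have t6 : 1 ≤ mainTerm p := by omega
  have u1 := Nat.mul_le_mul_left (setupCmd 0 0 0).wt t1
  have u2 := Nat.mul_le_mul_left instanceCmd.wt t2
  have u3 := Nat.mul_le_mul_left (3 + askCmd.wt * 2 + recordCmd.wt * 3) t3
  have u4 := Nat.mul_le_mul_left verifyCmd.wt t4
  have u5 := Nat.mul_le_mul_left (verifyCmd.wt * 9) t5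
  have u6 := Nat.mul_le_mul_left (initCmd.wt * 2 + 5 + 3) t6
  rw [← mul_assoc] at u5
  linarith

/-! ### The algorithm for 3SUM -/

/-- The parameters for an input of length `n`. -/
def inputPar (a b d w n : ℕ) (ha : a ≤ d) (hb : b ≤ d) (hw : 8 * n.size + 32 ≤ w) : Par where
  w := w
  n := n
  lam := n.size
  rho := n.size * a / d
  bet := n.size * b / d
  n_lt := Nat.lt_size_self n
  rho_le := by
    rcases Nat.eq_zero_or_pos d with rfl | hd
    · simp
    · exact Nat.div_le_of_le_mul (by rw [mul_comm]; exact Nat.mul_le_mul_right _ ha)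
  bet_le := by
    rcases Nat.eq_zero_or_pos d with rfl | hd
    · simp
    · exact Nat.div_le_of_le_mul (by rw [mul_comm]; exact Nat.mul_le_mul_right _ hb)
  hw := hw

theorem two_pow_size_le (n : ℕ) : 2 ^ n.size ≤ (n + 2) ^ 2 := by
  rcases Nat.eq_zero_or_pos n with rfl | hn
  · simp
  · have h1 : 0 < n.size := Nat.size_pos.2 hn
    have h2 : 2 ^ (n.size - 1) ≤ n := Nat.lt_size.1 (by omega)
    have h3 : 2 ^ n.size = 2 * 2 ^ (n.size - 1) := by
      rw [← pow_succ', Nat.sub_add_cancel h1]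
    rw [h3]
    nlinarith

/-- The constant in the lower bound on the word length. -/
def wordConst (D : SetDisjointnessDS) (d : ℕ) : ℕ := 48 + d + 12 * D.c

section Fit

variable {D : SetDisjointnessDS} {a b d w n : ℕ}

theorem pow_le_of_wordsFit {c m : ℕ} (hfit : WordsFit c n w) (hm : m ≤ c) : (n + 2) ^ m ≤ 2 ^ w :=
  (Nat.pow_le_pow_right (by omega) hm).trans hfit

/-- Since `2 ^ n.size ≤ (n + 2) ^ 2`, the exponent `48 = 2 * 8 + 32` suffices. -/
theorem size_le_of_wordsFit (hfit : WordsFit (wordConst D d) n w) : 8 * n.size + 32 ≤ w := by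
  have h1 := pow_le_of_wordsFit (m := 48) hfit (by rw [wordConst]; omega)
  have h2 : 2 ^ (8 * n.size + 32) ≤ (n + 2) ^ 48 := by
    calc 2 ^ (8 * n.size + 32) = (2 ^ n.size) ^ 8 * 2 ^ 32 := by rw [pow_add, mul_comm 8, pow_mul]
      _ ≤ ((n + 2) ^ 2) ^ 8 * (n + 2) ^ 32 :=
        Nat.mul_le_mul (Nat.pow_le_pow_left (two_pow_size_le n) 8)
          (Nat.pow_le_pow_left (by omega) 32)
      _ = (n + 2) ^ 48 := by ring
  exact (Nat.pow_le_pow_iff_right (by norm_num)).1 (h2.trans h1)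

theorem size_mul_lt_of_wordsFit (hfit : WordsFit (wordConst D d) n w) : n.size * d < 2 ^ w := by
  refine lt_of_lt_of_le ?_ (pow_le_of_wordsFit (m := 2 + d) hfit (by rw [wordConst]; omega))
  have h1 : n.size < (n + 2) ^ 2 := Nat.lt_two_pow_self.trans_le (two_pow_size_le n)
  have h2 : d < (n + 2) ^ d := Nat.lt_pow_self (by omega)
  rw [pow_add]
  exact Nat.mul_lt_mul'' h1 h2

theorem lt_of_wordsFit (hfit : WordsFit (wordConst D d) n w) : d < 2 ^ w := by
  refine lt_of_lt_of_le ?_ (pow_le_of_wordsFit (m := d) hfit (by rw [wordConst]; omega))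
  exact Nat.lt_pow_self (by omega)

/-- The instance has size at most `9 * P ^ 4`, hence at most a power of `n + 2` with exponent `12 =
2 * 4 + 4`. So words that are long enough for the 3SUM input are long enough for the data structure.
-/
theorem instance_wordsFit (hfit : WordsFit (wordConst D d) n w) (ha : a ≤ d) (hb : b ≤ d) :
    WordsFit D.c (inputPar a b d w n ha hb (size_le_of_wordsFit hfit)).N w := by
  refine le_trans ?_ (pow_le_of_wordsFit (m := 12 * D.c) hfit (by rw [wordConst]; omega))
  set p := inputPar a b d w n ha hb (size_le_of_wordsFit hfit)
  have h1 := p.N_le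
  have h2 := p.one_le_P_pow 4
  rw [pow_mul]
  refine Nat.pow_le_pow_left ?_ _
  calc p.N + 2 ≤ p.P ^ 4 * 2 ^ 4 := by omega
    _ ≤ ((n + 2) ^ 2) ^ 4 * (n + 2) ^ 4 :=
      Nat.mul_le_mul (Nat.pow_le_pow_left (two_pow_size_le n) 4)
        (Nat.pow_le_pow_left (by omega) 4)
    _ = (n + 2) ^ 12 := by ring

end Fit

theorem natAbs_lt_of_wordsFit {c x w : ℕ} (hc : 8 ≤ c) (hw : 6 ≤ w) (h : WordsFit c x w) :
    x < 2 ^ (w / 4) := by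
  by_contra hn
  have h1 : 2 ^ (w / 4) < x + 2 := by omega
  have h2 : (2 ^ (w / 4)) ^ 8 < (x + 2) ^ 8 := Nat.pow_lt_pow_left h1 (by norm_num)
  have h3 := pow_le_of_wordsFit (m := 8) h hc
  have h4 : 2 ^ w ≤ (2 ^ (w / 4)) ^ 8 := by
    rw [← pow_mul]
    exact Nat.pow_le_pow_right (by norm_num) (by omega)
  omega

/-- The words of the input. -/
def inputWords (w : ℕ) (A : List ℤ) (i : ℕ) : ℕ := (A.getD i 0 % 2 ^ w).toNat

theorem padKey_inputWords {p : Par} {A : List ℤ} (hn : p.n = A.length)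
    (hA : ∀ x ∈ A, x.natAbs < p.O) {i : ℕ} (hi : i < p.n) :
    (padKey p (inputWords p.w A) i : ℤ) = A[i]'(hn ▸ hi) + p.O := by
  have hx := hA (A[i]'(hn ▸ hi)) (List.getElem_mem _)
  have hO := p.O_le_W
  have hpos : (0 : ℤ) < 2 ^ p.w := by positivity
  have hO' : (p.O : ℤ) * 64 ≤ 2 ^ p.w := by exact_mod_cast hO
  rw [padKey, if_pos hi, inputWords, List.getD_eq_getElem _ _ (hn ▸ hi)]
  push_cast
  rw [Int.toNat_of_nonneg (Int.emod_nonneg _ hpos.ne'), Int.emod_add_emod]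
  exact Int.emod_eq_of_lt (by omega) (by omega)

/-- Keys are the numbers plus `O`, so `x + y = z` becomes a sum of two keys equal to the key of z
plus `O`. The condition `x ≠ z` says that `y ≠ 0`, that is, that the key of y is not `O`; likewise
for `y ≠ z`. -/
theorem hasSolution_iff {p : Par} {A : List ℤ} (hn : p.n = A.length)
    (hA : ∀ x ∈ A, x.natAbs < p.O) :
    HasSolution p (inputWords p.w A) ↔ HasThreeSum A := by
  have hk := fun i (hi : i < p.n) => padKey_inputWords hn hA hi
  constructor
  · rintro ⟨i, j, l, hi, hj, hl, h1, h2, h3, h4⟩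
    have e1 := hk i hi
    have e2 := hk j hj
    have e3 := hk l hl
    rw [target] at h1
    refine ⟨_, List.getElem_mem (hn ▸ hj), _, List.getElem_mem (hn ▸ hl), _,
      List.getElem_mem (hn ▸ hi), ?_, ?_, ?_, ?_⟩ <;> omega
  · rintro ⟨x, hx, y, hy, z, hz, h1, h2, h3, h4⟩
    obtain ⟨j, hj, rfl⟩ := List.getElem_of_mem hx
    obtain ⟨l, hl, rfl⟩ := List.getElem_of_mem hy
    obtain ⟨i, hi, rfl⟩ := List.getElem_of_mem hz
    rw [← hn] at hj hl hi
    have e1 := hk i hi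
    have e2 := hk j hj
    have e3 := hk l hl
    refine ⟨i, j, l, hi, hj, hl, ?_, ?_, ?_, ?_⟩
    · rw [target]; omega
    all_goals omega

theorem reduction_cost_input (D : SetDisjointnessDS) {a b d : ℕ} (ha : a ≤ d) (hb : b ≤ d)
    {A : List ℤ} {w : ℕ} (hnd : A.Nodup) (hfit : ThreeSumWordsFit (wordConst D d) A w)
    (hf : ∀ s', (s'.reg 0 ≠ 0 ↔ HasThreeSum A) → f s' = 0) :
    ∃ p : Par, p.n = A.length ∧ p.lam = A.length.size ∧ p.rho = p.lam * a / d ∧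
      p.bet = p.lam * b / d ∧
      cost w k f ([reduction D a b d], threeSumInput w A) ≤
        k * (D.prepTime p.N + (p.n * p.S : ℕ) * D.queryTime p.N + totalCost a b d p) := by
  obtain ⟨hfit, hx⟩ := hfit
  have hw := size_le_of_wordsFit hfit
  refine ⟨inputPar a b d w A.length ha hb hw, rfl, rfl, rfl, rfl, ?_⟩
  set p := inputPar a b d w A.length ha hb hw with hp
  have hA : ∀ x ∈ A, x.natAbs < p.O := fun x h =>
    natAbs_lt_of_wordsFit (by rw [wordConst]; omega) (by have := p.hw; omega) (hx x h)
  have hk := fun i (hi : i < p.n) => padKey_inputWords (p := p) rfl hA hi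
  refine reduction_cost D (raw := inputWords w A) ha hb p rfl rfl rfl
    (size_mul_lt_of_wordsFit hfit) (lt_of_wordsFit hfit) (s := threeSumInput w A) rfl rfl
    (fun r hr => ?_) rfl (fun m hm => ?_) (fun i hi => ?_) (fun i j hij hj h => ?_)
    (instance_wordsFit hfit ha hb) (fun s' hs' => hf s' ?_) _ .rfl
  · simp only [threeSumInput]
    rw [if_neg (by omega), if_neg (by omega)]
  · funext i
    simp only [threeSumInput]
    rw [if_neg (by omega)]
    rfl
  · have h1 := hk i hi
    have h2 := hA _ (List.getElem_mem (l := A) (n := i) hi)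
    change padKey p (inputWords p.w A) i < _
    omega
  · have h1 := hk i (hij.trans hj)
    have h2 := hk j hj
    change padKey p (inputWords p.w A) i = padKey p (inputWords p.w A) j at h
    rw [h, h2] at h1
    have := (hnd.getElem_inj_iff).1 (add_right_cancel h1)
    omega
  · rw [hs']
    exact hasSolution_iff (p := p) rfl hA

/-- The algorithm for 3SUM that uses the data structure. -/
def threeSumAlgorithm (D : SetDisjointnessDS) {a b d : ℕ} (ha : a ≤ d) (hb : b ≤ d) :
    ThreeSumAlgorithm where
  prog := reduction D a b d
  c := wordConst D d
  correct A w hnd hfit s' hs' := by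
    classical
    -- With running time free of charge (k = 0) and a wrong answer costing 1, the total cost is 0,
    -- so no halting run is wrong.
    let f : RamState → ℝ≥0∞ := fun s' => if (s'.reg 0 ≠ 0 ↔ HasThreeSum A) then 0 else 1
    obtain ⟨p, -, -, -, -, h⟩ := reduction_cost_input (k := 0) (f := f) D ha hb hnd hfit
      (fun s' h => if_pos h)
    rw [zero_mul] at h
    have h0 : f s' = 0 := eq_zero_of_cost_eq_zero (le_antisymm h zero_le) hs'
    by_contra hn
    simp only [f, if_neg hn] at h0
    exact one_ne_zero h0

theorem expTime_reduction_le (D : SetDisjointnessDS) {a b d : ℕ} (ha : a ≤ d) (hb : b ≤ d)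
    {A : List ℤ} {w : ℕ} (hnd : A.Nodup) (hfit : ThreeSumWordsFit (wordConst D d) A w) :
    ∃ p : Par, p.n = A.length ∧ p.lam = A.length.size ∧ p.rho = p.lam * a / d ∧
      p.bet = p.lam * b / d ∧
      expTime w (reduction D a b d) (threeSumInput w A) ≤
        D.prepTime p.N + (p.n * p.S : ℕ) * D.queryTime p.N + (costFactor * mainTerm p : ℕ) := by
  obtain ⟨p, h1, h2, h3, h4, h⟩ := reduction_cost_input (k := 1) (f := 0) D ha hb hnd hfit
    (fun _ _ => rfl)
  refine ⟨p, h1, h2, h3, h4, (expTime_le_cost _ _ _).trans (h.trans ?_)⟩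
  rw [one_mul]
  gcongr
  exact totalCost_le a b d p

end WordRam

/-! ### Asymptotics of the parameters. -/

namespace WordRam

/-! ### Lower bounds up to subpolynomial factors -/

/-- The loss δ(n) is taken as the smallest nonnegative exponent for which the bound holds at n, with
constant 1. The hypothesis for each ε says exactly that this loss is eventually small. Infinite
values are treated apart because `toReal` sends them to 0. -/
theorem isOmegaPowSubLittleO_of_eventually {T : ℕ → ℝ≥0∞} {b : ℝ}
    (h : ∀ ε : ℝ, 0 < ε → ∀ᶠ n : ℕ in atTop, ENNReal.ofReal ((n : ℝ) ^ (b - ε)) ≤ T n) :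
    IsOmegaPowSubLittleO T b := by
  classical
  refine ⟨fun n => if T n = ⊤ then 0 else max 0 (b - Real.log (T n).toReal / Real.log n), ?_, 1,
    one_pos, ?_⟩
  · rw [Metric.tendsto_atTop']
    intro ε hε
    obtain ⟨N, hN⟩ := eventually_atTop.1 (h (ε / 2) (by linarith))
    refine ⟨max N 2, fun n hn => ?_⟩
    have hn1 : N ≤ n := (le_max_left _ _).trans hn.le
    have hn2 : 2 ≤ n := (le_max_right _ _).trans hn.le
    have hlog : 0 < Real.log n := Real.log_pos (by exact_mod_cast hn2)
    rw [Real.dist_eq, sub_zero]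
    split_ifs with hT
    · simpa using hε
    · rw [abs_of_nonneg (le_max_left _ _)]
      refine max_lt hε ?_
      have hpos : (0 : ℝ) < n := by exact_mod_cast (by omega : 0 < n)
      have h1 : (n : ℝ) ^ (b - ε / 2) ≤ (T n).toReal :=
        (ENNReal.ofReal_le_iff_le_toReal hT).1 (hN n hn1)
      have h2 := Real.log_le_log (by positivity) h1
      rw [Real.log_rpow hpos] at h2
      have h3 : b - ε / 2 ≤ Real.log (T n).toReal / Real.log n := (le_div_iff₀ hlog).2 h2
      linarith
  · filter_upwards [h 1 one_pos, eventually_ge_atTop 2] with n hn hn2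
    split_ifs with hT
    · rw [hT]; exact le_top
    · have hlog : 0 < Real.log n := Real.log_pos (by exact_mod_cast hn2)
      have hpos : (0 : ℝ) < n := by exact_mod_cast (by omega : 0 < n)
      have h1 : (n : ℝ) ^ (b - 1) ≤ (T n).toReal := (ENNReal.ofReal_le_iff_le_toReal hT).1 hn
      have hT0 : 0 < (T n).toReal := lt_of_lt_of_le (by positivity) h1
      rw [ENNReal.ofReal_le_iff_le_toReal hT, one_mul, Real.rpow_le_iff_le_log hpos hT0,
        ← le_div_iff₀ hlog]
      have := le_max_right 0 (b - Real.log (T n).toReal / Real.log n)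
      linarith

theorem eventually_of_isOmegaPowSubLittleO {T : ℕ → ℝ≥0∞} {b : ℝ} (h : IsOmegaPowSubLittleO T b)
    {ε : ℝ} (hε : 0 < ε) : ∀ᶠ n : ℕ in atTop, ENNReal.ofReal ((n : ℝ) ^ (b - ε)) ≤ T n := by
  obtain ⟨δ, hδ, C, hC, h⟩ := h
  have h1 : ∀ᶠ n : ℕ in atTop, C⁻¹ ≤ (n : ℝ) ^ (ε / 2) :=
    ((tendsto_rpow_atTop (by linarith)).comp tendsto_natCast_atTop_atTop).eventually_ge_atTop _
  filter_upwards [h, h1, hδ.eventually_lt_const (by linarith : (0 : ℝ) < ε / 2),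
    eventually_ge_atTop 1] with n hn hn1 hn2 hn3
  refine le_trans (ENNReal.ofReal_le_ofReal ?_) hn
  have hpos : (1 : ℝ) ≤ n := by exact_mod_cast hn3
  have h0 : (0 : ℝ) < n := by linarith
  calc (n : ℝ) ^ (b - ε) = 1 * (n : ℝ) ^ (b - ε) := (one_mul _).symm
    _ ≤ (C * (n : ℝ) ^ (ε / 2)) * (n : ℝ) ^ (b - ε) := by
        refine mul_le_mul_of_nonneg_right ?_ (by positivity)
        rwa [inv_le_iff_one_le_mul₀' hC] at hn1
    _ = C * (n : ℝ) ^ (b - ε / 2) := by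
        rw [mul_assoc, ← Real.rpow_add h0]
        congr 2
        ring
    _ ≤ C * (n : ℝ) ^ (b - δ n) := by
        refine mul_le_mul_of_nonneg_left (Real.rpow_le_rpow_of_exponent_le hpos ?_) hC.le
        linarith

/-! ### The size of the parameters -/

theorem prepTime_mono (D : SetDisjointnessDS) : Monotone D.prepTime := fun _ _ h =>
  iSup_mono fun _ => iSup_mono fun _ => iSup_mono' fun h1 => ⟨h1.trans h, le_rfl⟩

theorem queryTime_mono (D : SetDisjointnessDS) : Monotone D.queryTime := fun _ _ h =>
  iSup_mono fun _ => iSup_mono fun _ => iSup_mono' fun h1 => ⟨h1.trans h, le_rfl⟩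

theorem Par.N_le_pow (p : Par) : p.N ≤ 9 * 2 ^ (p.lam + (p.lam - p.rho) + 2 * p.bet) := by
  have h := p.rho_le
  have h1 : p.Q ≤ 2 ^ (p.lam + (p.lam - p.rho) + 2 * p.bet) :=
    Nat.pow_le_pow_right (by norm_num) (by omega)
  have h2 : p.R * p.q * p.g ≤ 2 ^ (p.lam + (p.lam - p.rho) + 2 * p.bet) := by
    rw [mul_right_comm, p.R_mul_g, Par.P, Par.q, ← pow_add]
    exact Nat.pow_le_pow_right (by norm_num) (by omega)
  have h3 : p.R * p.q ≤ p.R * p.q * p.g := Nat.le_mul_of_pos_right _ p.g_pos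
  have h4 := Nat.two_pow_pos (p.lam + (p.lam - p.rho) + 2 * p.bet)
  have h5 : p.N = p.Q + 2 + 4 * (p.R * p.q * p.g) + 2 * (p.R * p.q) := by rw [Par.N]; ring
  omega

theorem rpow_two_le {x y : ℝ} (h : x ≤ y) : (2 : ℝ) ^ x ≤ (2 : ℝ) ^ y :=
  Real.rpow_le_rpow_of_exponent_le (by norm_num) h

theorem succ_sq_le (l : ℕ) : (l + 1) ^ 2 ≤ 4 * 2 ^ l := by
  induction l with
  | zero => norm_num
  | succ l ih =>
    rcases Nat.lt_or_ge l 2 with h | h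
    · interval_cases l <;> norm_num
    · rw [pow_succ 2 l]
      nlinarith

section Bounds

variable {p : Par} {a b d l : ℕ}

/-- Rounding ρ down enlarges the groups by a factor of at most 2, which doubles the constant 9 of
`Par.N_le_pow`; rounding β down does no harm here. -/
theorem N_le_rpow (hd : 0 < d) (ha : a ≤ d) (hrho : p.rho = p.lam * a / d)
    (hbet : p.bet = p.lam * b / d) (hl : p.lam ≤ l) :
    (p.N : ℝ) ≤ 18 * 2 ^ ((l : ℝ) * (2 - a / d + 2 * (b / d))) := by
  have hd' : (0 : ℝ) < d := by exact_mod_cast hd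
  have h1 : (p.lam : ℝ) * (a / d) ≤ p.rho + 1 := by
    have := Nat.lt_mul_div_succ (p.lam * a) hd
    rw [← hrho] at this
    rw [← mul_div_assoc, div_le_iff₀ hd', mul_comm ((p.rho : ℝ) + 1)]
    exact_mod_cast this.le
  have h2 : (p.bet : ℝ) ≤ p.lam * (b / d) := by
    have := Nat.mul_div_le (p.lam * b) d
    rw [← hbet] at this
    rw [← mul_div_assoc, le_div_iff₀ hd', mul_comm]
    exact_mod_cast this
  have h3 : (p.N : ℝ) ≤ 9 * 2 ^ ((p.lam + (p.lam - p.rho) + 2 * p.bet : ℝ)) := by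
    have := p.N_le_pow
    have e : (2 : ℝ) ^ ((p.lam + (p.lam - p.rho) + 2 * p.bet : ℝ)) =
        (2 : ℝ) ^ (p.lam + (p.lam - p.rho) + 2 * p.bet : ℕ) := by
      rw [← Real.rpow_natCast]
      push_cast [Nat.cast_sub p.rho_le]
      rfl
    rw [e]
    exact_mod_cast this
  refine h3.trans ?_
  have h4 : (2 : ℝ) ^ ((l : ℝ) * (2 - a / d + 2 * (b / d)) + 1) =
      2 ^ ((l : ℝ) * (2 - a / d + 2 * (b / d))) * 2 := by
    rw [Real.rpow_add (by norm_num), Real.rpow_one]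
  have h5 : (p.lam : ℝ) * (2 - a / d + 2 * (b / d)) ≤ l * (2 - a / d + 2 * (b / d)) := by
    refine mul_le_mul_of_nonneg_right (by exact_mod_cast hl) ?_
    have : (a : ℝ) / d ≤ 1 := (div_le_one hd').2 (by exact_mod_cast ha)
    have : (0 : ℝ) ≤ b / d := by positivity
    linarith
  have h6 := rpow_two_le (x := p.lam + (p.lam - p.rho) + 2 * p.bet)
    (y := l * (2 - a / d + 2 * (b / d)) + 1) (by linarith)
  rw [h4] at h6
  linarith

theorem P_le_rpow (hl : p.lam ≤ l) : (p.P : ℝ) ≤ 2 ^ (l : ℝ) := by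
  rw [Par.P, Real.rpow_natCast]
  exact_mod_cast Nat.pow_le_pow_right (by norm_num) hl

theorem P_mul_R_le_rpow (hd : 0 < d) (hrho : p.rho = p.lam * a / d) (hl : p.lam ≤ l) :
    (p.P : ℝ) * p.R ≤ 2 ^ ((l : ℝ) * (1 + a / d)) := by
  have hd' : (0 : ℝ) < d := by exact_mod_cast hd
  have h1 : (p.rho : ℝ) ≤ p.lam * (a / d) := by
    have := Nat.mul_div_le (p.lam * a) d
    rw [← hrho] at this
    rw [← mul_div_assoc, le_div_iff₀ hd', mul_comm]
    exact_mod_cast this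
  have h2 : (p.R : ℝ) ≤ 2 ^ ((l : ℝ) * (a / d)) := by
    have : (p.R : ℝ) = 2 ^ (p.rho : ℝ) := by rw [Real.rpow_natCast, Par.R]; push_cast; rfl
    rw [this]
    refine rpow_two_le (h1.trans (mul_le_mul_of_nonneg_right (by exact_mod_cast hl) (by positivity)))
  rw [mul_add, mul_one, Real.rpow_add (by norm_num)]
  exact mul_le_mul (P_le_rpow hl) h2 (by positivity) (by positivity)

/-- The factor 4 comes from rounding β down, as `2 ^ (2β)` loses at most that much. -/
theorem quotient_le_rpow (hd : 0 < d) (hb : b ≤ d) (hbet : p.bet = p.lam * b / d)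
    (hl : p.lam ≤ l) :
    ((p.P * p.P / 2 ^ (2 * p.bet) : ℕ) : ℝ) ≤ 4 * 2 ^ ((l : ℝ) * (2 - 2 * (b / d))) := by
  have hd' : (0 : ℝ) < d := by exact_mod_cast hd
  have h1 : (p.lam : ℝ) * (b / d) ≤ p.bet + 1 := by
    have := Nat.lt_mul_div_succ (p.lam * b) hd
    rw [← hbet] at this
    rw [← mul_div_assoc, div_le_iff₀ hd', mul_comm ((p.bet : ℝ) + 1)]
    exact_mod_cast this.le
  have h2 : ((p.P * p.P / 2 ^ (2 * p.bet) : ℕ) : ℝ) ≤ 2 ^ (2 * p.lam - 2 * p.bet : ℝ) := by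
    refine Nat.cast_div_le.trans (le_of_eq ?_)
    rw [Real.rpow_sub (by norm_num), show (2 : ℝ) * p.lam = ((2 * p.lam : ℕ) : ℝ) by push_cast; ring,
      show (2 : ℝ) * p.bet = ((2 * p.bet : ℕ) : ℝ) by push_cast; ring, Real.rpow_natCast,
      Real.rpow_natCast, Par.P, ← pow_add, ← two_mul]
    push_cast
    rfl
  refine h2.trans ?_
  have h3 : (2 : ℝ) ^ ((l : ℝ) * (2 - 2 * (b / d)) + 2) = 2 ^ ((l : ℝ) * (2 - 2 * (b / d))) * 4 := by
    rw [Real.rpow_add (by norm_num)]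
    norm_num
  have h5 : (p.lam : ℝ) * (2 - 2 * (b / d)) ≤ l * (2 - 2 * (b / d)) := by
    refine mul_le_mul_of_nonneg_right (by exact_mod_cast hl) ?_
    have : (b : ℝ) / d ≤ 1 := (div_le_one hd').2 (by exact_mod_cast hb)
    linarith
  have h6 := rpow_two_le (x := 2 * p.lam - 2 * p.bet) (y := (l : ℝ) * (2 - 2 * (b / d)) + 2)
    (by linarith)
  rw [h3] at h6
  linarith

/-- The logarithmic factor of sorting is crudely bounded by a square root; the exponent 3/2 is far
enough below 2. -/
theorem P_mul_le_rpow (hl : p.lam ≤ l) : (p.P : ℝ) * (p.lam + 1) ≤ 2 * 2 ^ ((l : ℝ) * (3 / 2)) := by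
  have h1 : (p.lam + 1 : ℝ) ≤ 2 * 2 ^ ((l : ℝ) / 2) := by
    refine le_of_sq_le_sq ?_ (by positivity)
    rw [mul_pow, ← Real.rpow_natCast ((2 : ℝ) ^ ((l : ℝ) / 2)), ← Real.rpow_mul (by norm_num),
      show (l : ℝ) / 2 * (2 : ℕ) = l by push_cast; ring, Real.rpow_natCast]
    have h2 := succ_sq_le l
    have h3 : (p.lam + 1) ^ 2 ≤ (l + 1) ^ 2 := Nat.pow_le_pow_left (by omega) 2
    norm_num
    exact_mod_cast h3.trans h2
  calc (p.P : ℝ) * (p.lam + 1) ≤ 2 ^ (l : ℝ) * (2 * 2 ^ ((l : ℝ) / 2)) :=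
        mul_le_mul (P_le_rpow hl) h1 (by positivity) (by positivity)
    _ = 2 * (2 ^ (l : ℝ) * 2 ^ ((l : ℝ) / 2)) := by ring
    _ = 2 * 2 ^ ((l : ℝ) * (3 / 2)) := by
        rw [← Real.rpow_add (by norm_num)]
        congr 2
        ring

end Bounds

end WordRam

/-! ### Choice of the exponents, and the two lower bounds. -/

namespace WordRam

/-- The three conditions on σ bring the exponents of `N`, `P * R` and `P * P / 2 ^ (2β)` down to `2
- 2 * σ`. Added up they give `6 * σ ≤ 1`, which also covers the exponent 3/2 of sorting. The
constant is `25 = 2 + 18 + 1 + 4`. -/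
theorem mainTerm_le_rpow {p : Par} {a b d l : ℕ} (hd : 0 < d) (ha : a ≤ d) (hb : b ≤ d)
    (hrho : p.rho = p.lam * a / d) (hbet : p.bet = p.lam * b / d) (hl : p.lam ≤ l) {σ : ℝ}
    (h1 : 2 * σ ≤ a / d - 2 * (b / d)) (h2 : 2 * σ ≤ 1 - a / d) (h3 : 2 * σ ≤ 2 * (b / d)) :
    (mainTerm p : ℝ) ≤ 25 * 2 ^ ((l : ℝ) * (2 - 2 * σ)) := by
  have hl0 : (0 : ℝ) ≤ l := by positivity
  have hm : ∀ x, x ≤ 2 - 2 * σ → (2 : ℝ) ^ ((l : ℝ) * x) ≤ 2 ^ ((l : ℝ) * (2 - 2 * σ)) :=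
    fun x hx => rpow_two_le (mul_le_mul_of_nonneg_left hx hl0)
  have t1 := (P_mul_le_rpow hl).trans
    (mul_le_mul_of_nonneg_left (hm (3 / 2) (by linarith)) (by norm_num : (0 : ℝ) ≤ 2))
  have t2 := (N_le_rpow hd ha hrho hbet hl).trans
    (mul_le_mul_of_nonneg_left (hm _ (by linarith)) (by norm_num : (0 : ℝ) ≤ 18))
  have t3 := (P_mul_R_le_rpow hd hrho hl).trans (hm _ (by linarith))
  have t4 := (quotient_le_rpow hd hb hbet hl).trans
    (mul_le_mul_of_nonneg_left (hm _ (by linarith)) (by norm_num : (0 : ℝ) ≤ 4))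
  have e : (mainTerm p : ℝ) = p.P * (p.lam + 1) + p.N + p.P * p.R +
      ((p.P * p.P / 2 ^ (2 * p.bet) : ℕ) : ℝ) := by
    rw [mainTerm]
    simp only [Nat.cast_add, Nat.cast_mul, Nat.cast_one]
  rw [e]
  linarith

/-- The running time of the algorithm in terms of the times of the data structure on instances of
size `N`. -/
theorem time_threeSumAlgorithm_le (D : SetDisjointnessDS) {a b d : ℕ} (ha : a ≤ d) (hb : b ≤ d)
    (hd : 0 < d) {l N : ℕ} {σ : ℝ}
    (hN : (18 : ℝ) * 2 ^ ((l : ℝ) * (2 - a / d + 2 * (b / d))) ≤ N)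
    (h1 : 2 * σ ≤ a / d - 2 * (b / d)) (h2 : 2 * σ ≤ 1 - a / d) (h3 : 2 * σ ≤ 2 * (b / d)) :
    (threeSumAlgorithm D ha hb).time (2 ^ l - 1) ≤ D.prepTime N +
      ENNReal.ofReal (2 * 2 ^ ((l : ℝ) * (1 + a / d))) * D.queryTime N +
      ENNReal.ofReal (costFactor * 25 * 2 ^ ((l : ℝ) * (2 - 2 * σ))) := by
  refine iSup_le fun A => iSup_le fun w => iSup_le fun hnd => iSup_le fun hlen =>
    iSup_le fun hfit => ?_
  obtain ⟨p, hn, hlam, hrho, hbet, h⟩ := expTime_reduction_le D ha hb hnd hfit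
  -- Inputs of length at most `2 ^ l - 1` have bit length at most `l`.
  have hl : p.lam ≤ l := by
    rw [hlam]
    refine Nat.size_le.2 ?_
    have := Nat.two_pow_pos l
    omega
  have hpN : p.N ≤ N := by exact_mod_cast (N_le_rpow hd ha hrho hbet hl).trans hN
  refine h.trans ?_
  refine add_le_add (add_le_add (prepTime_mono D hpN) (mul_le_mul' ?_ (queryTime_mono D hpN))) ?_
  · rw [← ENNReal.ofReal_natCast]
    refine ENNReal.ofReal_le_ofReal ?_
    have hS : p.n * p.S ≤ p.P * (2 * p.R) :=
      Nat.mul_le_mul p.n_lt_P.le (by rw [Par.S]; omega)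
    have hS' : ((p.n * p.S : ℕ) : ℝ) ≤ p.P * (2 * p.R) := by exact_mod_cast hS
    have := P_mul_R_le_rpow hd hrho hl
    linarith
  · rw [← ENNReal.ofReal_natCast]
    refine ENNReal.ofReal_le_ofReal ?_
    rw [Nat.cast_mul, mul_assoc]
    exact mul_le_mul_of_nonneg_left
      (mainTerm_le_rpow hd ha hb hrho hbet hl h1 h2 h3) (by positivity)

/-- Rational approximations of the exponents. -/
theorem exists_parameters {γ μ : ℝ} (hγ : 0 < γ) (hγ1 : γ < 1) (hμ : 0 < μ) :
    ∃ a b d : ℕ, 0 < d ∧ a ≤ d ∧ b ≤ d ∧ (0 : ℝ) < b / d ∧ γ + 2 * (b / d) ≤ (a : ℝ) / d ∧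
      (a : ℝ) / d ≤ γ + μ ∧ (a : ℝ) / d < 1 := by
  obtain ⟨d, hd⟩ := exists_nat_gt (max (4 / μ) (4 / (1 - γ)))
  have hd1 : 4 / μ < d := (le_max_left _ _).trans_lt hd
  have hd2 : 4 / (1 - γ) < d := (le_max_right _ _).trans_lt hd
  have hd0 : (0 : ℝ) < d := lt_trans (by positivity) hd1
  rw [div_lt_iff₀ hμ] at hd1
  rw [div_lt_iff₀ (by linarith)] at hd2
  have f1 := Nat.lt_floor_add_one (γ * d)
  have f2 := Nat.floor_le (by positivity : 0 ≤ γ * d)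
  have hlt : ((⌊γ * d⌋₊ + 3 : ℕ) : ℝ) < d := by push_cast; nlinarith
  -- In the numerator, 1 makes up for the floor and 2 provides `2 * b` with `b = 1`; a large `d`
  -- makes `3 / d` negligible.
  refine ⟨⌊γ * d⌋₊ + 3, 1, d, by exact_mod_cast hd0, by exact_mod_cast hlt.le, ?_, by positivity,
    ?_, ?_, ?_⟩
  · exact Nat.one_le_iff_ne_zero.2 (by rintro rfl; simp at hd0)
  · rw [le_div_iff₀ hd0, add_mul, mul_assoc, div_mul_cancel₀ _ hd0.ne']
    push_cast
    linarith
  · rw [div_le_iff₀ hd0]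
    push_cast
    nlinarith
  · rwa [div_lt_one hd0]

/-- Sizes of inputs for 3SUM that correspond to the sizes of instances of SetDisjointness. -/
theorem exists_inputSize {κ : ℝ} (hκ : 0 < κ) (hκ2 : κ ≤ 2) {N : ℕ} (hN : 18 ≤ N) :
    ∃ l : ℕ, (18 : ℝ) * 2 ^ ((l : ℝ) * κ) ≤ N ∧ (N : ℝ) ≤ 72 * 2 ^ ((l : ℝ) * κ) := by
  have hN' : (18 : ℝ) ≤ N := by exact_mod_cast hN
  have h1 : (1 : ℝ) ≤ N / 18 := by rw [le_div_iff₀ (by norm_num)]; linarith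
  have h0 : (0 : ℝ) < N / 18 := by linarith
  have hlog : 0 ≤ Real.logb 2 (N / 18) := Real.logb_nonneg (by norm_num) h1
  -- The largest possible `l`. One more step would multiply the power by at most `2 ^ κ ≤ 4`, whence
  -- `72 = 18 * 4`.
  refine ⟨⌊Real.logb 2 (N / 18) / κ⌋₊, ?_, ?_⟩
  · have := Nat.floor_le (div_nonneg hlog hκ.le)
    rw [le_div_iff₀ hκ, Real.le_logb_iff_rpow_le (by norm_num) h0] at this
    linarith
  · have := (Nat.lt_floor_add_one (Real.logb 2 (N / 18) / κ)).le
    rw [div_le_iff₀ hκ, Real.logb_le_iff_le_rpow (by norm_num) h0, add_mul, one_mul,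
      Real.rpow_add (by norm_num)] at this
    have h2 : (2 : ℝ) ^ κ ≤ 2 ^ (2 : ℝ) := rpow_two_le hκ2
    have h3 : (2 : ℝ) ^ (2 : ℝ) = 4 := by norm_num
    rw [h3] at h2
    have h4 : (2 : ℝ) ^ ((⌊Real.logb 2 (N / 18) / κ⌋₊ : ℝ) * κ) * 2 ^ κ ≤
        2 ^ ((⌊Real.logb 2 (N / 18) / κ⌋₊ : ℝ) * κ) * 4 :=
      mul_le_mul_of_nonneg_left h2 (by positivity)
    linarith

theorem rpow_size_le {κ e s : ℝ} {N l : ℕ} (hN : (N : ℝ) ≤ 72 * 2 ^ ((l : ℝ) * κ)) (he : 0 ≤ e)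
    (he2 : e ≤ 2) (hs : κ * e ≤ s) : (N : ℝ) ^ e ≤ 5184 * 2 ^ ((l : ℝ) * s) := by
  calc (N : ℝ) ^ e ≤ (72 * 2 ^ ((l : ℝ) * κ)) ^ e :=
        Real.rpow_le_rpow (by positivity) hN he
    _ = 72 ^ e * 2 ^ ((l : ℝ) * (κ * e)) := by
        rw [Real.mul_rpow (by norm_num) (by positivity), ← Real.rpow_mul (by norm_num), mul_assoc]
    _ ≤ 72 ^ (2 : ℝ) * 2 ^ ((l : ℝ) * s) := by
        refine mul_le_mul (Real.rpow_le_rpow_of_exponent_le (by norm_num) he2)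
          (rpow_two_le (mul_le_mul_of_nonneg_left hs (by positivity))) (by positivity)
          (by positivity)
    _ = 5184 * 2 ^ ((l : ℝ) * s) := by norm_num

/-- Fast data structures give fast algorithms for 3SUM. -/
theorem tradeoff (h3SUM : ThreeSumConjecture) (D : SetDisjointnessDS) {γ : ℝ} (hγ : 0 < γ)
    (hγ1 : γ < 1) : IsOmegaPowSubLittleO
        (fun N => D.prepTime N +
          ENNReal.ofReal ((N : ℝ) ^ ((1 + γ) / (2 - γ))) * D.queryTime N) (2 / (2 - γ)) := by
  have h2γ : 0 < 2 - γ := by linarith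
  refine isOmegaPowSubLittleO_of_eventually fun ε₀ hε₀ => ?_
  -- The cap on ε keeps the exponent `e₂` of the assumed query time nonnegative, so that it can be
  -- transferred from N to n.
  set ε := min ε₀ ((1 - γ) / (2 - γ)) with hε
  have hεpos : 0 < ε := lt_min hε₀ (div_pos (by linarith) h2γ)
  have hε1 : ε ≤ ε₀ := min_le_left _ _
  have hε2 : ε ≤ (1 - γ) / (2 - γ) := min_le_right _ _
  obtain ⟨a, b, d, hd, ha, hb, hη, hθ, hθμ, hθ1⟩ :=
    exists_parameters hγ hγ1 (by linarith : 0 < ε / 2)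
  set θ : ℝ := a / d with hθd
  set η : ℝ := b / d with hηd
  set κ : ℝ := 2 - θ + 2 * η with hκ
  -- The first three bounds control the algorithm's own work, using `γ ≤ θ - 2 * η`. The last one
  -- lets σ be paid from what ε leaves after `θ ≤ γ + ε / 2`.
  obtain ⟨σ, hσ, hs1, hs2, hs3, hs4⟩ : ∃ σ : ℝ, 0 < σ ∧ 2 * σ ≤ γ ∧ 2 * σ ≤ 1 - θ ∧ 2 * σ ≤ 2 * η ∧
      4 * σ ≤ ε := by
    refine ⟨min (min (γ / 2) ((1 - θ) / 2)) (min η (ε / 4)), ?_, ?_, ?_, ?_, ?_⟩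
    · refine lt_min (lt_min ?_ ?_) (lt_min ?_ ?_) <;> linarith
    · have := (min_le_left (min (γ / 2) ((1 - θ) / 2)) (min η (ε / 4))).trans (min_le_left _ _)
      linarith
    · have := (min_le_left (min (γ / 2) ((1 - θ) / 2)) (min η (ε / 4))).trans (min_le_right _ _)
      linarith
    · have := (min_le_right (min (γ / 2) ((1 - θ) / 2)) (min η (ε / 4))).trans (min_le_left _ _)
      linarith
    · have := (min_le_right (min (γ / 2) ((1 - θ) / 2)) (min η (ε / 4))).trans (min_le_right _ _)
      linarith
  have hκ0 : 0 < κ := by linarith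
  have hκγ : κ ≤ 2 - γ := by linarith
  have hb2 : 2 / (2 - γ) ≤ 2 := by rw [div_le_iff₀ h2γ]; linarith
  have hexp : 2 / (2 - γ) - (1 + γ) / (2 - γ) = (1 - γ) / (2 - γ) := by rw [← sub_div]; ring
  have hpos1 : 0 ≤ (1 + γ) / (2 - γ) := by positivity
  set e₂ := (1 - γ) / (2 - γ) - ε with he₂
  have he₂0 : 0 ≤ e₂ := by linarith
  have he₁ : 2 / (2 - γ) - ε = (1 + γ) / (2 - γ) + e₂ := by linarith
  have hκ1 : κ * (2 / (2 - γ) - ε) ≤ 2 - 2 * σ := by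
    have : κ * (2 / (2 - γ) - ε) ≤ (2 - γ) * (2 / (2 - γ) - ε) :=
      mul_le_mul_of_nonneg_right hκγ (by linarith)
    rw [mul_sub (2 - γ), mul_div_cancel₀ _ h2γ.ne'] at this
    nlinarith
  -- Number of queries times time per query: the exponent is at most `2 + (θ - γ) - (2 - γ) * ε`,
  -- hence at most `2 - ε / 2` because `2 - γ > 1`.
  have hκ2 : (1 + θ) + κ * e₂ ≤ 2 - 2 * σ := by
    have : κ * e₂ ≤ (2 - γ) * e₂ := mul_le_mul_of_nonneg_right hκγ he₂0
    rw [he₂, mul_sub (2 - γ), mul_div_cancel₀ _ h2γ.ne', ← he₂] at this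
    nlinarith
  set M := threeSumAlgorithm D ha hb with hM
  set C : ℝ := 5184 + 2 * 5184 + costFactor * 25 with hC
  have hlow := eventually_of_isOmegaPowSubLittleO (h3SUM M) hσ
  obtain ⟨n₀, hn₀⟩ := eventually_atTop.1 hlow
  obtain ⟨l₀, hl₀⟩ : ∃ l₀ : ℕ, ∀ l : ℕ, l₀ ≤ l → 4 * C < 2 ^ ((l : ℝ) * σ) := by
    have : Tendsto (fun l : ℕ => (2 : ℝ) ^ ((l : ℝ) * σ)) atTop atTop :=
      (tendsto_rpow_atTop_of_base_gt_one 2 (by norm_num)).comp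
        (tendsto_natCast_atTop_atTop.atTop_mul_const hσ)
    exact eventually_atTop.1 (this.eventually_gt_atTop _)
  obtain ⟨N₀, hN₀⟩ := exists_nat_gt ((72 : ℝ) * 2 ^ (((l₀ + n₀ + 1 : ℕ) : ℝ) * κ))
  filter_upwards [eventually_ge_atTop (max N₀ 18)] with N hN
  have hN18 : 18 ≤ N := (le_max_right _ _).trans hN
  have hN0 : N₀ ≤ N := (le_max_left _ _).trans hN
  have hN1 : (1 : ℝ) ≤ N := by exact_mod_cast (by omega : 1 ≤ N)
  have hNpos : (0 : ℝ) < N := by linarith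
  refine le_trans (ENNReal.ofReal_le_ofReal (Real.rpow_le_rpow_of_exponent_le hN1
    (by linarith : 2 / (2 - γ) - ε₀ ≤ 2 / (2 - γ) - ε))) ?_
  -- If both terms are this small at size `N`, the algorithm on `2 ^ l - 1` numbers, with `l`
  -- matched to `N`, beats the conjectured bound.
  by_contra! hlt
  obtain ⟨l, hl1, hl2⟩ := exists_inputSize hκ0 (by linarith) hN18
  have hll : l₀ + n₀ + 1 ≤ l := by
    by_contra! h
    have h1 : (2 : ℝ) ^ ((l : ℝ) * κ) ≤ 2 ^ (((l₀ + n₀ + 1 : ℕ) : ℝ) * κ) :=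
      rpow_two_le (mul_le_mul_of_nonneg_right (by exact_mod_cast h.le) hκ0.le)
    have h2 : (N₀ : ℝ) ≤ N := by exact_mod_cast hN0
    linarith
  have hl0' : (0 : ℝ) ≤ l := by positivity
  have hprep : D.prepTime N ≤ ENNReal.ofReal (5184 * 2 ^ ((l : ℝ) * (2 - 2 * σ))) :=
    (le_self_add.trans hlt.le).trans (ENNReal.ofReal_le_ofReal
      (rpow_size_le hl2 (by linarith) (by linarith) hκ1))
  have hquery : D.queryTime N ≤ ENNReal.ofReal ((N : ℝ) ^ e₂) := by
    have h1 := le_add_self.trans hlt.le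
    rw [he₁, Real.rpow_add hNpos, ENNReal.ofReal_mul (by positivity)] at h1
    refine (ENNReal.mul_le_mul_iff_right ?_ ENNReal.ofReal_ne_top).1 h1
    rw [Ne, ENNReal.ofReal_eq_zero, not_le]
    positivity
  have hquery' : ENNReal.ofReal (2 * 2 ^ ((l : ℝ) * (1 + θ))) * D.queryTime N ≤
      ENNReal.ofReal (2 * 5184 * 2 ^ ((l : ℝ) * (2 - 2 * σ))) := by
    refine (mul_le_mul_right hquery _).trans ?_
    rw [← ENNReal.ofReal_mul (by positivity)]
    refine ENNReal.ofReal_le_ofReal ?_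
    have h1 := rpow_size_le (s := κ * e₂) hl2 he₂0 (by linarith) le_rfl
    calc 2 * 2 ^ ((l : ℝ) * (1 + θ)) * (N : ℝ) ^ e₂
        ≤ 2 * 2 ^ ((l : ℝ) * (1 + θ)) * (5184 * 2 ^ ((l : ℝ) * (κ * e₂))) :=
          mul_le_mul_of_nonneg_left h1 (by positivity)
      _ = 2 * 5184 * 2 ^ ((l : ℝ) * ((1 + θ) + κ * e₂)) := by
          rw [mul_add (l : ℝ) (1 + θ), Real.rpow_add (by norm_num)]
          ring
      _ ≤ _ := mul_le_mul_of_nonneg_left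
          (rpow_two_le (mul_le_mul_of_nonneg_left hκ2 hl0')) (by norm_num)
  have htime := time_threeSumAlgorithm_le D ha hb hd (l := l) (N := N) (σ := σ) hl1
    (by rw [← hθd, ← hηd]; linarith) (by rw [← hθd]; exact hs2) (by rw [← hηd]; exact hs3)
  rw [← hM, ← hθd] at htime
  have htime' := htime.trans (add_le_add (add_le_add hprep hquery') le_rfl)
  rw [← ENNReal.ofReal_add (by positivity) (by positivity),
    ← ENNReal.ofReal_add (by positivity) (by positivity)] at htime'
  have hpow : l < 2 ^ l := Nat.lt_two_pow_self
  have hM1 := (hn₀ (2 ^ l - 1) (by omega)).trans htime'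
  rw [ENNReal.ofReal_le_ofReal_iff (by positivity)] at hM1
  have hhalf : (2 : ℝ) ^ ((l : ℝ) - 1) ≤ ((2 ^ l - 1 : ℕ) : ℝ) := by
    have h1 : 2 ^ (l - 1) ≤ 2 ^ l - 1 := by
      have : 2 ^ l = 2 * 2 ^ (l - 1) := by rw [← pow_succ', Nat.sub_add_cancel (by omega)]
      have := Nat.two_pow_pos (l - 1)
      omega
    rw [show (l : ℝ) - 1 = ((l - 1 : ℕ) : ℝ) by rw [Nat.cast_sub (by omega)]; simp,
      Real.rpow_natCast]
    exact_mod_cast h1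
  -- Passing from `2 ^ l` to `2 ^ l - 1 ≥ 2 ^ (l - 1)` loses a factor of at most `2 ^ (2 - σ) ≤ 4`.
  have hM2 : (2 : ℝ) ^ ((l : ℝ) * (2 - σ)) ≤ 4 * ((2 ^ l - 1 : ℕ) : ℝ) ^ (2 - σ) := by
    calc (2 : ℝ) ^ ((l : ℝ) * (2 - σ)) ≤ 2 ^ (2 + ((l : ℝ) - 1) * (2 - σ)) :=
          rpow_two_le (by linarith)
      _ = 4 * (2 ^ ((l : ℝ) - 1)) ^ (2 - σ) := by
          rw [Real.rpow_add (by norm_num), ← Real.rpow_mul (by norm_num)]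
          norm_num
      _ ≤ _ := mul_le_mul_of_nonneg_left
          (Real.rpow_le_rpow (by positivity) hhalf (by linarith)) (by norm_num)
  have hM3 : (2 : ℝ) ^ ((l : ℝ) * (2 - σ)) =
      2 ^ ((l : ℝ) * σ) * 2 ^ ((l : ℝ) * (2 - 2 * σ)) := by
    rw [← Real.rpow_add (by norm_num)]
    congr 1
    ring
  have hM4 : 4 * C * 2 ^ ((l : ℝ) * (2 - 2 * σ)) <
      2 ^ ((l : ℝ) * σ) * 2 ^ ((l : ℝ) * (2 - 2 * σ)) :=
    mul_lt_mul_of_pos_right (hl₀ l (by omega)) (by positivity)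
  rw [hC] at hM4
  linarith

/-- With constant query time the preprocessing needs quadratic time. -/
theorem prepTime_lower_bound (h3SUM : ThreeSumConjecture) (D : SetDisjointnessDS) {K : ℝ≥0}
    (hK : ∀ N, D.queryTime N ≤ K) : IsOmegaPowSubLittleO D.prepTime 2 := by
  refine isOmegaPowSubLittleO_of_eventually fun ε hε => ?_
  obtain ⟨δ, hδ, hδ1, hδε⟩ : ∃ δ : ℝ, 0 < δ ∧ δ < 1 ∧ 4 * δ ≤ ε :=
    ⟨min (1 / 2) (ε / 4), by positivity, (min_le_left _ _).trans_lt (by norm_num),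
      by have := min_le_right (1 / 2) (ε / 4); linarith⟩
  -- With γ near 1 the lower bound has exponent `2 / (1 + δ)`, close to 2, while the factor of the
  -- query time has the smaller exponent `(2 - δ) / (1 + δ)`.
  have h := tradeoff h3SUM D (γ := 1 - δ) (by linarith) (by linarith)
  rw [show (2 : ℝ) - (1 - δ) = 1 + δ by ring, show (1 : ℝ) + (1 - δ) = 2 - δ by ring] at h
  have hδ' : 0 < δ / (1 + δ) := by positivity
  have h1 := eventually_of_isOmegaPowSubLittleO h (half_pos hδ')
  -- Halfway between these two exponents: still above the query term by a positive power of N, and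
  -- above `2 - ε`.
  set β := 2 / (1 + δ) - δ / (1 + δ) / 2 with hβ
  have hβ1 : 0 < β - (2 - δ) / (1 + δ) := by
    have : β - (2 - δ) / (1 + δ) = δ / (1 + δ) / 2 := by rw [hβ]; ring
    rw [this]
    exact half_pos hδ'
  have hβ2 : 0 < β - (2 - ε) := by
    have e1 : 2 - 2 * δ ≤ 2 / (1 + δ) := by
      rw [le_div_iff₀ (by linarith)]
      nlinarith
    have e2 : δ / (1 + δ) ≤ δ := div_le_self hδ.le (by linarith)
    linarith
  have g1 : ∀ᶠ N : ℕ in atTop, 2 * (K : ℝ) ≤ (N : ℝ) ^ (β - (2 - δ) / (1 + δ)) :=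
    ((tendsto_rpow_atTop hβ1).comp tendsto_natCast_atTop_atTop).eventually_ge_atTop _
  have g2 : ∀ᶠ N : ℕ in atTop, (2 : ℝ) ≤ (N : ℝ) ^ (β - (2 - ε)) :=
    ((tendsto_rpow_atTop hβ2).comp tendsto_natCast_atTop_atTop).eventually_ge_atTop _
  filter_upwards [h1, g1, g2, eventually_ge_atTop 1] with N h1 g1 g2 hN
  have hN0 : (0 : ℝ) < N := by exact_mod_cast hN
  have hsum : (N : ℝ) ^ (2 - ε) + (N : ℝ) ^ ((2 - δ) / (1 + δ)) * K ≤ (N : ℝ) ^ β := by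
    have f1 : (N : ℝ) ^ (2 - ε) * 2 ≤ (N : ℝ) ^ β := by
      calc (N : ℝ) ^ (2 - ε) * 2 ≤ (N : ℝ) ^ (2 - ε) * (N : ℝ) ^ (β - (2 - ε)) :=
            mul_le_mul_of_nonneg_left g2 (by positivity)
        _ = (N : ℝ) ^ β := by rw [← Real.rpow_add hN0]; congr 1; ring
    have f2 : (N : ℝ) ^ ((2 - δ) / (1 + δ)) * (2 * K) ≤ (N : ℝ) ^ β := by
      calc (N : ℝ) ^ ((2 - δ) / (1 + δ)) * (2 * K) ≤
            (N : ℝ) ^ ((2 - δ) / (1 + δ)) * (N : ℝ) ^ (β - (2 - δ) / (1 + δ)) :=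
            mul_le_mul_of_nonneg_left g1 (by positivity)
        _ = (N : ℝ) ^ β := by rw [← Real.rpow_add hN0]; congr 1; ring
    linarith
  have h2 : ENNReal.ofReal ((N : ℝ) ^ (2 - ε)) +
      ENNReal.ofReal ((N : ℝ) ^ ((2 - δ) / (1 + δ))) * K ≤
      D.prepTime N + ENNReal.ofReal ((N : ℝ) ^ ((2 - δ) / (1 + δ))) * K := by
    refine le_trans ?_ (h1.trans (add_le_add le_rfl (mul_le_mul_right (hK N) _)))
    rw [← ENNReal.ofReal_coe_nnreal, ← ENNReal.ofReal_mul (by positivity),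
      ← ENNReal.ofReal_add (by positivity) (by positivity)]
    exact ENNReal.ofReal_le_ofReal hsum
  -- The query term is finite because the query time is bounded by a constant, so it cancels.
  exact (ENNReal.add_le_add_iff_right
    (ENNReal.mul_ne_top ENNReal.ofReal_ne_top ENNReal.coe_ne_top)).1 h2

end WordRam

theorem mainTheorem6 (h3SUM : ThreeSumConjecture) (D : SetDisjointnessDS) :
    (∀ γ : ℝ, 0 < γ → γ < 1 →
      IsOmegaPowSubLittleO
        (fun N => D.prepTime N +
          ENNReal.ofReal ((N : ℝ) ^ ((1 + γ) / (2 - γ))) * D.queryTime N)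
        (2 / (2 - γ))) ∧
    ((∃ K : ℝ≥0, ∀ N, D.queryTime N ≤ K) → IsOmegaPowSubLittleO D.prepTime 2) := by
  exact ⟨fun γ h0 h1 => WordRam.tradeoff h3SUM D h0 h1,
    fun ⟨_, hK⟩ => WordRam.prepTime_lower_bound h3SUM D hK⟩
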